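/- Let $\Sigma$ be a closed (compact, boundaryless) smooth surface and $M$ a smooth $n$-manifold with a twisted Poisson structure $(\Pi,H)$: $H$ is a closed $3$-form and $\Pi$ a smooth bivector field whose components $\pi^{ij}$ satisfy, in every chart, $$\pi^{il}\partial_l\pi^{jk}+\pi^{jl}\partial_l\pi^{ki}+\pi^{kl}\partial_l\pi^{ij}=H(\Pi^\#dx^i,\Pi^\#dx^j,\Pi^\#dx^k),\qquad (\Pi^\#\alpha)^i=\pi^{ij}\alpha_j .$$ The fields of the twisted Poisson sigma model are the vector bundle morphisms $(X,A):T\Sigma\to T^*M$, with functional $$S[X,A]=\int_\Sigma\Big(A_i\wedge dX^i+\tfrac12\pi^{ij}(X)A_i\wedge A_j\Big)+\int_{\Sigma^3}H ,$$ where the variation of the last (Wess–Zumino) term is $\int_\Sigma X^*(\iota_{\delta X}H)$. Let $T^*[1]M$, with coordinates $x^i$ (degree $0$) and $p_i$ (degree $1$), carry the vector field $$Q=\pi^{ji}p_j\frac{\partial}{\partial x^i}-\tfrac12C_i^{jk}p_jp_k\frac{\partial}{\partial p_i},\qquad C_i^{jk}=\partial_i\pi^{jk}+H_{ij'k'}\pi^{jj'}\pi^{kk'}.$$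 Let $\hat Q=d_\Sigma+d+\mathcal L_Q$ on $T[1]\Sigma\times T[1]T^*[1]M$, with signs governed by the total degree. A field $(X,A)$ defines a degree preserving map with $x^i\mapsto X^i$, $p_i\mapsto A_i$. It lifts to the $Q$-morphism $f:T[1]\Sigma\to T[1]\Sigma\times T[1]T^*[1]M$ that is the identity on $T[1]\Sigma$ and satisfies $f^*x^i=X^i$, $f^*p_i=A_i$, $d_\Sigma f^*=f^*\hat Q$. Let $\varepsilon:\Sigma\to\Gamma(T^*M)$ be a smooth map, and let $\hat\varepsilon=\mathcal L_{\varepsilon}$ be the vertical vector field of degree $-1$ that is the Lie derivative lift of $\varepsilon_i(\sigma,x)\,\partial/\partial p_i$. The corresponding infinitesimal transformation of the fields is $$\delta_\varepsilon(f^*\,\cdot\,)=f^*\big([\hat Q,\hat\varepsilon]\,\cdot\,\big).$$ We say that $\varepsilon$ defines an infinitesimal gauge transformation of the model if $\delta_{\lambda\varepsilon}S[X,A]=0$ for all fields $(X,A)$ and all $\lambda\in C^\infty(\Sigma)$. **Theorem.** The map $\varepsilon$ defines an infinitesimal gauge transformation of the twisted Poisson sigma model if and only if, for every point $\sigma\in\Sigma$,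 the section $\varepsilon=\varepsilon_\sigma\in\Gamma(T^*M)$ satisfies $$d\varepsilon+\iota_{\Pi^\#\varepsilon}H=0 ,$$ where $d$ is the de Rham differential of $M$. The same condition is also necessary and sufficient for the superfunction $$\tilde H=\tfrac16H_{ijk}\,dx^idx^jdx^k+\tfrac12H_{ijk}\pi^{lk}\,dx^idx^jp_l+dp_i\,dx^i$$ to be $\hat Q$-closed and basic with respect to $\hat\varepsilon$, i.e. $\hat Q\tilde H=0$, $\hat\varepsilon\tilde H=0$ and $[\hat Q,\hat\varepsilon]\tilde H=0$. -/

import Mathlib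

open scoped ContDiff Manifold TensorProduct

noncomputable section

namespace TwistedPSM

/-! ## Superfunctions on a coordinate domain

`W` is an open set of a normed space (the domain of the coordinates of degree `0`).  A superfunction
is an element of `C^∞(W) ⊗ ℝ[ψ_k : k ∈ κ] ⊗ Λ(ξ_j : j ∈ o)`; the `ψ_k` are coordinates of degree `2`
and the `ξ_j` coordinates of degree `1`.  Signs are governed by the total degree. -/

section Super

set_option linter.unusedSectionVars false

variable {E : Type*} [NormedAddCommGroup E] [NormedSpace ℝ E]

/-- Extension by zero of a function on `W`. -/
def ext0 (W : TopologicalSpace.Opens E) (f : W → ℝ) : E → ℝ :=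
  Function.extend Subtype.val f 0

theorem ext0_apply (W : TopologicalSpace.Opens E) (f : W → ℝ) (w : W) : ext0 W f w = f w :=
  Subtype.val_injective.extend_apply f 0 w

theorem ext0_eqOn (W : TopologicalSpace.Opens E) (f : W → ℝ) (g : E → ℝ)
    (h : ∀ w : W, f w = g w) : Set.EqOn (ext0 W f) g W := by
  intro w hw
  exact (ext0_apply W f ⟨w, hw⟩).trans (h ⟨w, hw⟩)

/-- The algebra `C^∞(W)` of smooth real functions on the open set `W`. -/
def Fn (W : TopologicalSpace.Opens E) : Subalgebra ℝ (W → ℝ) where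
  carrier := {f | ContDiffOn ℝ ∞ (ext0 W f) W}
  mul_mem' := by
    intro a b ha hb
    refine (ContDiffOn.mul ha hb).congr (ext0_eqOn W _ _ ?_)
    intro w; simp [ext0_apply]
  add_mem' := by
    intro a b ha hb
    refine (ContDiffOn.add ha hb).congr (ext0_eqOn W _ _ ?_)
    intro w; simp [ext0_apply]
  algebraMap_mem' := by
    intro r
    refine (contDiffOn_const (c := r)).congr (ext0_eqOn W _ _ ?_)
    intro w; simp

/-- The restriction to `W` of a function on the ambient space that is smooth on `W`. -/
def Fn.mk {W : TopologicalSpace.Opens E} (g : E → ℝ) (hg : ContDiffOn ℝ ∞ g W) : Fn W :=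
  ⟨fun w => g w, hg.congr (ext0_eqOn W _ _ fun _ => rfl)⟩

theorem differentiableAt_ext0 {W : TopologicalSpace.Opens E} (f : Fn W) (w : W) :
    DifferentiableAt ℝ (ext0 W f) w :=
  (f.2.contDiffAt (W.isOpen.mem_nhds w.2)).differentiableAt (by simp)

/-- The directional derivative `∂_v` on `C^∞(W)`. -/
def Fn.partial {W : TopologicalSpace.Opens E} (v : E) : Fn W →ₗ[ℝ] Fn W where
  toFun f := Fn.mk (fun w => fderiv ℝ (ext0 W f) w v)
    ((f.2.fderiv_of_isOpen W.isOpen (m := ∞) (by simp)).clm_apply contDiffOn_const)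
  map_add' f g := by
    ext w
    have h : ext0 W (f + g : Fn W) =ᶠ[nhds (w : E)] ext0 W f + ext0 W g := by
      filter_upwards [W.isOpen.mem_nhds w.2] with y hy
      have h1 := ext0_apply W (f + g : Fn W) ⟨y, hy⟩
      have h2 := ext0_apply W f ⟨y, hy⟩
      have h3 := ext0_apply W g ⟨y, hy⟩
      simp only [Pi.add_apply] at h1 h2 h3 ⊢
      rw [h1, h2, h3]
      rfl
    change fderiv ℝ (ext0 W (f + g : Fn W)) w v
      = fderiv ℝ (ext0 W f) w v + fderiv ℝ (ext0 W g) w v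
    rw [h.fderiv_eq, fderiv_add (differentiableAt_ext0 f w) (differentiableAt_ext0 g w)]
    rfl
  map_smul' r f := by
    ext w
    have h : ext0 W (r • f : Fn W) =ᶠ[nhds (w : E)] r • ext0 W f := by
      filter_upwards [W.isOpen.mem_nhds w.2] with y hy
      have h1 := ext0_apply W (r • f : Fn W) ⟨y, hy⟩
      have h2 := ext0_apply W f ⟨y, hy⟩
      simp only [Pi.smul_apply] at h1 h2 ⊢
      rw [h1, h2]
      rfl
    change fderiv ℝ (ext0 W (r • f : Fn W)) w v = r * fderiv ℝ (ext0 W f) w v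
    rw [h.fderiv_eq, fderiv_const_smul (differentiableAt_ext0 f w)]
    rfl

/-- Superfunctions. -/
def SF (W : TopologicalSpace.Opens E) (κ o : Type) : Type _ :=
  Fn W ⊗[ℝ] (MvPolynomial κ ℝ ⊗[ℝ] ExteriorAlgebra ℝ (o → ℝ))

instance (W : TopologicalSpace.Opens E) (κ o : Type) : Ring (SF W κ o) :=
  inferInstanceAs (Ring (Fn W ⊗[ℝ] (MvPolynomial κ ℝ ⊗[ℝ] ExteriorAlgebra ℝ (o → ℝ))))

instance (W : TopologicalSpace.Opens E) (κ o : Type) : Algebra ℝ (SF W κ o) :=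
  inferInstanceAs (Algebra ℝ (Fn W ⊗[ℝ] (MvPolynomial κ ℝ ⊗[ℝ] ExteriorAlgebra ℝ (o → ℝ))))

/-- The tensor product algebra underlying `SF W κ o`. -/
def SF.equiv (W : TopologicalSpace.Opens E) (κ o : Type) :
    SF W κ o ≃ₐ[ℝ] Fn W ⊗[ℝ] (MvPolynomial κ ℝ ⊗[ℝ] ExteriorAlgebra ℝ (o → ℝ)) :=
  AlgEquiv.refl

variable {W : TopologicalSpace.Opens E} {κ o : Type}

/-- A smooth function as a superfunction of degree `0`. -/
def fn (g : Fn W) : SF W κ o := (SF.equiv W κ o).symm (g ⊗ₜ 1)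

/-- The coordinate `ψ_k` of degree `2`. -/
def ev (k : κ) : SF W κ o :=
  (SF.equiv W κ o).symm (1 ⊗ₜ (MvPolynomial.X k ⊗ₜ 1))

/-- The coordinate `ξ_j` of degree `1`. -/
def od [DecidableEq o] (j : o) : SF W κ o :=
  (SF.equiv W κ o).symm (1 ⊗ₜ (1 ⊗ₜ ExteriorAlgebra.ι ℝ (Pi.single j 1)))

/-- A linear operator on superfunctions, from one on the underlying tensor product. -/
def SF.lift (D : Fn W ⊗[ℝ] (MvPolynomial κ ℝ ⊗[ℝ] ExteriorAlgebra ℝ (o → ℝ)) →ₗ[ℝ]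
    Fn W ⊗[ℝ] (MvPolynomial κ ℝ ⊗[ℝ] ExteriorAlgebra ℝ (o → ℝ))) : SF W κ o →ₗ[ℝ] SF W κ o :=
  (SF.equiv W κ o).symm.toLinearMap ∘ₗ D ∘ₗ (SF.equiv W κ o).toLinearMap

/-- The partial derivative in the direction `v` of the coordinates of degree `0`. -/
def dBase (v : E) : SF W κ o →ₗ[ℝ] SF W κ o :=
  SF.lift (TensorProduct.map (Fn.partial v) LinearMap.id)

/-- The partial derivative `∂/∂ψ_k`. -/
def dEv (k : κ) : SF W κ o →ₗ[ℝ] SF W κ o :=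
  SF.lift (TensorProduct.map LinearMap.id
    (TensorProduct.map (MvPolynomial.pderiv k).toLinearMap LinearMap.id))

/-- The (left) partial derivative `∂/∂ξ_j`. -/
def dOd (j : o) : SF W κ o →ₗ[ℝ] SF W κ o :=
  SF.lift (TensorProduct.map LinearMap.id
    (TensorProduct.map LinearMap.id
      (CliffordAlgebra.contractLeft (Q := (0 : QuadraticForm ℝ (o → ℝ))) (LinearMap.proj j))))

/-- The operator `a · D`. -/
def lmul (a : SF W κ o) (D : SF W κ o →ₗ[ℝ] SF W κ o) : SF W κ o →ₗ[ℝ] SF W κ o :=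
  LinearMap.mulLeft ℝ a ∘ₗ D

/-- The graded commutator of two vector fields of odd degree. -/
def oddBracket (D D' : SF W κ o →ₗ[ℝ] SF W κ o) : SF W κ o →ₗ[ℝ] SF W κ o :=
  D ∘ₗ D' + D' ∘ₗ D

end Super

/-! ## The world-sheet `T[1]N` and the bundle `T[1]N × T[1]T^*[1]V` in coordinates -/

/-- Euclidean space. -/
abbrev Eu (n : ℕ) := EuclideanSpace ℝ (Fin n)

/-- The `i`-th vector of the standard basis. -/
abbrev bas {n : ℕ} (i : Fin n) : Eu n := EuclideanSpace.single i 1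

/-- Superfunctions on `T[1]N`, that is, differential forms on `N`. -/
abbrev Forms (N : TopologicalSpace.Opens (Eu 2)) := SF N (Fin 0) (Fin 2)

/-- The de Rham differential of `N`, as the vector field `dσ^a ∂/∂σ^a` on `T[1]N`. -/
def deRham (N : TopologicalSpace.Opens (Eu 2)) : Forms N →ₗ[ℝ] Forms N :=
  ∑ a : Fin 2, lmul (od a) (dBase (bas a))

/-- The coefficient of `dσ^0 dσ^1` in a form on `N`. -/
def topCoeff {N : TopologicalSpace.Opens (Eu 2)} : Forms N →ₗ[ℝ] Fn N :=
  (TensorProduct.rid ℝ (Fn N)).toLinearMap ∘ₗ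
    TensorProduct.map LinearMap.id
      ((TensorProduct.rid ℝ ℝ).toLinearMap ∘ₗ
        TensorProduct.map (MvPolynomial.aeval (fun _ : Fin 0 => (0 : ℝ))).toLinearMap
          (ExteriorAlgebra.algebraMapInv.toLinearMap ∘ₗ
            CliffordAlgebra.contractLeft (Q := (0 : QuadraticForm ℝ (Fin 2 → ℝ)))
              (LinearMap.proj 1) ∘ₗ
            CliffordAlgebra.contractLeft (Q := (0 : QuadraticForm ℝ (Fin 2 → ℝ)))
              (LinearMap.proj 0))) ∘ₗ
    (SF.equiv N (Fin 0) (Fin 2)).toLinearMap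

/-- The integral over `N` of (the top degree part of) a form on `N`. -/
def integralForm {N : TopologicalSpace.Opens (Eu 2)} (α : Forms N) : ℝ :=
  ∫ u in (N : Set (Eu 2)), ext0 N (topCoeff α) u

/-- Indices of the coordinates of degree `1` on `T[1]N × T[1]T^*[1]V`: these are
`η^a = dσ^a`, `p_i` and `θ^i = dx^i`, in this order. -/
abbrev OddIdx (n : ℕ) := Fin 2 ⊕ (Fin n ⊕ Fin n)

/-- Superfunctions on `T[1]N × T[1]T^*[1]V`, where `W = N × V`: the coordinates are
`σ^a, x^i` (degree `0`), `η^a, p_i, θ^i = dx^i` (degree `1`), `ψ_i = dp_i` (degree `2`). -/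
abbrev Tot {n : ℕ} (W : TopologicalSpace.Opens (Eu 2 × Eu n)) := SF W (Fin n) (OddIdx n)

section Total

variable {n : ℕ} {W : TopologicalSpace.Opens (Eu 2 × Eu n)}

/-- `η^a = dσ^a`. -/
def eta (a : Fin 2) : Tot W := od (Sum.inl a)
/-- `p_i`. -/
def pp (i : Fin n) : Tot W := od (Sum.inr (Sum.inl i))
/-- `θ^i = dx^i`. -/
def theta (i : Fin n) : Tot W := od (Sum.inr (Sum.inr i))
/-- `ψ_i = dp_i`. -/
def psi (i : Fin n) : Tot W := ev i
/-- The coordinate function `x^i`. -/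
def xx (i : Fin n) : Tot W :=
  fn (Fn.mk (fun w => w.2 i) (by fun_prop))

/-- `∂/∂x^i` on smooth functions. -/
def Fn.dx (i : Fin n) : Fn W →ₗ[ℝ] Fn W := Fn.partial (0, bas i)

/-- `∂/∂σ^a`. -/
def dSig (a : Fin 2) : Tot W →ₗ[ℝ] Tot W := dBase (bas a, 0)
/-- `∂/∂x^i`. -/
def dX (i : Fin n) : Tot W →ₗ[ℝ] Tot W := dBase (0, bas i)
/-- `∂/∂p_i`. -/
def dP (i : Fin n) : Tot W →ₗ[ℝ] Tot W := dOd (Sum.inr (Sum.inl i))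
/-- `∂/∂θ^i`. -/
def dTh (i : Fin n) : Tot W →ₗ[ℝ] Tot W := dOd (Sum.inr (Sum.inr i))
/-- `∂/∂ψ_i`. -/
def dPsi (i : Fin n) : Tot W →ₗ[ℝ] Tot W := dEv i

/-- The de Rham vector field of `T[1]N`, on the product. -/
def dSheet : Tot W →ₗ[ℝ] Tot W := ∑ a : Fin 2, lmul (eta a) (dSig a)

/-- The de Rham vector field `d = dx^i ∂/∂x^i + dp_i ∂/∂p_i` of `T[1]T^*[1]V`, on the product. -/
def dTarget : Tot W →ₗ[ℝ] Tot W :=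
  ∑ i : Fin n, (lmul (theta i) (dX i) + lmul (psi i) (dP i))

/-- The Lie derivative along the odd vector field `q^i ∂/∂x^i + r_i ∂/∂p_i` of `T^*[1]V`, as an odd
vector field on `T[1]T^*[1]V`; it is determined by its values on `x^i, p_i` and by graded
commutation with `d`: `L(dx^i) = - d q^i`, `L(dp_i) = - d r_i`. -/
def lieLift (q r : Fin n → Tot W) : Tot W →ₗ[ℝ] Tot W :=
  ∑ i : Fin n, (lmul (q i) (dX i) + lmul (r i) (dP i)
    - lmul (dTarget (q i)) (dTh i) - lmul (dTarget (r i)) (dPsi i))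

/-- Components of a bivector and of a `3`-form in coordinates. -/
structure Comps (W : TopologicalSpace.Opens (Eu 2 × Eu n)) where
  /-- `π^{ij}` -/
  bi : Fin n → Fin n → Fn W
  /-- `H_{ijk}` -/
  three : Fin n → Fin n → Fin n → Fn W

variable (c : Comps W)

/-- `C_i^{jk} = ∂π^{jk}/∂x^i + H_{ij'k'} π^{jj'} π^{kk'}`. -/
def Comps.str (i j k : Fin n) : Fn W :=
  Fn.dx i (c.bi j k) + ∑ j', ∑ k', c.three i j' k' * c.bi j j' * c.bi k k'

/-- `Q^i = π^{ji} p_j`. -/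
def Comps.qx (i : Fin n) : Tot W := ∑ j, fn (c.bi j i) * pp j

/-- `Q_i = -½ C_i^{jk} p_j p_k`. -/
def Comps.qp (i : Fin n) : Tot W :=
  -((1 / 2 : ℝ) • ∑ j, ∑ k, fn (c.str i j k) * pp j * pp k)

/-- The vector field `Q̂ = d_Σ + d + L_Q` on `T[1]N × T[1]T^*[1]V`. -/
def Comps.Qhat : Tot W →ₗ[ℝ] Tot W := dSheet + dTarget + lieLift c.qx c.qp

/-- The vertical vector field `ε̂ = L_ε` of degree `-1`, for `ε = ε_i(σ, x) ∂/∂p_i`. -/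
def epsHat (e : Fin n → Fn W) : Tot W →ₗ[ℝ] Tot W := lieLift 0 (fun i => fn (e i))

/-- The degree `3` superfunction
`⅙ H_{ijk} dx^i dx^j dx^k + ½ H_{ijk} π^{lk} dx^i dx^j p_l + dp_i dx^i`. -/
def Comps.Htilde : Tot W :=
  (1 / 6 : ℝ) • (∑ i, ∑ j, ∑ k, fn (c.three i j k) * theta i * theta j * theta k)
    + (1 / 2 : ℝ) • (∑ i, ∑ j, ∑ k, ∑ l,
        fn (c.three i j k) * fn (c.bi l k) * theta i * theta j * pp l)
    + ∑ i, psi i * theta i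

/-- The right hand side of `δ_ε (f^* z) = f^* ([Q̂, ε̂] z)`. -/
def gtVar (e : Fin n → Fn W) {N : TopologicalSpace.Opens (Eu 2)} (f : Tot W →ₐ[ℝ] Forms N)
    (z : Tot W) : Forms N :=
  f (oddBracket c.Qhat (epsHat e) z)

/-- The variation, under `δ_ε` given by `δ_ε (f^* z) = f^* ([Q̂, ε̂] z)`, of the integrand
`A_i dX^i + ½ π^{ij}(X) A_i A_j` of the sigma model functional, where `X^i = f^* x^i`,
`A_i = f^* p_i`. -/
def Comps.kinVar (e : Fin n → Fn W) {N : TopologicalSpace.Opens (Eu 2)}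
    (f : Tot W →ₐ[ℝ] Forms N) : Forms N :=
  ∑ i, (gtVar c e f (pp i) * deRham N (f (xx i))
        + f (pp i) * deRham N (gtVar c e f (xx i)))
    + (1 / 2 : ℝ) • ∑ i, ∑ j,
        (gtVar c e f (fn (c.bi i j)) * f (pp i) * f (pp j)
          + f (fn (c.bi i j)) * gtVar c e f (pp i) * f (pp j)
          + f (fn (c.bi i j)) * f (pp i) * gtVar c e f (pp j))

/-- The `2`-form `X^*(ι_{δX} H) = ½ H_{ijk}(X) δX^i dX^j dX^k` on the surface, whose integral is the
variation of the Wess-Zumino term `∫_{Σ³} H` (for closed `H`). -/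
def Comps.wzVar (e : Fin n → Fn W) {N : TopologicalSpace.Opens (Eu 2)}
    (f : Tot W →ₐ[ℝ] Forms N) : Forms N :=
  (1 / 2 : ℝ) • ∑ i, ∑ j, ∑ k,
    f (fn (c.three i j k)) * gtVar c e f (xx i) * deRham N (f (xx j)) * deRham N (f (xx k))

end Total

/-! ## Geometry of the target and of the fields -/

section Geometry

variable {n : ℕ} {M : Type*} [TopologicalSpace M] [ChartedSpace (Eu n) M]

/-- The coordinate vector field `∂/∂x^i` of the chart `e`, at the point with coordinates `y`. -/
def frame (e : OpenPartialHomeomorph M (Eu n)) (y : Eu n) (i : Fin n) :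
    TangentSpace (𝓡 n) (e.symm y) :=
  mfderiv (𝓡 n) (𝓡 n) e.symm y (bas i : Eu n)

/-- The coordinate covector `dx^i` of the chart `e`, at the point with coordinates `y`. -/
def coframe (e : OpenPartialHomeomorph M (Eu n)) (y : Eu n) (i : Fin n) :
    TangentSpace (𝓡 n) (e.symm y) →L[ℝ] ℝ :=
  (EuclideanSpace.proj i : Eu n →L[ℝ] ℝ).comp (mfderiv (𝓡 n) (𝓡 n) e (e.symm y))

variable (M) in
/-- Bivector fields (not necessarily smooth). -/
abbrev Bivector : Type _ :=
  ∀ x : M, (TangentSpace (𝓡 n) x →L[ℝ] ℝ) [⋀^Fin 2]→ₗ[ℝ] ℝ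

variable (M) in
/-- Differential `3`-forms (not necessarily smooth). -/
abbrev ThreeForm : Type _ := ∀ x : M, TangentSpace (𝓡 n) x [⋀^Fin 3]→ₗ[ℝ] ℝ

/-- The components `π^{ij}` in the chart `e`. -/
def biComp (P : Bivector (n := n) M) (e : OpenPartialHomeomorph M (Eu n)) (i j : Fin n)
    (y : Eu n) : ℝ :=
  P (e.symm y) ![coframe e y i, coframe e y j]

/-- The components `H_{ijk}` in the chart `e`. -/
def threeComp (H : ThreeForm (n := n) M) (e : OpenPartialHomeomorph M (Eu n)) (i j k : Fin n)
    (y : Eu n) : ℝ :=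
  H (e.symm y) ![frame e y i, frame e y j, frame e y k]

/-- The partial derivative `∂g/∂x^i`. -/
def pd (g : Eu n → ℝ) (i : Fin n) (y : Eu n) : ℝ := fderiv ℝ g y (bas i)

variable (n M) in
/-- A twisted Poisson structure `(Π, H)`: `H` is a closed `3`-form, and `Π` is a bivector field with
`π^{il} ∂_l π^{jk} + (cyclic) = H(Π^# dx^i, Π^# dx^j, Π^# dx^k)`, where
`Π^# α = Π(·, α)`, i.e. `(Π^# α)^i = π^{ij} α_j`. The left hand side is the trivector of
the Jacobiator, the Schouten bracket `[Π, Π]` up to normalization. -/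
structure TwistedPoisson where
  P : Bivector (n := n) M
  H : ThreeForm (n := n) M
  smooth_P : ∀ e ∈ atlas (Eu n) M, ∀ i j, ContDiffOn ℝ ∞ (biComp P e i j) e.target
  smooth_H : ∀ e ∈ atlas (Eu n) M, ∀ i j k, ContDiffOn ℝ ∞ (threeComp H e i j k) e.target
  closed : ∀ e ∈ atlas (Eu n) M, ∀ y ∈ e.target, ∀ i j k l,
    pd (threeComp H e j k l) i y - pd (threeComp H e i k l) j y
      + pd (threeComp H e i j l) k y - pd (threeComp H e i j k) l y = 0
  jacobi : ∀ e ∈ atlas (Eu n) M, ∀ y ∈ e.target, ∀ i j k,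
    (∑ l, (biComp P e i l y * pd (biComp P e j k) l y
        + biComp P e j l y * pd (biComp P e k i) l y
        + biComp P e k l y * pd (biComp P e i j) l y))
      = ∑ a, ∑ b, ∑ c, threeComp H e a b c y
          * biComp P e a i y * biComp P e b j y * biComp P e c k y

variable {S : Type*} [TopologicalSpace S] [ChartedSpace (Eu 2) S]

variable (n M S) in
/-- A smooth map from the surface `S` to the space `Γ(T^*M)` of smooth sections of the cotangent
bundle: a family of `1`-forms on `M`, smooth jointly in the point of `S` and the point of `M`. -/
structure SectionMap where
  toFun : S → ∀ x : M, TangentSpace (𝓡 n) x →L[ℝ] ℝ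
  smooth : ∀ c ∈ atlas (Eu 2) S, ∀ e ∈ atlas (Eu n) M, ∀ i,
    ContDiffOn ℝ ∞ (fun w : Eu 2 × Eu n => toFun (c.symm w.1) (e.symm w.2) (frame e w.2 i))
      (c.target ×ˢ e.target)

/-- The components `ε_i(σ, ·)` in the chart `e`. -/
def SectionMap.comp (ε : SectionMap n M S) (s : S) (e : OpenPartialHomeomorph M (Eu n))
    (i : Fin n) (y : Eu n) : ℝ :=
  ε.toFun s (e.symm y) (frame e y i)

/-- Multiplication of a map `S → Γ(T^*M)` by a smooth function on `S`. -/
def SectionMap.smul [IsManifold (𝓡 2) ∞ S] (lam : C^∞⟮𝓡 2, S; ℝ⟯) (ε : SectionMap n M S) :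
    SectionMap n M S where
  toFun s x := lam s • ε.toFun s x
  smooth c hc e he i := by
    have h1 : ContDiffOn ℝ ∞ (fun u : Eu 2 => lam (c.symm u)) c.target := by
      rw [← contMDiffOn_iff_contDiffOn]
      exact lam.contMDiff.comp_contMDiffOn
        (contMDiffOn_symm_of_mem_maximalAtlas (IsManifold.subset_maximalAtlas hc))
    have h2 : ContDiffOn ℝ ∞ (fun w : Eu 2 × Eu n => lam (c.symm w.1)) (c.target ×ˢ e.target) :=
      h1.comp contDiffOn_fst (fun w hw => hw.1)
    exact h2.mul (ε.smooth c hc e he i)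

/-- The components in the chart `e` of the `2`-form `dε + ι_{Π^# ε} H` on `M`, for the `1`-form
`ε = ε_σ`: `∂_i ε_j - ∂_j ε_i + π^{kl} ε_l H_{kij}`. -/
def twistedDiff (T : TwistedPoisson n M) (ε : SectionMap n M S) (s : S)
    (e : OpenPartialHomeomorph M (Eu n)) (i j : Fin n) (y : Eu n) : ℝ :=
  pd (ε.comp s e j) i y - pd (ε.comp s e i) j y
    + ∑ k, ∑ l, biComp T.P e k l y * ε.comp s e l y * threeComp T.H e k i j y

/-- `dε + ι_{Π^# ε} H = 0` on `M`, for every point of the surface. -/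
def SatisfiesEquation (T : TwistedPoisson n M) (ε : SectionMap n M S) : Prop :=
  ∀ s : S, ∀ e ∈ atlas (Eu n) M, ∀ y ∈ e.target, ∀ i j, twistedDiff T ε s e i j y = 0

variable (n M S) in
/-- The fields of the model: vector bundle morphisms `TΣ → T^*M`, given by a smooth base map `X` and
a smooth `A ∈ Ω¹(Σ, X^* T^*M)`. -/
structure Field where
  X : S → M
  smooth_X : ContMDiff (𝓡 2) (𝓡 n) ∞ X
  A : ∀ s : S, TangentSpace (𝓡 2) s →L[ℝ] (TangentSpace (𝓡 n) (X s) →L[ℝ] ℝ)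
  smooth_A : ∀ c ∈ atlas (Eu 2) S, ∀ e ∈ atlas (Eu n) M, ∀ (i : Fin n) (a : Fin 2),
    ContDiffOn ℝ ∞
      (fun u => A (c.symm u) (frame c u a)
        (mfderiv (𝓡 n) (𝓡 n) e.symm (e (X (c.symm u))) (bas i : Eu n)))
      {u | u ∈ c.target ∧ X (c.symm u) ∈ e.source}

/-- The components `A_{ia}` of `A` in the charts `c` of the surface and `e` of the target. -/
def Field.comp (F : Field n M S) (c : OpenPartialHomeomorph S (Eu 2))
    (e : OpenPartialHomeomorph M (Eu n)) (i : Fin n) (a : Fin 2) (u : Eu 2) : ℝ :=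
  F.A (c.symm u) (frame c u a)
    (mfderiv (𝓡 n) (𝓡 n) e.symm (e (F.X (c.symm u))) (bas i : Eu n))

/-- The target domain of a chart as an open set. -/
def dom {k : ℕ} {X : Type*} [TopologicalSpace X] (e : OpenPartialHomeomorph X (Eu k)) :
    TopologicalSpace.Opens (Eu k) := ⟨e.target, e.open_target⟩

/-- The product of two open sets. -/
def opProd (N : TopologicalSpace.Opens (Eu 2)) (V : TopologicalSpace.Opens (Eu n)) :
    TopologicalSpace.Opens (Eu 2 × Eu n) := ⟨N ×ˢ V, N.isOpen.prod V.isOpen⟩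

/-- The components of `(Π, H)`, as functions on `N × V`, `V` the domain of the chart `e`. -/
def TwistedPoisson.comps (T : TwistedPoisson n M) (N : TopologicalSpace.Opens (Eu 2))
    {e : OpenPartialHomeomorph M (Eu n)} (he : e ∈ atlas (Eu n) M) :
    Comps (opProd N (dom e)) where
  bi i j := Fn.mk (fun w => biComp T.P e i j w.2)
    ((T.smooth_P e he i j).comp contDiffOn_snd (fun _ hw => hw.2))
  three i j k := Fn.mk (fun w => threeComp T.H e i j k w.2)
    ((T.smooth_H e he i j k).comp contDiffOn_snd (fun _ hw => hw.2))

/-- The components `ε_i`, as functions on `N × V`, with `N` inside the domain of the chart `c` of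
the surface and `V` the domain of the chart `e` of the target. -/
def SectionMap.comps (ε : SectionMap n M S) {N : TopologicalSpace.Opens (Eu 2)}
    {c : OpenPartialHomeomorph S (Eu 2)} (hc : c ∈ atlas (Eu 2) S) (hN : N ≤ dom c)
    {e : OpenPartialHomeomorph M (Eu n)} (he : e ∈ atlas (Eu n) M) (i : Fin n) :
    Fn (opProd N (dom e)) :=
  Fn.mk (fun w => ε.comp (c.symm w.1) e i w.2)
    ((ε.smooth c hc e he i).mono (fun _ hw => ⟨hN hw.1, hw.2⟩))

/-- `f : T[1]N → T[1]N × T[1]T^*[1]V`, given by `f^*`, is the `Q`-morphism that covers the degree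
preserving map `φ : T[1]N → T[1]N × T^*[1]V` defined by the field `F`: it is the identity on
`T[1]N`, `f^* x^i = X^i`, `f^* p_i = A_i = A_{ia} dσ^a`, and `d f^* = f^* Q̂`. -/
structure IsLift (T : TwistedPoisson n M) (F : Field n M S) (N : TopologicalSpace.Opens (Eu 2))
    (c : OpenPartialHomeomorph S (Eu 2)) {e : OpenPartialHomeomorph M (Eu n)}
    (he : e ∈ atlas (Eu n) M) (f : Tot (opProd N (dom e)) →ₐ[ℝ] Forms N) : Prop where
  base : ∀ g : Fn (opProd N (dom e)), ∃ h : Fn N, f (fn g) = fn h ∧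
    ∀ u : N, h.1 u = ext0 (opProd N (dom e)) g.1 ((u : Eu 2), e (F.X (c.symm u)))
  sheet : ∀ a, f (eta a) = od a
  gauge : ∀ i, ∃ h : Fin 2 → Fn N, f (pp i) = ∑ a, fn (h a) * od a ∧
    ∀ a (u : N), (h a).1 u = F.comp c e i a u
  morphism : ∀ z, deRham N (f z) = f ((T.comps N he).Qhat z)

/-- `ε` is an infinitesimal gauge transformation of the twisted Poisson sigma model: for every
smooth function `λ` on the surface, the functional
`S[X, A] = ∫_Σ (A_i dX^i + ½ π^{ij} A_i A_j) + ∫_{Σ³} H` is stationary at all fields under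
the transformation `δ_{λε} (f^* ·) = f^* ([Q̂, λε̂] ·)`. It suffices to take `λ` with support in a
region (image of `N ⊆ ℝ²` under a chart `c` of the surface) that `X` maps to one chart `e` of the
target, since the variation is additive in `λ`; then it is an integral over `N`. -/
def IsGaugeTransformation [IsManifold (𝓡 2) ∞ S] (T : TwistedPoisson n M)
    (ε : SectionMap n M S) : Prop :=
  ∀ (lam : C^∞⟮𝓡 2, S; ℝ⟯) (F : Field n M S)
    (c : OpenPartialHomeomorph S (Eu 2)) (hc : c ∈ atlas (Eu 2) S)
    (e : OpenPartialHomeomorph M (Eu n)) (he : e ∈ atlas (Eu n) M)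
    (N : TopologicalSpace.Opens (Eu 2)) (hN : N ≤ dom c),
    (∀ u ∈ N, F.X (c.symm u) ∈ e.source) → tsupport lam ⊆ c.symm '' (N : Set (Eu 2)) →
    ∀ f : Tot (opProd N (dom e)) →ₐ[ℝ] Forms N, IsLift T F N c he f →
      integralForm ((T.comps N he).kinVar ((ε.smul lam).comps hc hN he) f
        + (T.comps N he).wzVar ((ε.smul lam).comps hc hN he) f) = 0

/-- The superfunction `H̃` is `Q̂`-closed and basic (horizontal and equivariant) with respect to the
vector field `ε̂ = L_ε` on `T[1]Σ × T[1]T^*[1]M`, expressed in all charts. -/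
def IsBasicFor (T : TwistedPoisson n M) (ε : SectionMap n M S) : Prop :=
  ∀ (c : OpenPartialHomeomorph S (Eu 2)) (hc : c ∈ atlas (Eu 2) S)
    (e : OpenPartialHomeomorph M (Eu n)) (he : e ∈ atlas (Eu n) M),
    (T.comps (dom c) he).Qhat (T.comps (dom c) he).Htilde = 0 ∧
    epsHat (ε.comps hc le_rfl he) (T.comps (dom c) he).Htilde = 0 ∧
    oddBracket (T.comps (dom c) he).Qhat (epsHat (ε.comps hc le_rfl he))
      (T.comps (dom c) he).Htilde = 0

end Geometry

end TwistedPSM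

end

/-! Everything follows from a primitive of `H̃` up to a basic correction. Put `F^i = Q̂ x^i = dx^i +
π^{ji} p_j`, `G_i = Q̂ p_i`, and let `K = p_i F^i + ½ π^{ij} p_i p_j` be the superfunction whose
pull back along a lift is the integrand of the sigma model. Then `H̃ = ⅙ H_{ijk} F^i F^j F^k + Q̂ K`
(`Comps.IsTwisted.Htilde_eq`).

The twisted Jacobi identity and `dH = 0` say that `L_Q² = 0` on the coordinates (`lie_qx`,
`lie_qp`), so `Q̂ F = 0` and `Q̂ G = 0`. Hence `Q̂² K = 0`, while `Q̂ (H F F F)` is `dH` evaluated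
on `F` and vanishes. So `Q̂ H̃ = 0` holds for every twisted Poisson structure, with no condition on
`ε`. Directly, `ε̂ H̃ = -½ (dε + ι_{Π^# ε} H)_{ij} dx^i dx^j`, and the monomials `dx^i dx^j` with `i
< j` are independent. The basic condition is therefore exactly the equation for `ε`; invariance
under `[Q̂, ε̂]` follows from the other two conditions.

For the functional, a lift `f` intertwines `d` and `Q̂`, so the variation of the kinetic integrand
is `f ([Q̂, ε̂] K)` and that of the Wess–Zumino term is `f (ε̂ (⅙ H F F F))`. Their sum is `d f(ε̂
K) + f(ε̂ H̃)` (`kinVar_add_wzVar`). Since `λ` does not depend on `x`, replacing `ε` by `λε`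
multiplies `ε̂` by `λ`. The exact term integrates to zero, and `δ_{λε} S` becomes the integral of `λ
f(ε̂ H̃)` (`integral_variation`).

This gives sufficiency at once. For necessity, arbitrary `λ` forces the `2`-form `f(ε̂ H̃)` to
vanish for every field. Fields with `A = 0` have an explicit lift with `f(dx^i) = dX^i`, and `X` may
be chosen with any value and any differential at a given point, so each component of `dε + ι_{Π^# ε}
H` can be read off. -/

noncomputable section

namespace TwistedPSM

/-! ### Graded algebra of superfunctions: parity, sign rule, odd and even derivations. -/

section Parity

set_option linter.unusedSectionVars false

variable {E : Type*} [NormedAddCommGroup E] [NormedSpace ℝ E]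
variable {W : TopologicalSpace.Opens E} {κ o : Type}

/-- The superfunction `g ⊗ p ⊗ x`. -/
def SF.pure (g : Fn W) (p : MvPolynomial κ ℝ) (x : ExteriorAlgebra ℝ (o → ℝ)) : SF W κ o :=
  (SF.equiv W κ o).symm (g ⊗ₜ (p ⊗ₜ x))

theorem SF.pure_mul (g g' : Fn W) (p p' : MvPolynomial κ ℝ) (x x' : ExteriorAlgebra ℝ (o → ℝ)) :
    SF.pure g p x * SF.pure g' p' x' = SF.pure (g * g') (p * p') (x * x') := by
  change (SF.equiv W κ o).symm _ * (SF.equiv W κ o).symm _ = (SF.equiv W κ o).symm _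
  rw [← map_mul]; simp [Algebra.TensorProduct.tmul_mul_tmul]

theorem SF.induction_pure {motive : SF W κ o → Prop} (z : SF W κ o)
    (add : ∀ a b, motive a → motive b → motive (a + b))
    (pure : ∀ g p x, motive (SF.pure g p x)) : motive z := by
  obtain ⟨t, rfl⟩ := (SF.equiv W κ o).symm.surjective z
  have h0 : motive 0 := by simpa [SF.pure] using pure 0 0 0
  induction t using TensorProduct.induction_on with
  | zero => simpa using h0
  | add a b ha hb => rw [map_add]; exact add _ _ ha hb
  | tmul g s =>
    induction s using TensorProduct.induction_on with
    | zero => simpa using h0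
    | add a b ha hb => rw [TensorProduct.tmul_add, map_add]; exact add _ _ ha hb
    | tmul p x => exact pure g p x

theorem fn_eq (g : Fn W) : (fn g : SF W κ o) = SF.pure g 1 1 := rfl
theorem ev_eq (k : κ) : (ev k : SF W κ o) = SF.pure 1 (MvPolynomial.X k) 1 := rfl
theorem od_eq [DecidableEq o] (j : o) :
    (od j : SF W κ o) = SF.pure 1 1 (ExteriorAlgebra.ι ℝ (Pi.single j 1)) := rfl
theorem SF.one_eq : (1 : SF W κ o) = SF.pure 1 1 1 := rfl

theorem dBase_pure (v : E) (g : Fn W) (p : MvPolynomial κ ℝ) (x : ExteriorAlgebra ℝ (o → ℝ)) :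
    dBase v (SF.pure g p x) = SF.pure (Fn.partial v g) p x := by
  simp [dBase, SF.lift, SF.pure]

theorem dEv_pure (k : κ) (g : Fn W) (p : MvPolynomial κ ℝ) (x : ExteriorAlgebra ℝ (o → ℝ)) :
    dEv k (SF.pure g p x) = SF.pure g (MvPolynomial.pderiv k p) x := by
  simp [dEv, SF.lift, SF.pure]

theorem dOd_pure (j : o) (g : Fn W) (p : MvPolynomial κ ℝ) (x : ExteriorAlgebra ℝ (o → ℝ)) :
    dOd j (SF.pure g p x) = SF.pure g p (CliffordAlgebra.contractLeft
      (Q := (0 : QuadraticForm ℝ (o → ℝ))) (LinearMap.proj j) x) := by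
  simp [dOd, SF.lift, SF.pure]

/-- Smooth functions as superfunctions, as an algebra homomorphism. -/
def fnHom : Fn W →ₐ[ℝ] SF W κ o :=
  (SF.equiv W κ o).symm.toAlgHom.comp Algebra.TensorProduct.includeLeft

theorem fnHom_apply (g : Fn W) : (fnHom g : SF W κ o) = fn g := rfl

theorem fn_mul (a b : Fn W) : (fn (a * b) : SF W κ o) = fn a * fn b := map_mul fnHom a b
theorem fn_add (a b : Fn W) : (fn (a + b) : SF W κ o) = fn a + fn b := map_add fnHom a b
theorem fn_neg (a : Fn W) : (fn (-a) : SF W κ o) = -fn a := map_neg fnHom a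
theorem fn_zero : (fn 0 : SF W κ o) = 0 := map_zero fnHom
theorem fn_one : (fn 1 : SF W κ o) = 1 := map_one fnHom
theorem fn_smul (r : ℝ) (a : Fn W) : (fn (r • a) : SF W κ o) = r • fn a := map_smul fnHom r a
theorem fn_sum {ι : Type*} (s : Finset ι) (a : ι → Fn W) :
    (fn (∑ i ∈ s, a i) : SF W κ o) = ∑ i ∈ s, fn (a i) := map_sum fnHom a s

/-- Setting all coordinates of positive degree to zero is a linear left inverse. -/
theorem fn_injective : Function.Injective (fn : Fn W → SF W κ o) := by
  let c : SF W κ o →ₗ[ℝ] Fn W :=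
    (TensorProduct.rid ℝ (Fn W)).toLinearMap ∘ₗ
      TensorProduct.map LinearMap.id ((TensorProduct.rid ℝ ℝ).toLinearMap ∘ₗ
        TensorProduct.map (MvPolynomial.aeval (fun _ : κ => (0 : ℝ))).toLinearMap
          ExteriorAlgebra.algebraMapInv.toLinearMap) ∘ₗ (SF.equiv W κ o).toLinearMap
  have h : ∀ g, c (fn g) = g := by
    intro g
    simp [c, fn, Algebra.TensorProduct.one_def]
  exact fun a b hab => by rw [← h a, ← h b, hab]

theorem Fn.partial_mul (v : E) (a b : Fn W) :
    Fn.partial v (a * b) = Fn.partial v a * b + a * Fn.partial v b := by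
  ext w
  have h : ext0 W (a * b : Fn W) =ᶠ[nhds (w : E)] ext0 W a * ext0 W b := by
    filter_upwards [W.isOpen.mem_nhds w.2] with y hy
    have h1 := ext0_apply W (a * b : Fn W) ⟨y, hy⟩
    have h2 := ext0_apply W a ⟨y, hy⟩
    have h3 := ext0_apply W b ⟨y, hy⟩
    simp only [Pi.mul_apply] at h1 h2 h3 ⊢
    rw [h1, h2, h3]
    rfl
  change fderiv ℝ (ext0 W (a * b : Fn W)) w v
    = fderiv ℝ (ext0 W a) w v * (b : W → ℝ) w + (a : W → ℝ) w * fderiv ℝ (ext0 W b) w v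
  rw [h.fderiv_eq, fderiv_mul (differentiableAt_ext0 a w) (differentiableAt_ext0 b w)]
  simp only [add_apply, smul_apply, ext0_apply, smul_eq_mul]
  ring

/-- The parity automorphism, which changes the sign of the coordinates of odd degree. -/
def parity : SF W κ o →ₐ[ℝ] SF W κ o :=
  (SF.equiv W κ o).symm.toAlgHom.comp
    ((Algebra.TensorProduct.map (AlgHom.id ℝ _) (Algebra.TensorProduct.map (AlgHom.id ℝ _)
      (CliffordAlgebra.involute (Q := (0 : QuadraticForm ℝ (o → ℝ)))))).comp (SF.equiv W κ o).toAlgHom)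

theorem parity_pure (g : Fn W) (p : MvPolynomial κ ℝ) (x : ExteriorAlgebra ℝ (o → ℝ)) :
    parity (SF.pure g p x) = SF.pure g p (CliffordAlgebra.involute x) := by
  simp [parity, SF.pure]

@[simp] theorem parity_fn (g : Fn W) : parity (fn g : SF W κ o) = fn g := by
  simp [fn_eq, parity_pure]
@[simp] theorem parity_ev (k : κ) : parity (ev k : SF W κ o) = ev k := by
  simp [ev_eq, parity_pure]

theorem neg_pure (g : Fn W) (p : MvPolynomial κ ℝ) (x : ExteriorAlgebra ℝ (o → ℝ)) :
    -SF.pure g p x = SF.pure g p (-x) := by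
  have : -SF.pure g p x = (-1 : ℝ) • SF.pure g p x := by simp
  rw [this, SF.pure, ← map_smul, ← TensorProduct.tmul_smul, ← TensorProduct.tmul_smul]
  simp [SF.pure]

@[simp] theorem parity_od [DecidableEq o] (j : o) : parity (od j : SF W κ o) = - od j := by
  rw [od_eq, parity_pure, neg_pure]
  congr 1
  exact CliffordAlgebra.involute_ι _

/-- The algebra is generated by smooth functions and coordinates: `g ⊗ p ⊗ x` is the product of its
three factors, and the last two lie in algebras generated by the `ψ_k` and the `ξ_j`. This is how
multiplicative statements (sign rule, Leibniz rule, the morphism property of a lift) are reduced to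
coordinates. -/
theorem SF.induction [Fintype o] [DecidableEq o] {motive : SF W κ o → Prop} (z : SF W κ o)
    (fn : ∀ g, motive (fn g)) (ev : ∀ k, motive (ev k)) (od : ∀ j, motive (od j))
    (add : ∀ a b, motive a → motive b → motive (a + b))
    (mul : ∀ a b, motive a → motive b → motive (a * b)) : motive z := by
  induction z using SF.induction_pure with
  | add a b ha hb => exact add a b ha hb
  | pure g p x =>
    have h : SF.pure g p x = TwistedPSM.fn g * SF.pure 1 p 1 * SF.pure 1 1 x := by
      rw [fn_eq, SF.pure_mul, SF.pure_mul]; simp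
    rw [h]
    have hc : ∀ r : ℝ, motive (algebraMap ℝ _ r) := fun r => by
      have := fn (algebraMap ℝ _ r)
      rwa [← fnHom_apply, AlgHom.commutes] at this
    refine mul _ _ (mul _ _ (fn g) ?_) ?_
    · let F : MvPolynomial κ ℝ →ₐ[ℝ] SF W κ o :=
        (SF.equiv W κ o).symm.toAlgHom.comp
          (Algebra.TensorProduct.includeRight.comp Algebra.TensorProduct.includeLeft)
      change motive (F p)
      clear h
      induction p using MvPolynomial.induction_on with
      | C a => rw [← MvPolynomial.algebraMap_eq, AlgHom.commutes]; exact hc a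
      | add p q hp hq => rw [map_add]; exact add _ _ hp hq
      | mul_X p k hp => rw [map_mul]; exact mul _ _ hp (ev k)
    · let F : ExteriorAlgebra ℝ (o → ℝ) →ₐ[ℝ] SF W κ o :=
        (SF.equiv W κ o).symm.toAlgHom.comp
          (Algebra.TensorProduct.includeRight.comp Algebra.TensorProduct.includeRight)
      change motive (F x)
      clear h
      induction x using ExteriorAlgebra.induction with
      | algebraMap r => rw [AlgHom.commutes]; exact hc r
      | add a b ha hb => rw [map_add]; exact add _ _ ha hb
      | mul a b ha hb => rw [map_mul]; exact mul _ _ ha hb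
      | ι m =>
        have hm : m = ∑ j, m j • (Pi.single j 1 : o → ℝ) := by
          ext j; simp [Finset.sum_apply, Pi.single_apply]
        rw [hm, map_sum, map_sum]
        refine Finset.sum_induction _ motive add (by simpa using hc 0) fun j _ => ?_
        rw [map_smul, map_smul, Algebra.smul_def]
        exact mul _ _ (hc _) (od j)

@[simp] theorem parity_parity (z : SF W κ o) : parity (parity z) = z := by
  induction z using SF.induction_pure with
  | add a b ha hb => rw [map_add, map_add, ha, hb]
  | pure g p x => rw [parity_pure, parity_pure, CliffordAlgebra.involute_involute]

/-- Homogeneous elements of odd degree: they anticommute with odd elements and commute with even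
ones. -/
structure IsOddE (a : SF W κ o) : Prop where
  comm : ∀ b, a * b = parity b * a
  parity : parity a = -a

/-- Homogeneous elements of even degree; they are central. -/
structure IsEvenE (a : SF W κ o) : Prop where
  comm : ∀ b, a * b = b * a
  parity : parity a = a

theorem IsOddE.anticomm {a b : SF W κ o} (ha : IsOddE a) (hb : IsOddE b) : a * b = -(b * a) := by
  rw [ha.comm, hb.parity, neg_mul]

theorem IsOddE.add {a b : SF W κ o} (ha : IsOddE a) (hb : IsOddE b) : IsOddE (a + b) :=
  ⟨fun c => by rw [add_mul, mul_add, ha.comm, hb.comm], by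
    rw [map_add, ha.parity, hb.parity, neg_add]⟩

theorem IsEvenE.add {a b : SF W κ o} (ha : IsEvenE a) (hb : IsEvenE b) : IsEvenE (a + b) :=
  ⟨fun c => by rw [add_mul, mul_add, ha.comm, hb.comm], by rw [map_add, ha.parity, hb.parity]⟩

theorem IsOddE.zero : IsOddE (0 : SF W κ o) := ⟨fun c => by simp, by simp⟩
theorem IsEvenE.zero : IsEvenE (0 : SF W κ o) := ⟨fun c => by simp, by simp⟩

theorem IsOddE.smul {a : SF W κ o} (r : ℝ) (ha : IsOddE a) : IsOddE (r • a) :=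
  ⟨fun c => by rw [smul_mul_assoc, mul_smul_comm, ha.comm], by rw [map_smul, ha.parity, smul_neg]⟩

theorem IsEvenE.smul {a : SF W κ o} (r : ℝ) (ha : IsEvenE a) : IsEvenE (r • a) :=
  ⟨fun c => by rw [smul_mul_assoc, mul_smul_comm, ha.comm], by rw [map_smul, ha.parity]⟩

theorem IsEvenE.neg {a : SF W κ o} (ha : IsEvenE a) : IsEvenE (-a) := by
  simpa using ha.smul (-1)

theorem IsOddE.sum {ι : Type*} (s : Finset ι) {a : ι → SF W κ o} (h : ∀ i, IsOddE (a i)) :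
    IsOddE (∑ i ∈ s, a i) :=
  Finset.sum_induction _ _ (fun _ _ => IsOddE.add) IsOddE.zero fun i _ => h i

theorem IsEvenE.sum {ι : Type*} (s : Finset ι) {a : ι → SF W κ o} (h : ∀ i, IsEvenE (a i)) :
    IsEvenE (∑ i ∈ s, a i) :=
  Finset.sum_induction _ _ (fun _ _ => IsEvenE.add) IsEvenE.zero fun i _ => h i

theorem IsEvenE.mul_odd {a b : SF W κ o} (ha : IsEvenE a) (hb : IsOddE b) : IsOddE (a * b) :=
  ⟨fun c => by rw [mul_assoc, hb.comm, ← mul_assoc, ha.comm, mul_assoc],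
    by rw [map_mul, ha.parity, hb.parity, mul_neg]⟩

theorem IsOddE.mul {a b : SF W κ o} (ha : IsOddE a) (hb : IsOddE b) : IsEvenE (a * b) :=
  ⟨fun c => by rw [mul_assoc, hb.comm, ← mul_assoc, ha.comm, parity_parity, mul_assoc],
    by rw [map_mul, ha.parity, hb.parity, neg_mul_neg]⟩

theorem isEvenE_fn (g : Fn W) : IsEvenE (fn g : SF W κ o) := by
  refine ⟨fun b => ?_, parity_fn g⟩
  induction b using SF.induction_pure with
  | add a b ha hb => rw [mul_add, add_mul, ha, hb]
  | pure g' p x => rw [fn_eq, SF.pure_mul, SF.pure_mul]; simp [mul_comm]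

theorem isEvenE_ev (k : κ) : IsEvenE (ev k : SF W κ o) := by
  refine ⟨fun b => ?_, parity_ev k⟩
  induction b using SF.induction_pure with
  | add a b ha hb => rw [mul_add, add_mul, ha, hb]
  | pure g' p x => rw [ev_eq, SF.pure_mul, SF.pure_mul]; simp [mul_comm]

/-- The sign rule is multiplicative in `b`, so it needs checking on generators only; the one sign
comes from the exterior algebra. -/
theorem isOddE_od [Fintype o] [DecidableEq o] (j : o) : IsOddE (od j : SF W κ o) := by
  refine ⟨fun b => ?_, parity_od j⟩
  induction b using SF.induction with
  | add a b ha hb => rw [mul_add, map_add, add_mul, ha, hb]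
  | mul a b ha hb => rw [← mul_assoc, ha, mul_assoc, hb, map_mul, mul_assoc]
  | fn g => rw [← (isEvenE_fn g).comm, parity_fn]
  | ev k => rw [← (isEvenE_ev k).comm, parity_ev]
  | od i =>
    rw [parity_od, neg_mul, od_eq, od_eq, SF.pure_mul, SF.pure_mul, neg_pure]
    congr 1
    exact eq_neg_of_add_eq_zero_left (ExteriorAlgebra.ι_add_mul_swap _ _)

/-- Derivations of odd degree. -/
structure IsOddDer (D : SF W κ o →ₗ[ℝ] SF W κ o) : Prop where
  leibniz : ∀ a b, D (a * b) = D a * b + parity a * D b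
  anti : ∀ a, parity (D a) = -D (parity a)

/-- Derivations of even degree. -/
structure IsEvenDer (D : SF W κ o →ₗ[ℝ] SF W κ o) : Prop where
  leibniz : ∀ a b, D (a * b) = D a * b + a * D b
  comm : ∀ a, parity (D a) = D (parity a)

/-- Apply `D` to `a b = parity(b) a` by the Leibniz rule on both sides; the terms in which `D` hits
`b` agree and cancel, leaving the commutation rule for `D a`. The two lemmas after this one hold for
the same reason. -/
theorem IsOddDer.map_odd {D : SF W κ o →ₗ[ℝ] SF W κ o} (hD : IsOddDer D) {a : SF W κ o}
    (ha : IsOddE a) : IsEvenE (D a) := by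
  refine ⟨fun b => ?_, by rw [hD.anti, ha.parity, map_neg, neg_neg]⟩
  have h := hD.leibniz a b
  rw [ha.comm b, hD.leibniz, ha.parity, parity_parity, neg_mul, ha.comm, hD.anti, neg_mul,
    neg_neg] at h
  rw [add_comm (D (parity b) * a)] at h
  exact (add_right_cancel h).symm

theorem IsOddDer.map_even {D : SF W κ o →ₗ[ℝ] SF W κ o} (hD : IsOddDer D) {a : SF W κ o}
    (ha : IsEvenE a) : IsOddE (D a) := by
  refine ⟨fun b => ?_, by rw [hD.anti, ha.parity]⟩
  have h := hD.leibniz a b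
  rw [ha.comm b, hD.leibniz, ha.parity, ha.comm (D b), add_comm] at h
  exact (add_right_cancel h).symm

theorem IsEvenDer.map_odd {D : SF W κ o →ₗ[ℝ] SF W κ o} (hD : IsEvenDer D) {a : SF W κ o}
    (ha : IsOddE a) : IsOddE (D a) := by
  refine ⟨fun b => ?_, by rw [hD.comm, ha.parity, map_neg]⟩
  have h := hD.leibniz a b
  rw [ha.comm b, hD.leibniz, ha.comm (D b), hD.comm, add_comm] at h
  exact (add_right_cancel h).symm

theorem IsOddDer.zero : IsOddDer (0 : SF W κ o →ₗ[ℝ] SF W κ o) := ⟨by simp, by simp⟩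

theorem IsOddDer.add {D D' : SF W κ o →ₗ[ℝ] SF W κ o} (h : IsOddDer D) (h' : IsOddDer D') :
    IsOddDer (D + D') :=
  ⟨fun a b => by simp only [LinearMap.add_apply, h.leibniz, h'.leibniz, add_mul, mul_add]; abel,
    fun a => by simp only [LinearMap.add_apply, map_add, h.anti, h'.anti]; abel⟩

theorem IsOddDer.neg {D : SF W κ o →ₗ[ℝ] SF W κ o} (h : IsOddDer D) : IsOddDer (-D) :=
  ⟨fun a b => by simp only [LinearMap.neg_apply, h.leibniz, neg_mul, mul_neg]; abel,
    fun a => by simp only [LinearMap.neg_apply, map_neg, h.anti]⟩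

theorem IsOddDer.sub {D D' : SF W κ o →ₗ[ℝ] SF W κ o} (h : IsOddDer D) (h' : IsOddDer D') :
    IsOddDer (D - D') := by
  rw [sub_eq_add_neg]; exact h.add h'.neg

theorem IsOddDer.sum {ι : Type*} (s : Finset ι) {D : ι → SF W κ o →ₗ[ℝ] SF W κ o}
    (h : ∀ i, IsOddDer (D i)) : IsOddDer (∑ i ∈ s, D i) :=
  Finset.sum_induction _ _ (fun _ _ => IsOddDer.add) IsOddDer.zero fun i _ => h i

theorem lmul_apply (a : SF W κ o) (D : SF W κ o →ₗ[ℝ] SF W κ o) (z : SF W κ o) :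
    lmul a D z = a * D z := rfl

theorem IsOddE.lmul {a : SF W κ o} {D : SF W κ o →ₗ[ℝ] SF W κ o} (ha : IsOddE a)
    (hD : IsEvenDer D) : IsOddDer (lmul a D) :=
  ⟨fun b c => by
    rw [lmul_apply, lmul_apply, lmul_apply, hD.leibniz, mul_add, ← mul_assoc, ← mul_assoc,
      ha.comm b, mul_assoc _ a],
    fun b => by rw [lmul_apply, lmul_apply, map_mul, ha.parity, hD.comm, neg_mul]⟩

theorem IsEvenE.lmul {a : SF W κ o} {D : SF W κ o →ₗ[ℝ] SF W κ o} (ha : IsEvenE a)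
    (hD : IsOddDer D) : IsOddDer (lmul a D) :=
  ⟨fun b c => by
    rw [lmul_apply, lmul_apply, lmul_apply, hD.leibniz, mul_add, ← mul_assoc, ← mul_assoc,
      ha.comm (TwistedPSM.parity b), mul_assoc _ a],
    fun b => by rw [lmul_apply, lmul_apply, map_mul, ha.parity, hD.anti, mul_neg]⟩

theorem isEvenDer_dBase (v : E) : IsEvenDer (dBase v : SF W κ o →ₗ[ℝ] SF W κ o) := by
  constructor
  · intro a b
    induction a using SF.induction_pure with
    | add a a' ha hb => simp only [add_mul, map_add, ha, hb]; abel
    | pure g p x =>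
      induction b using SF.induction_pure with
      | add a a' ha hb => simp only [mul_add, map_add, ha, hb]; abel
      | pure g' p' x' =>
        simp only [SF.pure_mul, dBase_pure, Fn.partial_mul]
        simp only [SF.pure, TensorProduct.add_tmul, map_add]
  · intro a
    induction a using SF.induction_pure with
    | add a a' ha hb => simp only [map_add, ha, hb]
    | pure g p x => simp only [parity_pure, dBase_pure]

theorem isEvenDer_dEv (k : κ) : IsEvenDer (dEv k : SF W κ o →ₗ[ℝ] SF W κ o) := by
  constructor
  · intro a b
    induction a using SF.induction_pure with
    | add a a' ha hb => simp only [add_mul, map_add, ha, hb]; abel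
    | pure g p x =>
      induction b using SF.induction_pure with
      | add a a' ha hb => simp only [mul_add, map_add, ha, hb]; abel
      | pure g' p' x' =>
        simp only [SF.pure_mul, dEv_pure, Derivation.leibniz, smul_eq_mul]
        rw [add_comm, mul_comm p']
        simp only [SF.pure, TensorProduct.add_tmul, TensorProduct.tmul_add, map_add]
  · intro a
    induction a using SF.induction_pure with
    | add a a' ha hb => simp only [map_add, ha, hb]
    | pure g p x => simp only [parity_pure, dEv_pure]

@[simp] theorem dBase_fn (v : E) (g : Fn W) :
    dBase v (fn g : SF W κ o) = fn (Fn.partial v g) := dBase_pure v g 1 1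

theorem Fn.partial_one (v : E) : Fn.partial v (1 : Fn W) = 0 := by
  have := Fn.partial_mul v (1 : Fn W) 1
  simpa using this

@[simp] theorem dBase_ev (v : E) (k : κ) : dBase v (ev k : SF W κ o) = 0 := by
  rw [ev_eq, dBase_pure, Fn.partial_one]; simp [SF.pure]

@[simp] theorem dBase_od [DecidableEq o] (v : E) (j : o) : dBase v (od j : SF W κ o) = 0 := by
  rw [od_eq, dBase_pure, Fn.partial_one]; simp [SF.pure]

@[simp] theorem dEv_fn (k : κ) (g : Fn W) : dEv k (fn g : SF W κ o) = 0 := by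
  rw [fn_eq, dEv_pure]; simp [SF.pure]

@[simp] theorem dEv_ev [DecidableEq κ] (k l : κ) :
    dEv k (ev l : SF W κ o) = if l = k then 1 else 0 := by
  rw [ev_eq, dEv_pure, MvPolynomial.pderiv_X]
  by_cases h : l = k
  · subst h; simp [SF.pure, SF.one_eq]
  · simp [SF.pure, h]

@[simp] theorem dEv_od [DecidableEq o] (k : κ) (j : o) : dEv k (od j : SF W κ o) = 0 := by
  rw [od_eq, dEv_pure]; simp [SF.pure]

@[simp] theorem dOd_fn (j : o) (g : Fn W) : dOd j (fn g : SF W κ o) = 0 := by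
  rw [fn_eq, dOd_pure]; simp [SF.pure]

@[simp] theorem dOd_ev (j : o) (k : κ) : dOd j (ev k : SF W κ o) = 0 := by
  rw [ev_eq, dOd_pure]; simp [SF.pure]

@[simp] theorem dOd_od [DecidableEq o] (i j : o) :
    dOd i (od j : SF W κ o) = if j = i then 1 else 0 := by
  rw [od_eq, dOd_pure]
  have : CliffordAlgebra.contractLeft (Q := (0 : QuadraticForm ℝ (o → ℝ))) (LinearMap.proj i)
      (ExteriorAlgebra.ι ℝ (Pi.single j 1)) = algebraMap ℝ _ ((Pi.single j 1 : o → ℝ) i) :=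
    CliffordAlgebra.contractLeft_ι _ _ _
  rw [this]
  by_cases h : j = i
  · subst h; simp [SF.one_eq]
  · simp [h, Ne.symm h, SF.pure]

/-- Induction on the left factor: the Leibniz rule passes to products, it is immediate for even
generators, and for an odd coordinate it is the contraction formula on `ι m * x`. -/
theorem isOddDer_dOd [Fintype o] [DecidableEq o] (j : o) :
    IsOddDer (dOd j : SF W κ o →ₗ[ℝ] SF W κ o) := by
  have hl : ∀ a b : SF W κ o, dOd j (a * b) = dOd j a * b + parity a * dOd j b := by
    intro a b
    induction a using SF.induction generalizing b with
    | add a a' ha hb => simp only [add_mul, map_add, ha, hb]; abel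
    | mul a a' ha ha' => rw [mul_assoc, ha, ha', ha, map_mul]; noncomm_ring
    | fn g =>
      rw [dOd_fn, zero_mul, zero_add, parity_fn]
      induction b using SF.induction_pure with
      | add a a' ha hb => simp only [mul_add, map_add, ha, hb]
      | pure g' p' x' => simp only [fn_eq, SF.pure_mul, dOd_pure, one_mul]
    | ev k =>
      rw [dOd_ev, zero_mul, zero_add, parity_ev]
      induction b using SF.induction_pure with
      | add a a' ha hb => simp only [mul_add, map_add, ha, hb]
      | pure g' p' x' => simp only [ev_eq, SF.pure_mul, dOd_pure, one_mul]
    | od i =>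
      rw [parity_od]
      induction b using SF.induction_pure with
      | add a a' ha hb => simp only [mul_add, map_add, ha, hb]; abel
      | pure g' p' x' =>
        have h : CliffordAlgebra.contractLeft (Q := (0 : QuadraticForm ℝ (o → ℝ)))
            (LinearMap.proj j) (ExteriorAlgebra.ι ℝ (Pi.single i 1) * x')
            = (Pi.single i 1 : o → ℝ) j • x' - ExteriorAlgebra.ι ℝ (Pi.single i 1) *
              CliffordAlgebra.contractLeft (Q := (0 : QuadraticForm ℝ (o → ℝ)))
                (LinearMap.proj j) x' :=
          CliffordAlgebra.contractLeft_ι_mul _ _ _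
        rw [dOd_od, od_eq, SF.pure_mul, dOd_pure, dOd_pure, neg_mul, SF.pure_mul, neg_pure,
          one_mul, one_mul, h, sub_eq_add_neg]
        have hadd : ∀ y y', SF.pure g' p' (y + y')
            = (SF.pure g' p' y + SF.pure g' p' y' : SF W κ o) := fun y y' => by
          simp only [SF.pure, TensorProduct.tmul_add, map_add]
        rw [hadd]
        by_cases hij : i = j
        · subst hij; simp
        · simp [hij, Ne.symm hij, SF.pure]
  refine ⟨hl, fun a => ?_⟩
  induction a using SF.induction with
  | add a a' ha hb => simp only [map_add, ha, hb]; abel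
  | mul a a' ha ha' => simp only [hl, map_add, map_mul, ha, ha', parity_parity]; noncomm_ring
  | fn g => simp
  | ev k => simp
  | od i => by_cases h : i = j <;> simp [h]

end Parity

/-! ### The vector fields in coordinates, and the calculus of bilinear and trilinear expressions. -/

section Operators

theorem Fn.partial_comm {E : Type*} [NormedAddCommGroup E] [NormedSpace ℝ E]
    {W : TopologicalSpace.Opens E} (v v' : E) (g : Fn W) :
    Fn.partial v (Fn.partial v' g) = Fn.partial v' (Fn.partial v g) := by
  ext w
  have key : ∀ u u' : E, (Fn.partial u (Fn.partial u' g) : W → ℝ) w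
      = fderiv ℝ (fderiv ℝ (ext0 W g)) w u u' := by
    intro u u'
    change fderiv ℝ (ext0 W (Fn.partial u' g)) w u = _
    have h : ext0 W (Fn.partial u' g) =ᶠ[nhds (w : E)] fun y => fderiv ℝ (ext0 W g) y u' := by
      filter_upwards [W.isOpen.mem_nhds w.2] with y hy
      exact ext0_apply W (Fn.partial u' g) ⟨y, hy⟩
    have hd : DifferentiableAt ℝ (fderiv ℝ (ext0 W g)) w :=
      ((g.2.fderiv_of_isOpen W.isOpen (m := ∞) (by simp)).contDiffAt
        (W.isOpen.mem_nhds w.2)).differentiableAt (by simp)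
    rw [h.fderiv_eq, fderiv_clm_apply hd (differentiableAt_const u')]
    simp
  rw [key, key]
  have hs := ((g.2.contDiffAt (W.isOpen.mem_nhds w.2)).isSymmSndFDerivAt
    (by simpa using WithTop.coe_le_coe.mpr (le_top : (2 : ℕ∞) ≤ ⊤)))
  exact hs v v'

variable {n : ℕ} {W : TopologicalSpace.Opens (Eu 2 × Eu n)}

theorem isOddE_eta (a : Fin 2) : IsOddE (eta a : Tot W) := isOddE_od _
theorem isOddE_pp (i : Fin n) : IsOddE (pp i : Tot W) := isOddE_od _
theorem isOddE_theta (i : Fin n) : IsOddE (theta i : Tot W) := isOddE_od _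
theorem isEvenE_psi (i : Fin n) : IsEvenE (psi i : Tot W) := isEvenE_ev _

theorem isOddDer_dSheet : IsOddDer (dSheet : Tot W →ₗ[ℝ] Tot W) :=
  IsOddDer.sum _ fun a => (isOddE_eta a).lmul (isEvenDer_dBase _)

theorem isOddDer_dTarget : IsOddDer (dTarget : Tot W →ₗ[ℝ] Tot W) :=
  IsOddDer.sum _ fun i => ((isOddE_theta i).lmul (isEvenDer_dBase _)).add
    ((isEvenE_psi i).lmul (isOddDer_dOd _))

theorem isOddDer_lieLift {q r : Fin n → Tot W} (hq : ∀ i, IsOddE (q i))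
    (hr : ∀ i, IsEvenE (r i)) : IsOddDer (lieLift q r) :=
  IsOddDer.sum _ fun i => ((((hq i).lmul (isEvenDer_dBase _)).add
    ((hr i).lmul (isOddDer_dOd _))).sub
      ((isOddDer_dTarget.map_odd (hq i)).lmul (isOddDer_dOd _))).sub
        ((isOddDer_dTarget.map_even (hr i)).lmul (isEvenDer_dEv _))

theorem dSheet_fn (g : Fn W) :
    dSheet (fn g : Tot W) = ∑ a, eta a * fn (Fn.partial (bas a, 0) g) := by
  simp [dSheet, lmul_apply, dSig, -Fin.sum_univ_two]
@[simp] theorem dSheet_pp (i : Fin n) : dSheet (pp i : Tot W) = 0 := by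
  simp [dSheet, lmul_apply, dSig, pp]
@[simp] theorem dSheet_theta (i : Fin n) : dSheet (theta i : Tot W) = 0 := by
  simp [dSheet, lmul_apply, dSig, theta]
@[simp] theorem dSheet_psi (i : Fin n) : dSheet (psi i : Tot W) = 0 := by
  simp [dSheet, lmul_apply, dSig, psi]
@[simp] theorem dSheet_eta (a : Fin 2) : dSheet (eta a : Tot W) = 0 := by
  simp [dSheet, lmul_apply, dSig, eta]

theorem dTarget_fn (g : Fn W) : dTarget (fn g : Tot W) = ∑ l, theta l * fn (Fn.dx l g) := by
  simp [dTarget, lmul_apply, dX, dP, Fn.dx]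
@[simp] theorem dTarget_pp (i : Fin n) : dTarget (pp i : Tot W) = psi i := by
  simp [dTarget, lmul_apply, dX, dP, pp]
@[simp] theorem dTarget_theta (i : Fin n) : dTarget (theta i : Tot W) = 0 := by
  simp [dTarget, lmul_apply, dX, dP, theta]
@[simp] theorem dTarget_psi (i : Fin n) : dTarget (psi i : Tot W) = 0 := by
  simp [dTarget, lmul_apply, dX, dP, psi]
@[simp] theorem dTarget_eta (a : Fin 2) : dTarget (eta a : Tot W) = 0 := by
  simp [dTarget, lmul_apply, dX, dP, eta]

theorem lieLift_fn (q r : Fin n → Tot W) (g : Fn W) :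
    lieLift q r (fn g) = ∑ l, q l * fn (Fn.dx l g) := by
  simp [lieLift, lmul_apply, dX, dP, dTh, dPsi, Fn.dx]
@[simp] theorem lieLift_pp (q r : Fin n → Tot W) (i : Fin n) : lieLift q r (pp i) = r i := by
  simp [lieLift, lmul_apply, dX, dP, dTh, dPsi, pp]
@[simp] theorem lieLift_theta (q r : Fin n → Tot W) (i : Fin n) :
    lieLift q r (theta i) = -dTarget (q i) := by
  simp [lieLift, lmul_apply, dX, dP, dTh, dPsi, theta]
@[simp] theorem lieLift_psi (q r : Fin n → Tot W) (i : Fin n) :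
    lieLift q r (psi i) = -dTarget (r i) := by
  simp [lieLift, lmul_apply, dX, dP, dTh, dPsi, psi]
@[simp] theorem lieLift_eta (q r : Fin n → Tot W) (a : Fin 2) : lieLift q r (eta a) = 0 := by
  simp [lieLift, lmul_apply, dX, dP, dTh, dPsi, eta]

/-- `∑ c_{ij} a_i b_j`. -/
def bil (c : Fin n → Fin n → Fn W) (a b : Fin n → Tot W) : Tot W :=
  ∑ i, ∑ j, fn (c i j) * a i * b j

/-- `∑ c_{ijk} a_i b_j d_k`. -/
def tri (c : Fin n → Fin n → Fin n → Fn W) (a b d : Fin n → Tot W) : Tot W :=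
  ∑ i, ∑ j, ∑ k, fn (c i j k) * a i * b j * d k

theorem mul_fn (a : Tot W) (g : Fn W) : a * fn g = fn g * a := ((isEvenE_fn g).comm a).symm

theorem sum_mul_bil (c : Fin n → Fin n → Fin n → Fn W) (a b d : Fin n → Tot W) :
    ∑ i, a i * bil (c i) b d = tri c a b d := by
  simp only [bil, tri, Finset.mul_sum, ← mul_assoc, mul_fn]

theorem bil_add_coeff (c c' : Fin n → Fin n → Fn W) (a b : Fin n → Tot W) :
    bil (fun i j => c i j + c' i j) a b = bil c a b + bil c' a b := by
  simp only [bil, fn_add, add_mul, Finset.sum_add_distrib]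

theorem bil_smul_coeff (r : ℝ) (c : Fin n → Fin n → Fn W) (a b : Fin n → Tot W) :
    bil (fun i j => r • c i j) a b = r • bil c a b := by
  simp only [bil, fn_smul, smul_mul_assoc, Finset.smul_sum]

theorem tri_add_coeff (c c' : Fin n → Fin n → Fin n → Fn W) (a b d : Fin n → Tot W) :
    tri (fun i j k => c i j k + c' i j k) a b d = tri c a b d + tri c' a b d := by
  simp only [tri, fn_add, add_mul, Finset.sum_add_distrib]

theorem tri_smul_coeff (r : ℝ) (c : Fin n → Fin n → Fin n → Fn W) (a b d : Fin n → Tot W) :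
    tri (fun i j k => r • c i j k) a b d = r • tri c a b d := by
  simp only [tri, fn_smul, smul_mul_assoc, Finset.smul_sum]

theorem bil_swap (c : Fin n → Fin n → Fn W) {a b : Fin n → Tot W} (ha : ∀ i, IsOddE (a i))
    (hb : ∀ i, IsOddE (b i)) : bil c a b = -bil (fun i j => c j i) b a := by
  simp only [bil]
  rw [Finset.sum_comm, ← Finset.sum_neg_distrib]
  refine Finset.sum_congr rfl fun j _ => ?_
  rw [← Finset.sum_neg_distrib]
  refine Finset.sum_congr rfl fun i _ => ?_
  rw [mul_assoc, (ha i).anticomm (hb j), mul_neg, mul_assoc]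

theorem tri_swap₁₂ (c : Fin n → Fin n → Fin n → Fn W) {a b : Fin n → Tot W} (d : Fin n → Tot W)
    (ha : ∀ i, IsOddE (a i)) (hb : ∀ i, IsOddE (b i)) :
    tri c a b d = -tri (fun i j k => c j i k) b a d := by
  simp only [tri]
  rw [Finset.sum_comm, ← Finset.sum_neg_distrib]
  refine Finset.sum_congr rfl fun j _ => ?_
  rw [← Finset.sum_neg_distrib]
  refine Finset.sum_congr rfl fun i _ => ?_
  rw [← Finset.sum_neg_distrib]
  refine Finset.sum_congr rfl fun k _ => ?_
  rw [mul_assoc _ (a i), (ha i).anticomm (hb j), mul_neg, neg_mul, mul_assoc _ (b j)]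

theorem tri_swap₂₃ (c : Fin n → Fin n → Fin n → Fn W) (a : Fin n → Tot W) {b d : Fin n → Tot W}
    (hb : ∀ i, IsOddE (b i)) (hd : ∀ i, IsOddE (d i)) :
    tri c a b d = -tri (fun i j k => c i k j) a d b := by
  rw [← sum_mul_bil, ← sum_mul_bil, ← Finset.sum_neg_distrib]
  refine Finset.sum_congr rfl fun i _ => ?_
  rw [bil_swap _ hb hd, mul_neg]

theorem eq_zero_of_eq_neg {E : Type*} [NormedAddCommGroup E] [NormedSpace ℝ E]
    {W : TopologicalSpace.Opens E} {κ o : Type} {x : SF W κ o} (h : x = -x) : x = 0 := by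
  have h2 : (2 : ℝ) • x = 0 := by rw [two_smul]; nth_rewrite 1 [h]; simp
  exact (smul_eq_zero.mp h2).resolve_left two_ne_zero

theorem bil_self_eq_zero {c : Fin n → Fin n → Fn W} (hc : ∀ i j, c i j = c j i)
    {a : Fin n → Tot W} (ha : ∀ i, IsOddE (a i)) : bil c a a = 0 := by
  refine eq_zero_of_eq_neg ?_
  nth_rewrite 1 [bil_swap c ha ha]
  rw [show (fun i j => c j i) = c from funext fun i => funext fun j => hc j i]

/-- This and the substitution lemmas below expand `q^i = π^{ji} p_j` inside a slot. No sign arises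
in any slot, because the coefficients are even and hence central; only the coefficient array
changes. -/
theorem bil_subst₁ (c M : Fin n → Fin n → Fn W) (p b : Fin n → Tot W) :
    bil c (fun i => ∑ l, fn (M l i) * p l) b = bil (fun l j => ∑ i, c i j * M l i) p b := by
  simp only [bil, fn_sum, fn_mul, Finset.mul_sum, Finset.sum_mul]
  rw [Finset.sum_comm, Finset.sum_comm (s := (Finset.univ : Finset (Fin n))) (t := Finset.univ)
    (f := fun l j => ∑ i, fn (c i j) * fn (M l i) * p l * b j)]
  refine Finset.sum_congr rfl fun j _ => ?_
  rw [Finset.sum_comm]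
  simp only [mul_assoc]

theorem bil_subst₂ (c M : Fin n → Fin n → Fn W) (a p : Fin n → Tot W) :
    bil c a (fun i => ∑ l, fn (M l i) * p l) = bil (fun i l => ∑ j, c i j * M l j) a p := by
  simp only [bil, fn_sum, fn_mul, Finset.mul_sum, Finset.sum_mul]
  refine Finset.sum_congr rfl fun i _ => ?_
  rw [Finset.sum_comm]
  refine Finset.sum_congr rfl fun l _ => Finset.sum_congr rfl fun j _ => ?_
  rw [← mul_assoc, mul_fn, ← mul_assoc, ← fn_mul, ← fn_mul, mul_comm]

theorem tri_subst₁ (c : Fin n → Fin n → Fin n → Fn W) (M : Fin n → Fin n → Fn W)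
    (p b d : Fin n → Tot W) : tri c (fun i => ∑ l, fn (M l i) * p l) b d
      = tri (fun l j k => ∑ i, c i j k * M l i) p b d := by
  have h := fun k => bil_subst₁ (fun i j => c i j k) M p b
  have e : ∀ (c' : Fin n → Fin n → Fin n → Fn W) (a' : Fin n → Tot W),
      tri c' a' b d = ∑ k, bil (fun i j => c' i j k) a' b * d k := by
    intro c' a'
    simp only [tri, bil, Finset.sum_mul]
    rw [eq_comm, Finset.sum_comm]
    exact Finset.sum_congr rfl fun i _ => Finset.sum_comm
  rw [e, e]
  exact Finset.sum_congr rfl fun k _ => by rw [h]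

theorem tri_subst₂ (c : Fin n → Fin n → Fin n → Fn W) (M : Fin n → Fin n → Fn W)
    (a p d : Fin n → Tot W) : tri c a (fun i => ∑ l, fn (M l i) * p l) d
      = tri (fun i l k => ∑ j, c i j k * M l j) a p d := by
  rw [← sum_mul_bil, ← sum_mul_bil]
  exact Finset.sum_congr rfl fun i _ => by rw [bil_subst₁]

theorem tri_subst₃ (c : Fin n → Fin n → Fin n → Fn W) (M : Fin n → Fin n → Fn W)
    (a b p : Fin n → Tot W) : tri c a b (fun i => ∑ l, fn (M l i) * p l)
      = tri (fun i j l => ∑ k, c i j k * M l k) a b p := by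
  rw [← sum_mul_bil, ← sum_mul_bil]
  exact Finset.sum_congr rfl fun i _ => by rw [bil_subst₂]

theorem tri_add₁ (c : Fin n → Fin n → Fin n → Fn W) (a a' b d : Fin n → Tot W) :
    tri c (fun i => a i + a' i) b d = tri c a b d + tri c a' b d := by
  simp only [tri, mul_add, add_mul, Finset.sum_add_distrib]

theorem tri_add₂ (c : Fin n → Fin n → Fin n → Fn W) (a b b' d : Fin n → Tot W) :
    tri c a (fun i => b i + b' i) d = tri c a b d + tri c a b' d := by
  simp only [tri, mul_add, add_mul, Finset.sum_add_distrib]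

theorem tri_add₃ (c : Fin n → Fin n → Fin n → Fn W) (a b d d' : Fin n → Tot W) :
    tri c a b (fun i => d i + d' i) = tri c a b d + tri c a b d' := by
  simp only [tri, mul_add, Finset.sum_add_distrib]

/-- Only the first slot has to be odd: the minus sign comes from moving `D` past `a`. In the
trilinear version the last term has passed two odd factors and is positive again. -/
theorem IsOddDer.bil {D : Tot W →ₗ[ℝ] Tot W} (hD : IsOddDer D) (c : Fin n → Fin n → Fn W)
    {a b : Fin n → Tot W} (ha : ∀ i, IsOddE (a i)) :
    D (bil c a b) = (∑ i, ∑ j, D (fn (c i j)) * a i * b j)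
      + bil c (fun i => D (a i)) b - bil c a (fun i => D (b i)) := by
  simp only [TwistedPSM.bil, map_sum, ← Finset.sum_add_distrib, ← Finset.sum_sub_distrib]
  refine Finset.sum_congr rfl fun i _ => Finset.sum_congr rfl fun j _ => ?_
  rw [hD.leibniz, hD.leibniz, map_mul, parity_fn, (ha i).parity]
  noncomm_ring

theorem IsOddDer.tri {D : Tot W →ₗ[ℝ] Tot W} (hD : IsOddDer D)
    (c : Fin n → Fin n → Fin n → Fn W) {a b d : Fin n → Tot W} (ha : ∀ i, IsOddE (a i))
    (hb : ∀ i, IsOddE (b i)) :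
    D (tri c a b d) = (∑ i, ∑ j, ∑ k, D (fn (c i j k)) * a i * b j * d k)
      + tri c (fun i => D (a i)) b d - tri c a (fun i => D (b i)) d
      + tri c a b (fun i => D (d i)) := by
  simp only [TwistedPSM.tri, map_sum, ← Finset.sum_add_distrib, ← Finset.sum_sub_distrib]
  refine Finset.sum_congr rfl fun i _ => Finset.sum_congr rfl fun j _ =>
    Finset.sum_congr rfl fun k _ => ?_
  rw [hD.leibniz, hD.leibniz, hD.leibniz]
  simp only [map_mul, parity_fn, (ha i).parity, (hb j).parity]
  noncomm_ring

theorem dX_tri (m : Fin n) (c : Fin n → Fin n → Fin n → Fn W) (a b d : Fin n → Tot W) :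
    dX m (tri c a b d) = tri (fun i j k => Fn.dx m (c i j k)) a b d
      + tri c (fun i => dX m (a i)) b d + tri c a (fun i => dX m (b i)) d
      + tri c a b (fun i => dX m (d i)) := by
  have hD : IsEvenDer (dX m : Tot W →ₗ[ℝ] Tot W) := isEvenDer_dBase _
  have hf : ∀ g : Fn W, dX m (fn g : Tot W) = fn (Fn.dx m g) := dBase_fn _
  simp only [tri, map_sum, ← Finset.sum_add_distrib]
  refine Finset.sum_congr rfl fun i _ => Finset.sum_congr rfl fun j _ =>
    Finset.sum_congr rfl fun k _ => ?_
  rw [hD.leibniz, hD.leibniz, hD.leibniz, hf]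
  noncomm_ring

end Operators

/-! ### Consequences of the twisted Jacobi identity and of `dH = 0`: `L_Q² = 0` on `x^i` and `p_i`.
-/

section Structure

variable {n : ℕ} {W : TopologicalSpace.Opens (Eu 2 × Eu n)}

theorem sum_fn_mul_bil (g : Fin n → Fn W) (C : Fin n → Fin n → Fin n → Fn W)
    (a b : Fin n → Tot W) :
    ∑ l, fn (g l) * bil (C l) a b = bil (fun i j => ∑ l, g l * C l i j) a b := by
  simp only [bil, fn_sum, fn_mul, Finset.mul_sum, Finset.sum_mul]
  rw [Finset.sum_comm]
  refine Finset.sum_congr rfl fun i _ => ?_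
  rw [Finset.sum_comm]
  simp only [mul_assoc]

/-- The components satisfy the equations of a twisted Poisson structure, and do not depend on the
point of the surface. -/
structure Comps.IsTwisted (c : Comps W) : Prop where
  bi_swap : ∀ i j, c.bi i j = -c.bi j i
  three_swap₁ : ∀ i j k, c.three i j k = -c.three j i k
  three_swap₂ : ∀ i j k, c.three i j k = -c.three i k j
  bi_sheet : ∀ a i j, Fn.partial (bas a, 0) (c.bi i j) = 0
  three_sheet : ∀ a i j k, Fn.partial (bas a, 0) (c.three i j k) = 0
  closed : ∀ i j k l, Fn.dx i (c.three j k l) - Fn.dx j (c.three i k l)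
    + Fn.dx k (c.three i j l) - Fn.dx l (c.three i j k) = 0
  jacobi : ∀ i j k, (∑ l, (c.bi i l * Fn.dx l (c.bi j k) + c.bi j l * Fn.dx l (c.bi k i)
      + c.bi k l * Fn.dx l (c.bi i j)))
    = ∑ a, ∑ b, ∑ d, c.three a b d * c.bi a i * c.bi b j * c.bi d k

variable (c : Comps W)

/-- `Q̂ x^i = dx^i + π^{ji} p_j`. -/
def Comps.F (i : Fin n) : Tot W := theta i + c.qx i

/-- `Q̂ p_i = dp_i - ½ C_i^{jk} p_j p_k`. -/
def Comps.G (i : Fin n) : Tot W := psi i + c.qp i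

/-- `½ π^{ij} p_i p_j`. -/
def Comps.biFn : Tot W := (1 / 2 : ℝ) • bil c.bi pp pp

theorem Comps.qx_eq : c.qx = fun i => ∑ j, fn (c.bi j i) * pp j := rfl

theorem Comps.isOddE_qx (i : Fin n) : IsOddE (c.qx i) :=
  IsOddE.sum _ fun j => (isEvenE_fn _).mul_odd (isOddE_pp j)

theorem Comps.isEvenE_qp (i : Fin n) : IsEvenE (c.qp i) :=
  (IsEvenE.smul _ (IsEvenE.sum _ fun j => IsEvenE.sum _ fun k =>
    ((isEvenE_fn _).mul_odd (isOddE_pp j)).mul (isOddE_pp k))).neg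

theorem Comps.isOddE_F (i : Fin n) : IsOddE (c.F i) := (isOddE_theta i).add (c.isOddE_qx i)

theorem Comps.isEvenE_G (i : Fin n) : IsEvenE (c.G i) := (isEvenE_psi i).add (c.isEvenE_qp i)

/-- The vector field `L_Q`. -/
def Comps.lie : Tot W →ₗ[ℝ] Tot W := lieLift c.qx c.qp

theorem Comps.isOddDer_lie : IsOddDer c.lie := isOddDer_lieLift c.isOddE_qx c.isEvenE_qp

theorem Comps.isOddDer_Qhat : IsOddDer c.Qhat :=
  (isOddDer_dSheet.add isOddDer_dTarget).add c.isOddDer_lie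

theorem Comps.Qhat_apply (z : Tot W) : c.Qhat z = dSheet z + dTarget z + c.lie z := rfl

theorem Comps.lie_fn (g : Fn W) : c.lie (fn g) = ∑ l, c.qx l * fn (Fn.dx l g) :=
  lieLift_fn _ _ g

theorem Comps.lie_pp (i : Fin n) : c.lie (pp i) = c.qp i := lieLift_pp _ _ i

theorem Comps.Qhat_fn (g : Fn W) :
    c.Qhat (fn g) = dSheet (fn g) + ∑ l, c.F l * fn (Fn.dx l g) := by
  simp only [Comps.Qhat_apply, dTarget_fn, Comps.lie_fn, Comps.F, add_mul,
    Finset.sum_add_distrib, add_assoc]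

theorem Comps.Qhat_pp (i : Fin n) : c.Qhat (pp i) = c.G i := by
  simp [Comps.Qhat_apply, Comps.G, Comps.lie_pp]

theorem Fn.partial_mk_apply {E : Type*} [NormedAddCommGroup E] [NormedSpace ℝ E]
    {W : TopologicalSpace.Opens E} (v : E) (g : E → ℝ) (hg : ContDiffOn ℝ ∞ g W) (w : W) :
    (Fn.partial v (Fn.mk g hg) : W → ℝ) w = fderiv ℝ g w v := by
  change fderiv ℝ (ext0 W (Fn.mk g hg)) w v = _
  have h : ext0 W (Fn.mk g hg) =ᶠ[nhds (w : E)] g := by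
    filter_upwards [W.isOpen.mem_nhds w.2] with y hy
    exact ext0_apply W (Fn.mk g hg) ⟨y, hy⟩
  rw [h.fderiv_eq]

theorem Fn.partial_xx (i : Fin n) (v : Eu 2 × Eu n) (h : ContDiffOn ℝ ∞ (fun w : Eu 2 × Eu n =>
    w.2 i) W) : Fn.partial v (Fn.mk (fun w => w.2 i) h : Fn W) = algebraMap ℝ _ (v.2 i) := by
  ext w
  rw [Fn.partial_mk_apply]
  have : HasFDerivAt (fun w : Eu 2 × Eu n => w.2 i)
      ((EuclideanSpace.proj i : Eu n →L[ℝ] ℝ).comp (ContinuousLinearMap.snd ℝ (Eu 2) (Eu n)))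
      (w : Eu 2 × Eu n) :=
    ((EuclideanSpace.proj i : Eu n →L[ℝ] ℝ).comp
      (ContinuousLinearMap.snd ℝ (Eu 2) (Eu n))).hasFDerivAt
  rw [this.fderiv]
  rfl

theorem Comps.Qhat_xx (i : Fin n) : c.Qhat (xx i) = c.F i := by
  rw [xx, Comps.Qhat_fn, dSheet_fn]
  simp only [Fn.dx, Fn.partial_xx, ← fnHom_apply, AlgHom.commutes]
  rw [Finset.sum_eq_single i]
  · simp
  · intro l _ hl
    simp [Ne.symm hl]
  · simp

variable {c}

theorem Comps.IsTwisted.str_swap (hc : c.IsTwisted) (i j k : Fin n) :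
    c.str i j k = -c.str i k j := by
  have h1 : Fn.dx i (c.bi j k) = -Fn.dx i (c.bi k j) := by rw [hc.bi_swap, map_neg]
  rw [Comps.str, Comps.str, h1, neg_add]
  congr 1
  rw [Finset.sum_comm]
  simp only [← Finset.sum_neg_distrib]
  refine Finset.sum_congr rfl fun a _ => Finset.sum_congr rfl fun b _ => ?_
  rw [hc.three_swap₂]; ring

theorem Comps.IsTwisted.three_cyc (hc : c.IsTwisted) (i j k : Fin n) :
    c.three i j k = c.three k i j := by
  rw [hc.three_swap₂, hc.three_swap₁, neg_neg]

/-- `Q² x^i` is quadratic in the `p`, so it vanishes as soon as its coefficient is symmetric in the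
two indices. The antisymmetric part of that coefficient is precisely the twisted Jacobi identity for
`m, k, i`, the `H`-term of `C` supplying the right hand side. -/
theorem Comps.IsTwisted.lie_qx (hc : c.IsTwisted) (i : Fin n) : c.lie (c.qx i) = 0 := by
  have h1 : c.lie (c.qx i) = bil (fun l j => Fn.dx l (c.bi j i)) c.qx pp
      + ∑ j, fn ((-1 / 2 : ℝ) • c.bi j i) * bil (c.str j) pp pp := by
    rw [Comps.qx, map_sum, bil, Finset.sum_comm, ← Finset.sum_add_distrib]
    refine Finset.sum_congr rfl fun j _ => ?_
    rw [c.isOddDer_lie.leibniz, Comps.lie_fn, Comps.lie_pp, parity_fn, Finset.sum_mul]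
    congr 1
    · simp only [mul_fn]
    · rw [Comps.qp, bil, fn_smul, smul_mul_assoc, mul_neg, mul_smul_comm, ← neg_smul]
      norm_num
  rw [h1, Comps.qx_eq, bil_subst₁, sum_fn_mul_bil, ← bil_add_coeff]
  refine bil_self_eq_zero (fun m k => ?_) isOddE_pp
  have hJ := hc.jacobi m k i
  have hS : ∑ j, c.bi j i * c.str j m k
      = (∑ l, c.bi l i * Fn.dx l (c.bi m k))
        + ∑ a, ∑ b, ∑ d, c.three a b d * c.bi a m * c.bi b k * c.bi d i := by
    have h2 : ∑ a, ∑ b, ∑ d, c.three a b d * c.bi a m * c.bi b k * c.bi d i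
        = ∑ d, ∑ a, ∑ b, c.three a b d * c.bi a m * c.bi b k * c.bi d i := by
      rw [eq_comm, Finset.sum_comm]
      exact Finset.sum_congr rfl fun a _ => Finset.sum_comm
    rw [h2, ← Finset.sum_add_distrib]
    refine Finset.sum_congr rfl fun j _ => ?_
    rw [Comps.str, mul_add, Finset.mul_sum]
    congr 1
    refine Finset.sum_congr rfl fun a _ => ?_
    rw [Finset.mul_sum]
    refine Finset.sum_congr rfl fun b _ => ?_
    rw [hc.three_cyc a b j, hc.bi_swap m a, hc.bi_swap k b]
    ring
  have hS' : ∑ j, c.bi j i * c.str j k m = -∑ j, c.bi j i * c.str j m k := by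
    rw [← Finset.sum_neg_distrib]
    exact Finset.sum_congr rfl fun j _ => by rw [hc.str_swap]; ring
  have e1 : ∑ l, c.bi k l * Fn.dx l (c.bi i m) = -∑ l, Fn.dx l (c.bi m i) * c.bi k l := by
    rw [← Finset.sum_neg_distrib]
    exact Finset.sum_congr rfl fun l _ => by rw [hc.bi_swap i m, map_neg]; ring
  have e2 : ∑ l, c.bi i l * Fn.dx l (c.bi m k) = -∑ l, c.bi l i * Fn.dx l (c.bi m k) := by
    rw [← Finset.sum_neg_distrib]
    exact Finset.sum_congr rfl fun l _ => by rw [hc.bi_swap i l]; ring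
  have e3 : ∑ l, c.bi m l * Fn.dx l (c.bi k i) = ∑ l, Fn.dx l (c.bi k i) * c.bi m l :=
    Finset.sum_congr rfl fun l _ => mul_comm _ _
  rw [Finset.sum_add_distrib, Finset.sum_add_distrib, e1, e2, e3] at hJ
  simp only [smul_mul_assoc, ← Finset.smul_sum]
  rw [hS', hS, ← hJ]
  module

theorem tri_neg_coeff (C : Fin n → Fin n → Fin n → Fn W) (a b d : Fin n → Tot W) :
    tri (fun i j k => -C i j k) a b d = -tri C a b d := by
  simp only [tri, fn_neg, neg_mul, Finset.sum_neg_distrib]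

theorem tri_cyc (C : Fin n → Fin n → Fin n → Fn W) {a : Fin n → Tot W}
    (ha : ∀ i, IsOddE (a i)) : tri C a a a = tri (fun i j k => C k i j) a a a := by
  rw [tri_swap₁₂ C a ha ha, tri_swap₂₃ _ a ha ha, neg_neg]

/-- The Jacobi identity contracted with `p_i p_j p_k`. Its three cyclic terms contribute equally,
which gives the factor `3`; the sign appears because `q^a = π^{ia} p_i`, whereas the right hand side
of the identity carries `π^{ai}`, and three transpositions give `(-1)³`. -/
theorem Comps.IsTwisted.tri_qx (hc : c.IsTwisted) :
    tri (fun l j k => Fn.dx l (c.bi j k)) c.qx pp pp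
      = (-1 / 3 : ℝ) • tri c.three c.qx c.qx c.qx := by
  rw [Comps.qx_eq, tri_subst₁, tri_subst₁, tri_subst₂, tri_subst₃]
  set C : Fin n → Fin n → Fin n → Fn W := fun l j k => ∑ i, Fn.dx i (c.bi j k) * c.bi l i with hC
  set D : Fin n → Fin n → Fin n → Fn W := fun l j k =>
    ∑ d, (∑ b, (∑ a, c.three a b d * c.bi l a) * c.bi j b) * c.bi k d with hD
  have h1 : tri C pp pp pp = tri (fun i j k => C k i j) pp pp (pp : Fin n → Tot W) :=
    tri_cyc C isOddE_pp
  have h2 : tri (fun i j k => C k i j) pp pp (pp : Fin n → Tot W)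
      = tri (fun i j k => C j k i) pp pp pp := tri_cyc _ isOddE_pp
  have h3 : (3 : ℝ) • tri C pp pp (pp : Fin n → Tot W) = -tri D pp pp pp := by
    have : ∀ i j k, C i j k + C k i j + C j k i = (-1 : ℝ) • D i j k := by
      intro i j k
      have hJ := hc.jacobi i j k
      have e : ∑ a, ∑ b, ∑ d, c.three a b d * c.bi a i * c.bi b j * c.bi d k
          = (-1 : ℝ) • D i j k := by
        simp only [hD, Finset.sum_mul, Finset.smul_sum]
        rw [Finset.sum_congr rfl fun a _ => Finset.sum_comm, Finset.sum_comm]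
        refine Finset.sum_congr rfl fun d _ => ?_
        rw [Finset.sum_comm]
        refine Finset.sum_congr rfl fun b _ => Finset.sum_congr rfl fun a _ => ?_
        rw [hc.bi_swap a i, hc.bi_swap b j, hc.bi_swap d k, neg_one_smul]
        ring
      rw [← e, ← hJ]
      simp only [hC, ← Finset.sum_add_distrib]
      exact Finset.sum_congr rfl fun l _ => by ring
    rw [show -tri D pp pp pp = tri (fun i j k => (-1 : ℝ) • D i j k) pp pp (pp : Fin n → Tot W) by
      rw [tri_smul_coeff]; simp]
    simp only [← this]
    rw [tri_add_coeff, tri_add_coeff, ← h2, ← h1]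
    module
  linear_combination (norm := module) (1 / 3 : ℝ) • h3

/-- In this form the twist enters `Q_m` only through `H_{mjk} q^j q^k`, so that it can be compared
with `tri_qx` and with `H F F F`. -/
theorem Comps.IsTwisted.qp_eq (m : Fin n) :
    c.qp m = (-1 / 2 : ℝ) • bil (fun j k => Fn.dx m (c.bi j k)) pp pp
      + (-1 / 2 : ℝ) • bil (c.three m) c.qx c.qx := by
  have h : bil (c.three m) c.qx c.qx
      = bil (fun j k => ∑ j', ∑ k', c.three m j' k' * c.bi j j' * c.bi k k') pp pp := by
    rw [Comps.qx_eq, bil_subst₁, bil_subst₂]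
    congr 1
    funext j k
    rw [Finset.sum_comm]
    simp only [Finset.sum_mul]
  rw [h, ← smul_add, ← bil_add_coeff, show (-1 / 2 : ℝ) = -(1 / 2) by norm_num, neg_smul]
  rfl

/-- Closedness of `H` contracted with three odd elements: the three terms in which an index other
than `m` is differentiated differ by permutations and become equal. -/
theorem Comps.IsTwisted.tri_three (hc : c.IsTwisted) (m : Fin n) {a : Fin n → Tot W}
    (ha : ∀ i, IsOddE (a i)) : tri (fun i j k => Fn.dx m (c.three i j k)) a a a
      = (3 : ℝ) • tri (fun i j k => Fn.dx i (c.three m j k)) a a a := by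
  set T := tri (fun i j k => Fn.dx i (c.three m j k)) a a a with hT
  have h1 : tri (fun i j k => Fn.dx j (c.three m i k)) a a a = -T := tri_swap₁₂ _ _ ha ha
  have h2 : T = tri (fun i j k => Fn.dx k (c.three m i j)) a a a := tri_cyc _ ha
  have h3 : ∀ i j k, Fn.dx m (c.three i j k) = Fn.dx i (c.three m j k)
      + (-1 : ℝ) • Fn.dx j (c.three m i k) + Fn.dx k (c.three m i j) := by
    intro i j k
    rw [neg_one_smul]
    linear_combination hc.closed m i j k
  simp only [h3]
  rw [tri_add_coeff, tri_add_coeff, tri_smul_coeff, h1, ← hT, ← h2]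
  module

/-- `Q² p_m` is `-½` times the difference of the two sides of `tri_qx` differentiated along `x^m`.
Closedness replaces `∂_m H_{ijk}` by three copies of `∂_i H_{mjk}`, which matches the derivative of
the `H`-term in `qp_eq`; the terms with `∂_m q` match those in which `L_Q` hits a `p`. -/
theorem Comps.IsTwisted.lie_qp (hc : c.IsTwisted) (m : Fin n) : c.lie (c.qp m) = 0 := by
  set q' : Fin n → Tot W := fun j => dX m (c.qx j) with hq'
  have hXfn : ∀ g : Fn W, dX m (fn g : Tot W) = fn (Fn.dx m g) := dBase_fn _
  have hXpp : ∀ j, dX m (pp j : Tot W) = 0 := fun j => dBase_od _ _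
  have hX : IsEvenDer (dX m : Tot W →ₗ[ℝ] Tot W) := isEvenDer_dBase _
  have hq'odd : ∀ j, IsOddE (q' j) := fun j => hX.map_odd (c.isOddE_qx j)
  have hlq : (fun i => c.lie (c.qx i)) = fun _ => 0 := funext hc.lie_qx
  have z₁ : ∀ (C : Fin n → Fin n → Fn W) (b : Fin n → Tot W), bil C (fun _ => 0) b = 0 := by
    intro C b; simp [bil]
  have z₂ : ∀ (C : Fin n → Fin n → Fn W) (b : Fin n → Tot W), bil C b (fun _ => 0) = 0 := by
    intro C b; simp [bil]
  have t₂ : ∀ (C : Fin n → Fin n → Fin n → Fn W) (a b : Fin n → Tot W),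
      tri C a (fun _ => 0) b = 0 := by
    intro C a b; simp [tri]
  have t₃ : ∀ (C : Fin n → Fin n → Fin n → Fn W) (a b : Fin n → Tot W),
      tri C a b (fun _ => 0) = 0 := by
    intro C a b; simp [tri]
  have hfn : ∀ (C : Fin n → Fin n → Fn W) (a b : Fin n → Tot W),
      ∑ i, ∑ j, c.lie (fn (C i j)) * a i * b j = tri (fun l i j => Fn.dx l (C i j)) c.qx a b := by
    intro C a b
    simp only [Comps.lie_fn, Finset.sum_mul, tri, mul_fn]
    rw [eq_comm, Finset.sum_comm]
    exact Finset.sum_congr rfl fun i _ => Finset.sum_comm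
  -- the derivative of the Jacobi identity
  have hJ := congrArg (dX m) hc.tri_qx
  rw [map_smul, dX_tri, dX_tri] at hJ
  simp only [hXpp, t₂, t₃, add_zero] at hJ
  rw [← hq'] at hJ
  have hs₂ : tri c.three c.qx q' c.qx = tri c.three q' c.qx c.qx := by
    rw [tri_swap₁₂ _ _ c.isOddE_qx hq'odd]
    rw [show (fun i j k => c.three j i k) = fun i j k => -c.three i j k from
      funext fun i => funext fun j => funext fun k => hc.three_swap₁ j i k, tri_neg_coeff, neg_neg]
  have hs₃ : tri c.three c.qx c.qx q' = tri c.three q' c.qx c.qx := by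
    rw [← hs₂, tri_swap₂₃ _ _ c.isOddE_qx hq'odd]
    rw [show (fun i j k => c.three i k j) = fun i j k => -c.three i j k from
      funext fun i => funext fun j => funext fun k => hc.three_swap₂ i k j, tri_neg_coeff, neg_neg]
  rw [hs₂, hs₃, hc.tri_three m c.isOddE_qx] at hJ
  -- the term with `L p`
  have hB : bil (fun j k => Fn.dx m (c.bi j k)) c.qp pp
      = (1 / 2 : ℝ) • tri (fun l j k => Fn.dx l (c.bi j k)) q' pp pp
        + (1 / 2 : ℝ) • tri c.three q' c.qx c.qx := by
    have e : ∀ j, q' j = -∑ k, fn (Fn.dx m (c.bi j k)) * pp k := by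
      intro j
      rw [hq', ← Finset.sum_neg_distrib]
      simp only [Comps.qx, map_sum]
      refine Finset.sum_congr rfl fun k _ => ?_
      rw [hX.leibniz, hXfn, hXpp, hc.bi_swap, map_neg, fn_neg]
      simp
    have : bil (fun j k => Fn.dx m (c.bi j k)) c.qp pp = -∑ j, q' j * c.qp j := by
      simp only [e, bil, neg_mul, Finset.sum_neg_distrib, neg_neg, Finset.sum_mul]
      refine Finset.sum_congr rfl fun j _ => Finset.sum_congr rfl fun k _ => ?_
      rw [mul_assoc, (c.isEvenE_qp j).comm, mul_assoc]
    rw [this, ← sum_mul_bil, ← sum_mul_bil]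
    simp only [Finset.smul_sum, ← Finset.sum_add_distrib, ← Finset.sum_neg_distrib]
    refine Finset.sum_congr rfl fun j _ => ?_
    rw [Comps.IsTwisted.qp_eq, mul_add, mul_smul_comm, mul_smul_comm]
    module
  have hB' : bil (fun j k => Fn.dx m (c.bi j k)) pp c.qp
      = -bil (fun j k => Fn.dx m (c.bi j k)) c.qp pp := by
    simp only [bil]
    rw [Finset.sum_comm, ← Finset.sum_neg_distrib]
    refine Finset.sum_congr rfl fun j _ => ?_
    rw [← Finset.sum_neg_distrib]
    refine Finset.sum_congr rfl fun k _ => ?_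
    rw [hc.bi_swap k j, map_neg, fn_neg, mul_assoc, ← (c.isEvenE_qp j).comm]
    simp [mul_assoc]
  have hcomm : tri (fun l j k => Fn.dx l (Fn.dx m (c.bi j k))) c.qx pp pp
      = tri (fun l j k => Fn.dx m (Fn.dx l (c.bi j k))) c.qx pp pp := by
    simp only [Fn.dx, fun l j k => Fn.partial_comm (0, bas m) (0, bas l) (c.bi j k)]
  rw [Comps.IsTwisted.qp_eq, map_add, map_smul, map_smul, c.isOddDer_lie.bil _ isOddE_pp,
    c.isOddDer_lie.bil _ c.isOddE_qx, hlq, z₁, z₂, hfn, hfn]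
  simp only [Comps.lie_pp]
  rw [show bil (fun j k => Fn.dx m (c.bi j k)) (fun i => c.qp i) pp
    = bil (fun j k => Fn.dx m (c.bi j k)) c.qp pp from rfl,
    show bil (fun j k => Fn.dx m (c.bi j k)) pp (fun i => c.qp i)
    = bil (fun j k => Fn.dx m (c.bi j k)) pp c.qp from rfl, hB', hB, hcomm]
  linear_combination (norm := module) (-1 / 2 : ℝ) • hJ

end Structure

/-! ### The primitive of `H̃`, the action of `ε̂` on `H̃`, and the variation formula. -/

section Basic

variable {n : ℕ} {W : TopologicalSpace.Opens (Eu 2 × Eu n)} {c : Comps W}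

theorem Comps.IsTwisted.tri_comm₁₂ (hc : c.IsTwisted) {a b : Fin n → Tot W} (d : Fin n → Tot W)
    (ha : ∀ i, IsOddE (a i)) (hb : ∀ i, IsOddE (b i)) :
    tri c.three a b d = tri c.three b a d := by
  rw [tri_swap₁₂ _ _ ha hb]
  rw [show (fun i j k => c.three j i k) = fun i j k => -c.three i j k from
    funext fun i => funext fun j => funext fun k => hc.three_swap₁ j i k, tri_neg_coeff, neg_neg]

theorem Comps.IsTwisted.tri_comm₂₃ (hc : c.IsTwisted) (a : Fin n → Tot W) {b d : Fin n → Tot W}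
    (hb : ∀ i, IsOddE (b i)) (hd : ∀ i, IsOddE (d i)) :
    tri c.three a b d = tri c.three a d b := by
  rw [tri_swap₂₃ _ _ hb hd]
  rw [show (fun i j k => c.three i k j) = fun i j k => -c.three i j k from
    funext fun i => funext fun j => funext fun k => hc.three_swap₂ i k j, tri_neg_coeff, neg_neg]

theorem dSheet_bil {C : Fin n → Fin n → Fn W} (hC : ∀ a i j, Fn.partial (bas a, 0) (C i j) = 0)
    {a b : Fin n → Tot W} (hao : ∀ i, IsOddE (a i)) (ha : ∀ i, dSheet (a i) = 0)
    (hb : ∀ i, dSheet (b i) = 0) : dSheet (bil C a b) = 0 := by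
  rw [isOddDer_dSheet.bil C hao]
  simp [dSheet_fn, hC, fn_zero, bil, ha, hb]

theorem Comps.IsTwisted.dSheet_qx (hc : c.IsTwisted) (i : Fin n) : dSheet (c.qx i) = 0 := by
  rw [Comps.qx, map_sum]
  refine Finset.sum_eq_zero fun j _ => ?_
  rw [isOddDer_dSheet.leibniz, dSheet_pp, dSheet_fn]
  simp [hc.bi_sheet, fn_zero]

theorem Comps.IsTwisted.dSheet_qp (hc : c.IsTwisted) (i : Fin n) : dSheet (c.qp i) = 0 := by
  rw [Comps.IsTwisted.qp_eq, map_add, map_smul, map_smul,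
    dSheet_bil (fun a j k => ?_) isOddE_pp dSheet_pp dSheet_pp,
    dSheet_bil (fun a j k => hc.three_sheet a i j k) c.isOddE_qx hc.dSheet_qx hc.dSheet_qx]
  · simp
  · rw [Fn.dx, Fn.partial_comm, hc.bi_sheet, map_zero]

/-- `L_Q(dx^i) = -d q^i` cancels `d q^i`, and the rest is `L_Q q^i = 0` and independence of `σ`. The
same cancellation gives `Qhat_G`. -/
theorem Comps.IsTwisted.Qhat_F (hc : c.IsTwisted) (i : Fin n) : c.Qhat (c.F i) = 0 := by
  rw [Comps.F, map_add, Comps.Qhat_apply, Comps.Qhat_apply (z := c.qx i), hc.dSheet_qx, hc.lie_qx,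
    Comps.lie, lieLift_theta]
  simp

theorem Comps.IsTwisted.Qhat_G (hc : c.IsTwisted) (i : Fin n) : c.Qhat (c.G i) = 0 := by
  rw [Comps.G, map_add, Comps.Qhat_apply, Comps.Qhat_apply (z := c.qp i), hc.dSheet_qp, hc.lie_qp,
    Comps.lie, lieLift_psi]
  simp

theorem Comps.Qhat_fn_of_sheet (c : Comps W) {g : Fn W}
    (hg : ∀ a, Fn.partial (bas a, 0) g = 0) :
    c.Qhat (fn g) = ∑ l, c.F l * fn (Fn.dx l g) := by
  rw [Comps.Qhat_fn, dSheet_fn]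
  simp [hg, fn_zero]

/-- As `Q̂ F = 0`, only the coefficients are differentiated, and the result is `dH` evaluated on
four copies of `F`. -/
theorem Comps.IsTwisted.Qhat_tri_F (hc : c.IsTwisted) : c.Qhat (tri c.three c.F c.F c.F) = 0 := by
  have h1 : c.Qhat (tri c.three c.F c.F c.F)
      = ∑ l, c.F l * tri (fun i j k => Fn.dx l (c.three i j k)) c.F c.F c.F := by
    rw [c.isOddDer_Qhat.tri _ c.isOddE_F c.isOddE_F]
    simp only [hc.Qhat_F]
    simp only [tri, mul_zero, zero_mul, Finset.sum_const_zero, add_zero, sub_zero,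
      c.Qhat_fn_of_sheet (hc.three_sheet · _ _ _), Finset.sum_mul, Finset.mul_sum, ← mul_assoc]
    rw [eq_comm, Finset.sum_comm]
    refine Finset.sum_congr rfl fun i _ => ?_
    rw [Finset.sum_comm]
    exact Finset.sum_congr rfl fun j _ => Finset.sum_comm
  set V : Fin n → Fin n → Tot W :=
    fun l i => bil (fun j k => Fn.dx l (c.three i j k)) c.F c.F with hV
  have h2 : ∀ l, tri (fun i j k => Fn.dx l (c.three i j k)) c.F c.F c.F = ∑ i, c.F i * V l i :=
    fun l => (sum_mul_bil _ _ _ _).symm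
  have h3 : ∀ l, tri (fun i j k => Fn.dx l (c.three i j k)) c.F c.F c.F
      = (3 : ℝ) • ∑ i, c.F i * V i l := by
    intro l
    rw [hc.tri_three l c.isOddE_F, hV, sum_mul_bil]
  have h4 : ∑ l, c.F l * ∑ i, c.F i * V i l = -∑ l, c.F l * ∑ i, c.F i * V l i := by
    simp only [Finset.mul_sum]
    rw [Finset.sum_comm, ← Finset.sum_neg_distrib]
    refine Finset.sum_congr rfl fun i _ => ?_
    rw [← Finset.sum_neg_distrib]
    refine Finset.sum_congr rfl fun l _ => ?_
    rw [← mul_assoc, (c.isOddE_F l).anticomm (c.isOddE_F i), neg_mul, mul_assoc]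
  rw [h1]
  set X := ∑ l, c.F l * tri (fun i j k => Fn.dx l (c.three i j k)) c.F c.F c.F with hX
  have h5 : X = (3 : ℝ) • ∑ l, c.F l * ∑ i, c.F i * V i l := by
    rw [hX, Finset.smul_sum]
    exact Finset.sum_congr rfl fun l _ => by rw [h3, mul_smul_comm]
  have h6 : X = ∑ l, c.F l * ∑ i, c.F i * V l i := by simp only [hX, h2]
  rw [h4, ← h6] at h5
  -- Closedness gives `X = 3 ∑ F^l F^i V_{il}`, while exchanging the anticommuting `F^l` and `F^i`
  -- gives `∑ F^l F^i V_{il} = -X`; hence `X = -3X`.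
  have h7 : (4 : ℝ) • X = 0 := by linear_combination (norm := module) h5
  exact (smul_eq_zero.mp h7).resolve_left (by norm_num)

/-- `p_i dX^i + ½ π^{ij} p_i p_j`, the integrand of the sigma model. -/
def Comps.kin (c : Comps W) : Tot W := ∑ i, pp i * c.F i + c.biFn

theorem Comps.Htilde_eq_tri (c : Comps W) : c.Htilde
    = (1 / 6 : ℝ) • tri c.three theta theta theta
      + (1 / 2 : ℝ) • tri c.three theta theta c.qx + ∑ i, psi i * theta i := by
  rw [Comps.Htilde, Comps.qx_eq, tri_subst₃]
  congr 3
  simp only [tri, fn_sum, Finset.sum_mul, fn_mul]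
  exact Finset.sum_congr rfl fun i _ => Finset.sum_congr rfl fun j _ => Finset.sum_comm

/-- Expand `F = θ + q`. In `Q̂ K` the products `G q` cancel and leave `G_i θ^i + ½ ∂_l π^{jk} F^l
p_j p_k`. The `∂π` part of `G θ` cancels the `θ`-part of the second term, the `H θ q q` of `G θ`
cancels that of `⅙ H F F F`, and by `tri_qx` the remaining `q`-part equals `-⅙ H q q q`, which also
cancels. What survives is `H̃`. -/
theorem Comps.IsTwisted.Htilde_eq (hc : c.IsTwisted) :
    c.Htilde = (1 / 6 : ℝ) • tri c.three c.F c.F c.F + c.Qhat c.kin := by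
  have h2 : tri c.three c.F c.F c.F = tri c.three theta theta theta
      + (3 : ℝ) • tri c.three theta theta c.qx + (3 : ℝ) • tri c.three theta c.qx c.qx
      + tri c.three c.qx c.qx c.qx := by
    have hF : c.F = fun i => theta i + c.qx i := rfl
    have ht := isOddE_theta (n := n) (W := W)
    have hq := c.isOddE_qx
    rw [hF, tri_add₁, tri_add₂, tri_add₂, tri_add₃, tri_add₃, tri_add₃, tri_add₃]
    rw [hc.tri_comm₂₃ theta hq ht, hc.tri_comm₁₂ theta hq ht, hc.tri_comm₂₃ theta hq ht,
      hc.tri_comm₁₂ c.qx hq ht, hc.tri_comm₂₃ c.qx hq ht, hc.tri_comm₁₂ c.qx hq ht]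
    module
  have h3 : c.Qhat (∑ i, pp i * c.F i) = ∑ i, c.G i * c.F i := by
    rw [map_sum]
    refine Finset.sum_congr rfl fun i _ => ?_
    rw [c.isOddDer_Qhat.leibniz, hc.Qhat_F, Comps.Qhat_pp, mul_zero, add_zero]
  have h4 : c.Qhat c.biFn = (1 / 2 : ℝ) • tri (fun l j k => Fn.dx l (c.bi j k)) c.F pp pp
      - ∑ j, c.G j * c.qx j := by
    have e1 : bil c.bi c.G pp = -∑ j, c.G j * c.qx j := by
      simp only [bil, Comps.qx, Finset.mul_sum]
      rw [← Finset.sum_neg_distrib]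
      refine Finset.sum_congr rfl fun j _ => ?_
      rw [← Finset.sum_neg_distrib]
      refine Finset.sum_congr rfl fun k _ => ?_
      rw [hc.bi_swap, fn_neg, neg_mul, neg_mul, ← mul_fn, mul_assoc]
    have e2 : bil c.bi pp c.G = ∑ j, c.G j * c.qx j := by
      simp only [bil, Comps.qx, Finset.mul_sum]
      rw [Finset.sum_comm]
      refine Finset.sum_congr rfl fun j _ => Finset.sum_congr rfl fun k _ => ?_
      rw [← (c.isEvenE_G j).comm]
    rw [Comps.biFn, map_smul, c.isOddDer_Qhat.bil _ isOddE_pp]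
    simp only [Comps.Qhat_pp]
    rw [show (fun i => c.G i) = c.G from rfl, e1, e2]
    have e3 : ∑ i, ∑ j, c.Qhat (fn (c.bi i j)) * pp i * pp j
        = tri (fun l j k => Fn.dx l (c.bi j k)) c.F pp pp := by
      simp only [c.Qhat_fn_of_sheet (hc.bi_sheet · _ _), Finset.sum_mul, tri, mul_fn]
      rw [eq_comm, Finset.sum_comm]
      exact Finset.sum_congr rfl fun i _ => Finset.sum_comm
    rw [e3]
    module
  have h5 : tri (fun l j k => Fn.dx l (c.bi j k)) c.F pp pp
      = tri (fun l j k => Fn.dx l (c.bi j k)) theta pp pp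
        + (-1 / 3 : ℝ) • tri c.three c.qx c.qx c.qx := by
    rw [← hc.tri_qx]; exact tri_add₁ _ _ _ _ _
  have h6 : ∑ i, c.G i * c.F i - ∑ i, c.G i * c.qx i
      = ∑ i, psi i * theta i + ((-1 / 2 : ℝ) • tri (fun l j k => Fn.dx l (c.bi j k)) theta pp pp
        + (-1 / 2 : ℝ) • tri c.three theta c.qx c.qx) := by
    rw [← sum_mul_bil, ← sum_mul_bil, ← Finset.sum_sub_distrib]
    simp only [Finset.smul_sum, ← Finset.sum_add_distrib]
    refine Finset.sum_congr rfl fun i _ => ?_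
    rw [Comps.F, mul_add, add_sub_cancel_right, Comps.G, add_mul, (c.isEvenE_qp i).comm,
      Comps.IsTwisted.qp_eq, mul_add, mul_smul_comm, mul_smul_comm]
  rw [c.Htilde_eq_tri, Comps.kin, map_add, h3, h4, h2, h5]
  linear_combination (norm := module) -h6

/-- The cross terms of `D²` cancel by the sign rule, so `D² = 0` on a product follows from `D² = 0`
on its factors. -/
theorem IsOddDer.sq_mul {D : Tot W →ₗ[ℝ] Tot W} (hD : IsOddDer D) (a b : Tot W) :
    D (D (a * b)) = D (D a) * b + a * D (D b) := by
  rw [hD.leibniz, map_add, hD.leibniz, hD.leibniz, hD.anti, parity_parity]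
  noncomm_ring

/-- `Q̂²` contracts the symmetric Hessian of `g` with the anticommuting `F`. -/
theorem Comps.IsTwisted.Qhat_Qhat_fn (hc : c.IsTwisted) {g : Fn W}
    (hg : ∀ a, Fn.partial (bas a, 0) g = 0) : c.Qhat (c.Qhat (fn g)) = 0 := by
  have h : c.Qhat (c.Qhat (fn g)) = -bil (fun l m => Fn.dx m (Fn.dx l g)) c.F c.F := by
    rw [c.Qhat_fn_of_sheet hg, map_sum, bil, ← Finset.sum_neg_distrib]
    refine Finset.sum_congr rfl fun l _ => ?_
    rw [c.isOddDer_Qhat.leibniz, hc.Qhat_F, (c.isOddE_F l).parity, c.Qhat_fn_of_sheet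
      (fun a => by rw [Fn.dx, Fn.partial_comm, hg, map_zero]), zero_mul, zero_add, neg_mul,
      Finset.mul_sum]
    congr 1
    refine Finset.sum_congr rfl fun m _ => ?_
    rw [mul_fn, ← mul_assoc, mul_fn]
  rw [h, bil_self_eq_zero (fun l m => by simp only [Fn.dx]; exact Fn.partial_comm _ _ _) c.isOddE_F, neg_zero]

theorem Comps.IsTwisted.Qhat_Qhat_kin (hc : c.IsTwisted) : c.Qhat (c.Qhat c.kin) = 0 := by
  have h : ∀ i, c.Qhat (c.Qhat (pp i)) = 0 := fun i => by rw [Comps.Qhat_pp, hc.Qhat_G]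
  have hs := c.isOddDer_Qhat.sq_mul
  simp [Comps.kin, Comps.biFn, bil, hs, h, hc.Qhat_F, hc.Qhat_Qhat_fn (hc.bi_sheet · _ _)]

theorem Comps.IsTwisted.Qhat_Htilde (hc : c.IsTwisted) : c.Qhat c.Htilde = 0 := by
  rw [hc.Htilde_eq, map_add, map_smul, hc.Qhat_tri_F, hc.Qhat_Qhat_kin, smul_zero, add_zero]

variable (e : Fin n → Fn W)

theorem isOddDer_epsHat : IsOddDer (epsHat e) :=
  isOddDer_lieLift (fun _ => IsOddE.zero) fun _ => isEvenE_fn _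

@[simp] theorem epsHat_fn (g : Fn W) : epsHat e (fn g) = 0 := by
  simp [epsHat, lieLift_fn]
@[simp] theorem epsHat_pp (i : Fin n) : epsHat e (pp i) = fn (e i) := lieLift_pp _ _ i
@[simp] theorem epsHat_theta (i : Fin n) : epsHat e (theta i) = 0 := by
  simp [epsHat]
theorem epsHat_psi (i : Fin n) :
    epsHat e (psi i) = -∑ l, theta l * fn (Fn.dx l (e i)) := by
  simp [epsHat, dTarget_fn]

/-- The derivatives of `ε` in `ε̂` enter only through `d` of the target, which does not see a factor
depending on `σ` alone. Thus `ε̂` is linear over functions on the surface, which is what makes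
localization by `λ` possible. -/
theorem epsHat_smul {g : Fn W} (hg : ∀ i, Fn.dx i g = 0) (z : Tot W) :
    epsHat (fun i => g * e i) z = fn g * epsHat e z := by
  have hd : ∀ l i, Fn.dx l (g * e i) = g * Fn.dx l (e i) := fun l i => by
    rw [Fn.dx, Fn.partial_mul]; change Fn.dx l g * _ + _ = _; rw [hg]; ring
  have h : ∀ i, dTarget (fn (g * e i) : Tot W) = fn g * dTarget (fn (e i)) := by
    intro i
    rw [dTarget_fn, dTarget_fn, Finset.mul_sum]
    refine Finset.sum_congr rfl fun l _ => ?_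
    rw [hd, fn_mul, ← mul_assoc, mul_fn (theta l) g, mul_assoc]
  simp only [epsHat, lieLift, LinearMap.sum_apply, LinearMap.sub_apply, LinearMap.add_apply,
    lmul_apply, h, Finset.mul_sum]
  refine Finset.sum_congr rfl fun i _ => ?_
  simp only [fn_mul, Pi.zero_apply, map_zero, zero_mul, mul_add, mul_sub, mul_assoc, mul_zero]

/-- The components of `dε + ι_{Π^# ε} H`. -/
def Comps.twist (c : Comps W) (i j : Fin n) : Fn W :=
  Fn.dx i (e j) - Fn.dx j (e i) + ∑ k, ∑ l, c.bi k l * e l * c.three k i j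

theorem epsHat_qx (c : Comps W) (i : Fin n) : epsHat e (c.qx i) = fn (∑ j, c.bi j i * e j) := by
  rw [Comps.qx, map_sum, fn_sum]
  refine Finset.sum_congr rfl fun j _ => ?_
  rw [(isOddDer_epsHat e).leibniz]
  simp [fn_mul]

/-- `ε̂` kills `x` and `dx`, so only two terms of `H̃` contribute: `dp_i dx^i` gives the derivatives
of `ε`, and `½ H dx dx q` gives the contraction of `H` with `Π^# ε`, with a sign from `π^{lk} =
-π^{kl}`. -/
theorem Comps.IsTwisted.epsHat_Htilde (hc : c.IsTwisted) :
    epsHat e c.Htilde = (-1 / 2 : ℝ) • bil (c.twist e) theta theta := by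
  have t0 : ∀ (C : Fin n → Fin n → Fin n → Fn W) (a b : Fin n → Tot W),
      tri C a b (fun _ => 0) = 0 ∧ tri C a (fun _ => 0) b = 0 ∧ tri C (fun _ => 0) a b = 0 :=
    fun C a b => by simp [tri]
  have hE := isOddDer_epsHat e
  have hd : bil (fun i j => Fn.dx i (e j) - Fn.dx j (e i)) theta (theta : _ → Tot W)
      = (2 : ℝ) • bil (fun i j => Fn.dx i (e j)) theta theta := by
    have := bil_swap (fun i j => Fn.dx i (e j)) isOddE_theta (isOddE_theta (n := n) (W := W))
    rw [show (fun i j => Fn.dx i (e j) - Fn.dx j (e i))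
      = fun i j => Fn.dx i (e j) + (-1 : ℝ) • Fn.dx j (e i) from by ext; simp [sub_eq_add_neg],
      bil_add_coeff, bil_smul_coeff]
    linear_combination (norm := module) (-1 : ℝ) • this
  have h2 : bil (c.twist e) theta (theta : _ → Tot W)
      = (2 : ℝ) • bil (fun i j => Fn.dx i (e j)) theta theta
        + bil (fun i j => ∑ k, ∑ l, c.bi k l * e l * c.three k i j) theta theta := by
    rw [← hd, ← bil_add_coeff]; rfl
  have h3 : epsHat e (tri c.three theta theta c.qx)
      = -bil (fun i j => ∑ k, ∑ l, c.bi k l * e l * c.three k i j) theta theta := by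
    rw [hE.tri _ isOddE_theta isOddE_theta]
    simp only [epsHat_fn, epsHat_theta, t0, zero_mul, Finset.sum_const_zero, add_zero, zero_add,
      sub_zero, epsHat_qx]
    simp only [tri, bil]
    rw [← Finset.sum_neg_distrib]
    refine Finset.sum_congr rfl fun i _ => ?_
    rw [← Finset.sum_neg_distrib]
    refine Finset.sum_congr rfl fun j _ => ?_
    rw [fn_sum, Finset.sum_mul, Finset.sum_mul, ← Finset.sum_neg_distrib]
    refine Finset.sum_congr rfl fun k _ => ?_
    rw [mul_fn, ← mul_assoc, ← mul_assoc, ← fn_mul, ← neg_mul, ← neg_mul, ← fn_neg]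
    congr 3
    rw [Finset.sum_mul, ← Finset.sum_neg_distrib]
    refine Finset.sum_congr rfl fun l _ => ?_
    rw [hc.three_cyc i j k, hc.bi_swap l k]
    ring
  have h4 : epsHat e (∑ i, psi i * theta i)
      = -bil (fun i j => Fn.dx i (e j)) theta theta := by
    simp only [map_sum, hE.leibniz, epsHat_theta, epsHat_psi, mul_zero, add_zero, neg_mul,
      Finset.sum_neg_distrib, Finset.sum_mul, mul_fn, bil]
    rw [Finset.sum_comm]
  rw [c.Htilde_eq_tri, map_add, map_add, map_smul, map_smul, h3, h4, h2, hE.tri _ isOddE_theta isOddE_theta]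
  simp only [epsHat_fn, epsHat_theta, t0, zero_mul, Finset.sum_const_zero, add_zero, sub_zero]
  module

/-- Applying `∂/∂θ^i` and then `∂/∂θ^j` reads off `2 C_{ij}`. -/
theorem bil_theta_eq_zero {C : Fin n → Fin n → Fn W} (hC : ∀ i j, C i j = -C j i)
    (h : bil C theta theta = (0 : Tot W)) (i j : Fin n) : C i j = 0 := by
  have hD : ∀ i, IsOddDer (dTh i : Tot W →ₗ[ℝ] Tot W) := fun i => isOddDer_dOd _
  have hf : ∀ i (g : Fn W), dTh i (fn g : Tot W) = 0 := fun i g => dOd_fn _ _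
  have ht : ∀ i j, dTh i (theta j : Tot W) = if j = i then 1 else 0 := fun i j => by
    rw [dTh, theta, dOd_od]; simp
  have hp : ∀ j, parity (theta j : Tot W) = -theta j := fun j => (isOddE_theta j).parity
  have h1 : dTh i (bil C theta theta : Tot W) = (2 : ℝ) • ∑ k, fn (C i k) * theta k := by
    rw [(hD i).bil _ isOddE_theta, two_smul]
    simp only [hf, ht, zero_mul, Finset.sum_const_zero, zero_add, bil, mul_ite, mul_one, mul_zero,
      ite_mul, Finset.sum_ite_eq', Finset.mem_univ, if_true]
    rw [Finset.sum_comm]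
    simp only [Finset.sum_ite_eq', Finset.mem_univ, if_true]
    rw [sub_eq_add_neg, ← Finset.sum_neg_distrib]
    congr 1
    exact Finset.sum_congr rfl fun k _ => by rw [hC k i, fn_neg, neg_mul, neg_neg]
  have h2 : dTh j (dTh i (bil C theta theta : Tot W)) = (2 : ℝ) • fn (C i j) := by
    rw [h1, map_smul, map_sum]
    congr 1
    simp [(hD j).leibniz, hf, ht]
  rw [h, map_zero, map_zero] at h2
  exact fn_injective (((smul_eq_zero.mp h2.symm).resolve_left two_ne_zero).trans fn_zero.symm)

theorem Comps.IsTwisted.twist_swap (hc : c.IsTwisted) (i j : Fin n) :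
    c.twist e i j = -c.twist e j i := by
  rw [Comps.twist, Comps.twist, neg_add, neg_sub]
  congr 1
  simp only [← Finset.sum_neg_distrib]
  exact Finset.sum_congr rfl fun k _ => Finset.sum_congr rfl fun l _ => by
    rw [hc.three_swap₂]; ring

theorem Comps.IsTwisted.epsHat_Htilde_eq_zero_iff (hc : c.IsTwisted) :
    epsHat e c.Htilde = 0 ↔ ∀ i j, c.twist e i j = 0 := by
  rw [hc.epsHat_Htilde]
  refine ⟨fun h i j => ?_, fun h => ?_⟩
  · exact bil_theta_eq_zero (hc.twist_swap e)
      ((smul_eq_zero.mp h).resolve_left (by norm_num)) i j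
  · simp [bil, h, fn_zero]

/-- Closedness is automatic, and the bracket kills whatever both operators kill, so horizontality is
the only real condition. -/
theorem Comps.IsTwisted.basic_iff (hc : c.IsTwisted) :
    (c.Qhat c.Htilde = 0 ∧ epsHat e c.Htilde = 0 ∧ oddBracket c.Qhat (epsHat e) c.Htilde = 0) ↔
      ∀ i j, c.twist e i j = 0 := by
  rw [← hc.epsHat_Htilde_eq_zero_iff]
  refine ⟨fun h => h.2.1, fun h => ⟨hc.Qhat_Htilde, h, ?_⟩⟩
  rw [oddBracket, LinearMap.add_apply, LinearMap.comp_apply, LinearMap.comp_apply, h,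
    hc.Qhat_Htilde, map_zero, map_zero, add_zero]

theorem IsOddDer.oddBracket {D D' : Tot W →ₗ[ℝ] Tot W} (hD : IsOddDer D) (hD' : IsOddDer D') :
    IsEvenDer (oddBracket D D') := by
  constructor
  · intro a b
    simp only [TwistedPSM.oddBracket, LinearMap.add_apply, LinearMap.comp_apply, hD'.leibniz,
      hD.leibniz, map_add, hD.anti, hD'.anti, parity_parity]
    noncomm_ring
  · intro a
    simp only [TwistedPSM.oddBracket, LinearMap.add_apply, LinearMap.comp_apply, map_add, hD.anti,
      hD'.anti, map_neg, neg_neg]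

/-- The variation of the integrand of the functional is exact up to the horizontal part of `H̃`. -/
theorem Comps.IsTwisted.kinVar_add_wzVar (hc : c.IsTwisted)
    {N : TopologicalSpace.Opens (Eu 2)} {f : Tot W →ₐ[ℝ] Forms N}
    (hf : ∀ z, deRham N (f z) = f (c.Qhat z)) :
    c.kinVar e f + c.wzVar e f = deRham N (f (epsHat e c.kin)) + f (epsHat e c.Htilde) := by
  have hE := isOddDer_epsHat e
  have hd := c.isOddDer_Qhat.oddBracket hE
  set δ := oddBracket c.Qhat (epsHat e) with hδ
  have hδ' : ∀ z, δ z = c.Qhat (epsHat e z) + epsHat e (c.Qhat z) := fun z => rfl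
  have hx : ∀ i, δ (xx i) = epsHat e (c.F i) := fun i => by
    rw [hδ', xx, epsHat_fn, ← xx, c.Qhat_xx, map_zero, zero_add]
  have hF : ∀ i, δ (c.F i) = c.Qhat (epsHat e (c.F i)) := fun i => by
    rw [hδ', hc.Qhat_F, map_zero, add_zero]
  -- After `d f = f Q̂`, the definition of `kinVar` is the Leibniz expansion of `δ K`: on the
  -- coordinates `δ F^i = Q̂ ε̂ F^i = Q̂ δ x^i`, so varying `dX^i` is the same as differentiating
  -- `δX^i`.
  have h1 : c.kinVar e f = f (δ c.kin) := by
    simp only [Comps.kinVar, gtVar, ← hδ, hf, c.Qhat_xx, hx, ← hF, Comps.kin, Comps.biFn, bil,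
      map_add, map_sum, map_smul, hd.leibniz, map_mul, add_mul]
  -- `ε̂` kills the coefficients `H_{ijk}` and acts in the same way on each of the three `F`, so `3
  -- · ⅙` gives the `½` of the Wess–Zumino variation.
  have h2 : c.wzVar e f = f (epsHat e ((1 / 6 : ℝ) • tri c.three c.F c.F c.F)) := by
    have h3 : epsHat e (tri c.three c.F c.F c.F)
        = (3 : ℝ) • tri c.three (fun i => epsHat e (c.F i)) c.F c.F := by
      have hv : ∀ i, IsEvenE (epsHat e (c.F i)) := fun i => hE.map_odd (c.isOddE_F i)
      have e1 : tri c.three c.F (fun i => epsHat e (c.F i)) c.F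
          = -tri c.three (fun i => epsHat e (c.F i)) c.F c.F := by
        simp only [tri]
        rw [Finset.sum_comm]
        simp only [← Finset.sum_neg_distrib]
        refine Finset.sum_congr rfl fun i _ => Finset.sum_congr rfl fun j _ =>
          Finset.sum_congr rfl fun k _ => ?_
        rw [hc.three_swap₁, fn_neg, neg_mul, neg_mul, neg_mul, mul_assoc _ (c.F j),
          ← (hv i).comm, ← mul_assoc]
      have e2 : tri c.three c.F c.F (fun i => epsHat e (c.F i))
          = -tri c.three c.F (fun i => epsHat e (c.F i)) c.F := by
        rw [← sum_mul_bil, ← sum_mul_bil, ← Finset.sum_neg_distrib]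
        refine Finset.sum_congr rfl fun i _ => ?_
        rw [← mul_neg]
        congr 1
        simp only [bil]
        rw [Finset.sum_comm]
        simp only [← Finset.sum_neg_distrib]
        refine Finset.sum_congr rfl fun j _ => Finset.sum_congr rfl fun k _ => ?_
        rw [hc.three_swap₂, fn_neg, neg_mul, neg_mul, mul_assoc _ (c.F k),
          ← (hv j).comm, ← mul_assoc]
      rw [hE.tri _ c.isOddE_F c.isOddE_F, e2, e1]
      simp only [epsHat_fn, zero_mul, Finset.sum_const_zero]
      module
    rw [map_smul, h3, smul_smul, map_smul]
    simp only [Comps.wzVar, gtVar, ← hδ, hf, c.Qhat_xx, hx, tri, map_sum, map_mul]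
    norm_num
  -- `δ K = Q̂ ε̂ K + ε̂ Q̂ K`: the first term is exact after pull back, the second combines with
  -- the Wess–Zumino term to `ε̂ H̃`.
  rw [h1, h2, hf, hc.Htilde_eq, hδ', map_add, map_add, map_add]
  abel

end Basic

/-! ### From geometric data on the target to components in charts. -/

section ChartComponents

variable {n : ℕ} {M : Type*} [TopologicalSpace M] [ChartedSpace (Eu n) M]
variable {S : Type*} [TopologicalSpace S] [ChartedSpace (Eu 2) S]

theorem fderiv_comp_snd_apply {g : Eu n → ℝ} {w : Eu 2 × Eu n} (hg : DifferentiableAt ℝ g w.2)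
    (v : Eu 2 × Eu n) : fderiv ℝ (fun w : Eu 2 × Eu n => g w.2) w v = fderiv ℝ g w.2 v.2 := by
  have h : HasFDerivAt (fun w : Eu 2 × Eu n => g w.2)
      ((fderiv ℝ g w.2).comp (ContinuousLinearMap.snd ℝ (Eu 2) (Eu n))) w :=
    hg.hasFDerivAt.comp w hasFDerivAt_snd
  rw [h.fderiv]; rfl

theorem biComp_swap (P : Bivector (n := n) M) (e : OpenPartialHomeomorph M (Eu n)) (i j : Fin n)
    (y : Eu n) : biComp P e i j y = -biComp P e j i y := by
  rw [biComp, biComp, ← (P (e.symm y)).map_swap _ (i := 0) (j := 1) (by decide)]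
  congr 1
  ext k : 1
  fin_cases k <;> rfl

theorem threeComp_swap₁ (H : ThreeForm (n := n) M) (e : OpenPartialHomeomorph M (Eu n))
    (i j k : Fin n) (y : Eu n) : threeComp H e i j k y = -threeComp H e j i k y := by
  rw [threeComp, threeComp, ← (H (e.symm y)).map_swap _ (i := 0) (j := 1) (by decide)]
  congr 1
  ext k : 1
  fin_cases k <;> rfl

theorem threeComp_swap₂ (H : ThreeForm (n := n) M) (e : OpenPartialHomeomorph M (Eu n))
    (i j k : Fin n) (y : Eu n) : threeComp H e i j k y = -threeComp H e i k j y := by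
  rw [threeComp, threeComp, ← (H (e.symm y)).map_swap _ (i := 1) (j := 2) (by decide)]
  congr 1
  ext k : 1
  fin_cases k <;> rfl

variable (T : TwistedPoisson n M) (N : TopologicalSpace.Opens (Eu 2))
  {e : OpenPartialHomeomorph M (Eu n)} (he : e ∈ atlas (Eu n) M)

theorem coe_sum_fn {E : Type*} [NormedAddCommGroup E] [NormedSpace ℝ E]
    {W : TopologicalSpace.Opens E} {ι : Type*} (s : Finset ι) (g : ι → Fn W) (w : W) :
    ((∑ i ∈ s, g i : Fn W) : W → ℝ) w = ∑ i ∈ s, (g i : W → ℝ) w := by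
  rw [AddSubmonoidClass.coe_finsetSum, Finset.sum_apply]

theorem TwistedPoisson.partial_bi (v : Eu 2 × Eu n) (i j : Fin n) (w : opProd N (dom e)) :
    (Fn.partial v ((T.comps N he).bi i j) : opProd N (dom e) → ℝ) w
      = fderiv ℝ (biComp T.P e i j) (w : Eu 2 × Eu n).2 v.2 := by
  rw [TwistedPoisson.comps, Fn.partial_mk_apply]
  exact fderiv_comp_snd_apply (((T.smooth_P e he i j).contDiffAt
    (e.open_target.mem_nhds w.2.2)).differentiableAt (by simp)) _

theorem TwistedPoisson.partial_three (v : Eu 2 × Eu n) (i j k : Fin n) (w : opProd N (dom e)) :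
    (Fn.partial v ((T.comps N he).three i j k) : opProd N (dom e) → ℝ) w
      = fderiv ℝ (threeComp T.H e i j k) (w : Eu 2 × Eu n).2 v.2 := by
  rw [TwistedPoisson.comps, Fn.partial_mk_apply]
  exact fderiv_comp_snd_apply (((T.smooth_H e he i j k).contDiffAt
    (e.open_target.mem_nhds w.2.2)).differentiableAt (by simp)) _

theorem TwistedPoisson.isTwisted_comps : (T.comps N he).IsTwisted where
  bi_swap i j := by ext w; exact biComp_swap _ _ _ _ _
  three_swap₁ i j k := by ext w; exact threeComp_swap₁ _ _ _ _ _ _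
  three_swap₂ i j k := by ext w; exact threeComp_swap₂ _ _ _ _ _ _
  bi_sheet a i j := by ext w; rw [T.partial_bi]; simp
  three_sheet a i j k := by ext w; rw [T.partial_three]; simp
  closed i j k l := by
    ext w
    have := T.closed e he _ w.2.2 i j k l
    simp only [pd] at this
    simpa [Fn.dx, T.partial_three] using this
  jacobi i j k := by
    ext w
    have := T.jacobi e he _ w.2.2 i j k
    simp only [pd] at this
    simp only [Fn.dx, coe_sum_fn, Subalgebra.coe_add, Subalgebra.coe_mul, Pi.add_apply,
      Pi.mul_apply, T.partial_bi]
    exact this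

variable (ε : SectionMap n M S) {N} {c : OpenPartialHomeomorph S (Eu 2)}
  (hc : c ∈ atlas (Eu 2) S) (hN : N ≤ dom c)

theorem SectionMap.dx_comps (i j : Fin n) (w : opProd N (dom e)) :
    (Fn.dx i (ε.comps hc hN he j) : opProd N (dom e) → ℝ) w
      = pd (ε.comp (c.symm (w : Eu 2 × Eu n).1) e j) i (w : Eu 2 × Eu n).2 := by
  refine (Fn.partial_mk_apply (W := opProd N (dom e)) (0, bas i)
    (fun w : Eu 2 × Eu n => ε.comp (c.symm w.1) e j w.2) _ w).trans ?_
  rw [pd]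
  have hd : DifferentiableAt ℝ (fun w : Eu 2 × Eu n => ε.comp (c.symm w.1) e j w.2) w :=
    ((ε.smooth c hc e he j).contDiffAt
      ((c.open_target.prod e.open_target).mem_nhds ⟨hN w.2.1, w.2.2⟩)).differentiableAt (by simp)
  have h1 : HasFDerivAt (fun y : Eu n => ((w : Eu 2 × Eu n).1, y))
      (ContinuousLinearMap.inr ℝ (Eu 2) (Eu n)) (w : Eu 2 × Eu n).2 :=
    hasFDerivAt_prodMk_right _ _
  have h2 : HasFDerivAt (ε.comp (c.symm (w : Eu 2 × Eu n).1) e j)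
      ((fderiv ℝ (fun w : Eu 2 × Eu n => ε.comp (c.symm w.1) e j w.2) w).comp
        (ContinuousLinearMap.inr ℝ (Eu 2) (Eu n))) (w : Eu 2 × Eu n).2 :=
    HasFDerivAt.comp (w : Eu 2 × Eu n).2 (g := fun w : Eu 2 × Eu n => ε.comp (c.symm w.1) e j w.2)
      hd.hasFDerivAt h1
  rw [h2.fderiv]; rfl

theorem twist_comps_apply (i j : Fin n) (w : opProd N (dom e)) :
    ((T.comps N he).twist (ε.comps hc hN he) i j : opProd N (dom e) → ℝ) w
      = twistedDiff T ε (c.symm (w : Eu 2 × Eu n).1) e i j (w : Eu 2 × Eu n).2 := by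
  rw [twistedDiff, ← ε.dx_comps he hc hN i j w, ← ε.dx_comps he hc hN j i w]
  change _ + ((∑ k, ∑ l, (T.comps N he).bi k l * ε.comps hc hN he l * (T.comps N he).three k i j :
    Fn (opProd N (dom e))) : opProd N (dom e) → ℝ) w = _
  simp only [coe_sum_fn]
  rfl

theorem isBasicFor_iff : IsBasicFor T ε ↔ SatisfiesEquation T ε := by
  constructor
  · intro h s e he y hy i j
    have h1 := ((T.isTwisted_comps (dom (chartAt (Eu 2) s)) he).basic_iff _).mp
      (h (chartAt (Eu 2) s) (chart_mem_atlas _ s) e he) i j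
    have h2 := twist_comps_apply T he ε (chart_mem_atlas _ s) le_rfl i j
      ⟨(chartAt (Eu 2) s s, y), mem_chart_target _ s, hy⟩
    rw [h1] at h2
    have h3 : (chartAt (Eu 2) s).symm (chartAt (Eu 2) s s) = s :=
      (chartAt (Eu 2) s).left_inv (mem_chart_source _ s)
    rw [← h3]
    exact h2.symm
  · intro h c hc e he
    refine ((T.isTwisted_comps (dom c) he).basic_iff _).mpr fun i j => ?_
    ext w
    rw [twist_comps_apply]
    exact h _ e he _ w.2.2 i j

end ChartComponents

/-! ### Compactly supported forms on a planar domain and Stokes' theorem. -/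

section Integration

open MeasureTheory

variable {N : TopologicalSpace.Opens (Eu 2)}

theorem isOddDer_deRham : IsOddDer (deRham N) :=
  IsOddDer.sum _ fun a => (isOddE_od a).lmul (isEvenDer_dBase _)

/-- The constant `r` does not depend on `g`; this makes `topCoeff` linear over functions and lets
`r` be taken out of integrals. -/
theorem topCoeff_pure (p : MvPolynomial (Fin 0) ℝ)
    (x : ExteriorAlgebra ℝ (Fin 2 → ℝ)) :
    ∃ r : ℝ, ∀ g : Fn N, topCoeff (SF.pure g p x) = r • g := by
  refine ⟨TensorProduct.rid ℝ ℝ (TensorProduct.map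
    (MvPolynomial.aeval (fun _ : Fin 0 => (0 : ℝ))).toLinearMap
      (ExteriorAlgebra.algebraMapInv.toLinearMap ∘ₗ
        CliffordAlgebra.contractLeft (Q := (0 : QuadraticForm ℝ (Fin 2 → ℝ)))
          (LinearMap.proj 1) ∘ₗ
        CliffordAlgebra.contractLeft (Q := (0 : QuadraticForm ℝ (Fin 2 → ℝ)))
          (LinearMap.proj 0)) (p ⊗ₜ x)), fun g => ?_⟩
  simp only [topCoeff, SF.pure, LinearMap.comp_apply, AlgEquiv.toLinearMap_apply,
    AlgEquiv.apply_symm_apply, TensorProduct.map_tmul, LinearEquiv.coe_coe,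
    TensorProduct.rid_tmul, LinearMap.id_apply]

theorem topCoeff_fn_mul (g : Fn N) (β : Forms N) : topCoeff (fn g * β) = g * topCoeff β := by
  induction β using SF.induction_pure with
  | add a b ha hb => rw [mul_add, map_add, map_add, ha, hb, mul_add]
  | pure g' p x =>
    obtain ⟨r, hr⟩ := topCoeff_pure p x
    rw [fn_eq, SF.pure_mul, one_mul, one_mul, hr, hr, mul_smul_comm]

theorem ext0_eq_zero {E : Type*} [NormedAddCommGroup E] [NormedSpace ℝ E]
    {W : TopologicalSpace.Opens E} (f : W → ℝ) {u : E} (hu : u ∉ W) : ext0 W f u = 0 := by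
  rw [ext0, Function.extend_apply']
  · rfl
  · rintro ⟨w, rfl⟩; exact hu w.2

theorem ext0_add {E : Type*} [NormedAddCommGroup E] [NormedSpace ℝ E]
    {W : TopologicalSpace.Opens E} (f g : W → ℝ) : ext0 W (f + g) = ext0 W f + ext0 W g := by
  ext u
  by_cases hu : u ∈ W
  · have h := fun k : W → ℝ => ext0_apply W k ⟨u, hu⟩
    simp only at h
    simp [h]
  · simp [ext0_eq_zero _ hu]

theorem ext0_smul {E : Type*} [NormedAddCommGroup E] [NormedSpace ℝ E]
    {W : TopologicalSpace.Opens E} (r : ℝ) (f : W → ℝ) : ext0 W (r • f) = r • ext0 W f := by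
  ext u
  by_cases hu : u ∈ W
  · have h := fun k : W → ℝ => ext0_apply W k ⟨u, hu⟩
    simp only at h
    simp [h]
  · simp [ext0_eq_zero _ hu]

/-- The function vanishes outside a compact subset of its domain. -/
def IsCompactlySupported (h : Fn N) : Prop :=
  ∃ K : Set (Eu 2), IsCompact K ∧ K ⊆ N ∧ ∀ u : N, (u : Eu 2) ∉ K → (h : N → ℝ) u = 0

theorem IsCompactlySupported.mul {h : Fn N} (hh : IsCompactlySupported h) (g : Fn N) :
    IsCompactlySupported (h * g) := by
  obtain ⟨K, hK, hKN, h0⟩ := hh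
  refine ⟨K, hK, hKN, fun u hu => ?_⟩
  change (h : N → ℝ) u * (g : N → ℝ) u = 0
  rw [h0 u hu, zero_mul]

theorem IsCompactlySupported.ext0_eventuallyEq {h : Fn N} (hh : IsCompactlySupported h) {u : Eu 2}
    (hu : u ∉ N) : ext0 N h =ᶠ[nhds u] 0 := by
  obtain ⟨K, hK, hKN, h0⟩ := hh
  filter_upwards [hK.isClosed.isOpen_compl.mem_nhds fun h => hu (hKN h)] with y hy
  by_cases hyN : y ∈ N
  · exact (ext0_apply N h ⟨y, hyN⟩).trans (h0 ⟨y, hyN⟩ hy)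
  · exact ext0_eq_zero _ hyN

theorem IsCompactlySupported.contDiff {h : Fn N} (hh : IsCompactlySupported h) :
    ContDiff ℝ ∞ (ext0 N h) := by
  rw [contDiff_iff_contDiffAt]
  intro u
  by_cases hu : u ∈ N
  · exact h.2.contDiffAt (N.isOpen.mem_nhds hu)
  · exact contDiffAt_const.congr_of_eventuallyEq (hh.ext0_eventuallyEq hu)

theorem IsCompactlySupported.hasCompactSupport {h : Fn N} (hh : IsCompactlySupported h) :
    HasCompactSupport (ext0 N h) := by
  obtain ⟨K, hK, hKN, h0⟩ := hh
  refine HasCompactSupport.intro hK fun u hu => ?_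
  by_cases hyN : u ∈ N
  · exact (ext0_apply N h ⟨u, hyN⟩).trans (h0 ⟨u, hyN⟩ hu)
  · exact ext0_eq_zero _ hyN

theorem IsCompactlySupported.integrable {h : Fn N} (hh : IsCompactlySupported h) :
    Integrable (ext0 N h) :=
  hh.contDiff.continuous.integrable_of_hasCompactSupport hh.hasCompactSupport

theorem IsCompactlySupported.ext0_partial {h : Fn N} (hh : IsCompactlySupported h) (v : Eu 2) :
    ext0 N (Fn.partial v h) = fun u => fderiv ℝ (ext0 N h) u v := by
  ext u
  by_cases hu : u ∈ N
  · exact ext0_apply N (Fn.partial v h) ⟨u, hu⟩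
  · rw [ext0_eq_zero _ hu, (hh.ext0_eventuallyEq hu).fderiv_eq]
    simp [Pi.zero_def]

theorem IsCompactlySupported.partial {h : Fn N} (hh : IsCompactlySupported h) (v : Eu 2) :
    IsCompactlySupported (Fn.partial v h) := by
  obtain ⟨K, hK, hKN, h0⟩ := hh
  refine ⟨K, hK, hKN, fun u hu => ?_⟩
  change fderiv ℝ (ext0 N h) u v = 0
  have : ext0 N h =ᶠ[nhds (u : Eu 2)] 0 := by
    filter_upwards [hK.isClosed.isOpen_compl.mem_nhds hu, N.isOpen.mem_nhds u.2] with y hy hyN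
    exact (ext0_apply N h ⟨y, hyN⟩).trans (h0 ⟨y, hyN⟩ hy)
  rw [this.fderiv_eq]
  simp [Pi.zero_def]

theorem IsCompactlySupported.integral_partial {h : Fn N} (hh : IsCompactlySupported h)
    (v : Eu 2) : ∫ u, ext0 N (Fn.partial v h) u = 0 := by
  have hi := (hh.partial v).integrable
  rw [hh.ext0_partial v] at hi ⊢
  -- Integration by parts against the constant function `1`.
  have := integral_mul_fderiv_eq_neg_fderiv_mul_of_integrable (μ := volume) (𝕜 := ℝ)
    (f := fun _ : Eu 2 => (1 : ℝ)) (g := ext0 N h) (v := v) (by simp) (by simpa using hi)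
    (by simpa using hh.integrable) (fun _ _ => differentiableAt_const _)
    (fun x _ => hh.contDiff.differentiable (by simp) x)
  simpa using this

theorem integralForm_eq (α : Forms N) : integralForm α = ∫ u, ext0 N (topCoeff α) u :=
  setIntegral_eq_integral_of_forall_compl_eq_zero fun _ hu => ext0_eq_zero _ hu

/-- Stokes: on a monomial the top coefficient of `d(h β)` is a combination of partial derivatives of
a compactly supported function. Integrability is carried through the induction because additivity of
the integral needs it. -/
theorem deRham_fn_mul_integral {h : Fn N} (hh : IsCompactlySupported h) (β : Forms N) :
    Integrable (ext0 N (topCoeff (deRham N (fn h * β)))) ∧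
      ∫ u, ext0 N (topCoeff (deRham N (fn h * β))) u = 0 := by
  induction β using SF.induction_pure with
  | add a b ha hb =>
    have : ext0 N (topCoeff (deRham N (fn h * (a + b)))) = ext0 N (topCoeff (deRham N (fn h * a)))
        + ext0 N (topCoeff (deRham N (fn h * b))) := by
      rw [← ext0_add, mul_add, map_add, map_add]; rfl
    rw [this]
    exact ⟨ha.1.add hb.1, by rw [integral_add' ha.1 hb.1, ha.2, hb.2, add_zero]⟩
  | pure g p x =>
    have hk := hh.mul g
    have h1 : ∀ a : Fin 2, ∃ r : ℝ,
        topCoeff (od a * SF.pure (Fn.partial (bas a) (h * g)) p x : Forms N)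
          = r • Fn.partial (bas a) (h * g) := by
      intro a
      obtain ⟨r, hr⟩ := topCoeff_pure p (ExteriorAlgebra.ι ℝ (Pi.single a 1) * x)
      exact ⟨r, by rw [od_eq, SF.pure_mul, one_mul, one_mul, hr]⟩
    choose r hr using h1
    have h2 : ext0 N (topCoeff (deRham N (fn h * SF.pure g p x)))
        = r 0 • ext0 N (Fn.partial (bas 0) (h * g)) + r 1 • ext0 N (Fn.partial (bas 1) (h * g)) := by
      rw [← ext0_smul, ← ext0_smul, ← ext0_add, fn_eq, SF.pure_mul, one_mul, one_mul, deRham,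
        Fin.sum_univ_two, LinearMap.add_apply, lmul_apply, lmul_apply, dBase_pure, dBase_pure,
        map_add, hr, hr]
      rfl
    have i0 := ((hk.partial (bas 0)).integrable).smul (r 0)
    have i1 := ((hk.partial (bas 1)).integrable).smul (r 1)
    rw [h2]
    refine ⟨i0.add i1, ?_⟩
    rw [integral_add' i0 i1]
    simp only [Pi.smul_apply, integral_smul, hk.integral_partial, smul_zero, add_zero]

theorem integralForm_deRham_add {h : Fn N} (hh : IsCompactlySupported h) (β β' : Forms N) :
    integralForm (deRham N (fn h * β) + fn h * β') = ∫ u, ext0 N (h * topCoeff β' : Fn N) u := by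
  obtain ⟨h1, h2⟩ := deRham_fn_mul_integral hh β
  rw [integralForm_eq, map_add, topCoeff_fn_mul]
  have : ext0 N (topCoeff (deRham N (fn h * β)) + h * topCoeff β' : Fn N)
      = ext0 N (topCoeff (deRham N (fn h * β))) + ext0 N (h * topCoeff β' : Fn N) :=
    ext0_add _ _
  rw [this, integral_add' h1 (hh.mul _).integrable, h2, zero_add]

end Integration

/-! ### The variation of the functional as an integral against `λ`; sufficiency. -/

section Variation

variable {n : ℕ} {M : Type*} [TopologicalSpace M] [ChartedSpace (Eu n) M]
variable {S : Type*} [TopologicalSpace S] [ChartedSpace (Eu 2) S] [IsManifold (𝓡 2) ∞ S]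
variable (T : TwistedPoisson n M) (ε : SectionMap n M S) (lam : C^∞⟮𝓡 2, S; ℝ⟯)
  {N : TopologicalSpace.Opens (Eu 2)} {c : OpenPartialHomeomorph S (Eu 2)}
  (hc : c ∈ atlas (Eu 2) S) (hN : N ≤ dom c)
  {e : OpenPartialHomeomorph M (Eu n)} (he : e ∈ atlas (Eu n) M)

theorem contDiffOn_comp_symm (hc : c ∈ atlas (Eu 2) S) : ContDiffOn ℝ ∞ (fun u : Eu 2 => lam (c.symm u)) c.target := by
  rw [← contMDiffOn_iff_contDiffOn]
  exact lam.contMDiff.comp_contMDiffOn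
    (contMDiffOn_symm_of_mem_maximalAtlas (IsManifold.subset_maximalAtlas hc))

/-- A function on the surface in a chart. -/
def localFn : Fn N := Fn.mk (fun u => lam (c.symm u)) ((contDiffOn_comp_symm lam hc).mono hN)

/-- A function on the surface in a chart, as a function on the product. -/
def localFnProd (V : TopologicalSpace.Opens (Eu n)) : Fn (opProd N V) :=
  Fn.mk (fun w => lam (c.symm w.1))
    ((contDiffOn_comp_symm lam hc).comp contDiffOn_fst fun _ hw => hN hw.1)

theorem dx_localFnProd (V : TopologicalSpace.Opens (Eu n)) (i : Fin n) :
    Fn.dx i (localFnProd lam hc hN V) = 0 := by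
  ext w
  refine (Fn.partial_mk_apply (W := opProd N V) (0, bas i)
    (fun w : Eu 2 × Eu n => lam (c.symm w.1)) _ w).trans ?_
  have hd : DifferentiableAt ℝ (fun u => lam (c.symm u)) (w : Eu 2 × Eu n).1 :=
    ((contDiffOn_comp_symm lam hc).contDiffAt
      (c.open_target.mem_nhds (hN w.2.1))).differentiableAt (by simp)
  have h : HasFDerivAt (fun w : Eu 2 × Eu n => lam (c.symm w.1))
      ((fderiv ℝ (fun u => lam (c.symm u)) (w : Eu 2 × Eu n).1).comp
        (ContinuousLinearMap.fst ℝ (Eu 2) (Eu n))) w :=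
    HasFDerivAt.comp (w : Eu 2 × Eu n) (g := fun u => lam (c.symm u)) hd.hasFDerivAt hasFDerivAt_fst
  rw [h.fderiv]
  simp

theorem smul_comps : (ε.smul lam).comps hc hN he
    = fun i => localFnProd lam hc hN (dom e) * ε.comps hc hN he i := by
  funext i
  ext w
  rfl

/-- The support of `λ` is compact, being closed in the compact surface, and the chart maps it into
`N`. -/
theorem isCompactlySupported_localFn [CompactSpace S]
    (hl : tsupport lam ⊆ c.symm '' (N : Set (Eu 2))) :
    IsCompactlySupported (localFn lam hc hN) := by
  have hsub : tsupport lam ⊆ c.source := by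
    intro p hp
    obtain ⟨u, hu, rfl⟩ := hl hp
    exact c.map_target (hN hu)
  refine ⟨c '' tsupport lam, (isClosed_tsupport _).isCompact.image_of_continuousOn
    (c.continuousOn.mono hsub), ?_, fun u hu => ?_⟩
  · rintro _ ⟨p, hp, rfl⟩
    obtain ⟨u, hu, rfl⟩ := hl hp
    rwa [c.right_inv (hN hu)]
  · by_contra h
    exact hu ⟨c.symm u, subset_tsupport _ h, c.right_inv (hN u.2)⟩

/-- Both terms of `kinVar_add_wzVar` are linear in `λ`, so the exact one is `d` of a compactly
supported form and drops out. This holds for every lift, whatever `A` is. -/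
theorem integral_variation [CompactSpace S] {F : Field n M S}
    (hl : tsupport lam ⊆ c.symm '' (N : Set (Eu 2)))
    (hX : ∀ u ∈ N, F.X (c.symm u) ∈ e.source)
    {f : Tot (opProd N (dom e)) →ₐ[ℝ] Forms N} (hf : IsLift T F N c he f) :
    integralForm ((T.comps N he).kinVar ((ε.smul lam).comps hc hN he) f
        + (T.comps N he).wzVar ((ε.smul lam).comps hc hN he) f)
      = ∫ u, ext0 N (localFn lam hc hN
          * topCoeff (f (epsHat (ε.comps hc hN he) (T.comps N he).Htilde)) : Fn N) u := by
  have hfn : f (fn (localFnProd lam hc hN (dom e))) = fn (localFn lam hc hN) := by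
    obtain ⟨h, h1, h2⟩ := hf.base (localFnProd lam hc hN (dom e))
    rw [h1]
    congr 1
    ext u
    rw [h2]
    exact ext0_apply _ _ (⟨(u, e (F.X (c.symm u))), u.2, e.map_source (hX u u.2)⟩ :
      opProd N (dom e))
  rw [(T.isTwisted_comps N he).kinVar_add_wzVar _ hf.morphism, smul_comps,
    epsHat_smul _ (dx_localFnProd lam hc hN _), epsHat_smul _ (dx_localFnProd lam hc hN _),
    map_mul f, map_mul f, hfn,
    integralForm_deRham_add (isCompactlySupported_localFn lam hc hN hl)]

theorem SatisfiesEquation.isGaugeTransformation [CompactSpace S] {T : TwistedPoisson n M}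
    {ε : SectionMap n M S} (h : SatisfiesEquation T ε) : IsGaugeTransformation T ε := by
  intro lam F c hc e he N hN hX hl f hf
  have h0 : epsHat (ε.comps hc hN he) (T.comps N he).Htilde = 0 := by
    rw [(T.isTwisted_comps N he).epsHat_Htilde_eq_zero_iff]
    intro i j
    ext w
    rw [twist_comps_apply]
    exact h _ e he _ w.2.2 i j
  rw [integral_variation T ε lam hc hN he hl hX hf, h0, map_zero, map_zero, mul_zero]
  have : ext0 N ((0 : Fn N) : N → ℝ) = 0 := by
    ext u
    by_cases hu : u ∈ N
    · exact ext0_apply N _ ⟨u, hu⟩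
    · exact ext0_eq_zero _ hu
  rw [this]
  simp

end Variation

/-! ### Algebra homomorphisms out of superfunctions, and differential forms in two dimensions. -/

section Lift

variable {n : ℕ} {W : TopologicalSpace.Opens (Eu 2 × Eu n)} {N : TopologicalSpace.Opens (Eu 2)}

/-- The pull back of smooth functions. -/
def pullback (Φ : Eu 2 → Eu 2 × Eu n) (hΦ : ContDiffOn ℝ ∞ Φ N) (hm : Set.MapsTo Φ N W) :
    Fn W →ₐ[ℝ] Fn N where
  toFun g := Fn.mk (fun u => ext0 W g (Φ u)) (g.2.comp hΦ hm)
  map_one' := by ext u; exact ext0_apply W _ ⟨Φ u, hm u.2⟩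
  map_zero' := by ext u; exact ext0_apply W _ ⟨Φ u, hm u.2⟩
  map_mul' a b := by
    ext u
    have h := fun g : W → ℝ => ext0_apply W g ⟨Φ u, hm u.2⟩
    exact (h _).trans (congrArg₂ _ (h _).symm (h _).symm)
  map_add' a b := by
    ext u
    have h := fun g : W → ℝ => ext0_apply W g ⟨Φ u, hm u.2⟩
    exact (h _).trans (congrArg₂ _ (h _).symm (h _).symm)
  commutes' r := by ext u; exact ext0_apply W _ ⟨Φ u, hm u.2⟩

/-- Universal properties of the three tensor factors; odd values square to zero, as the exterior
algebra requires. Sending every `ψ_k` to `0` is enough because only fields with `A = 0` are lifted.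
-/
theorem exists_algHom (ρ : Fn W →ₐ[ℝ] Fn N) {v : OddIdx n → Forms N} (hv : ∀ j, IsOddE (v j)) :
    ∃ f : Tot W →ₐ[ℝ] Forms N, (∀ g, f (fn g) = fn (ρ g)) ∧ (∀ k, f (psi k) = 0) ∧
      ∀ j, f (od j) = v j := by
  let L : (OddIdx n → ℝ) →ₗ[ℝ] Forms N := Fintype.linearCombination ℝ v
  have hL : ∀ m, IsOddE (L m) := fun m =>
    IsOddE.sum (a := fun j => m j • v j) Finset.univ fun j => (hv j).smul _
  have hsq : ∀ m, L m * L m = 0 := fun m => eq_zero_of_eq_neg ((hL m).anticomm (hL m))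
  let f₁ : MvPolynomial (Fin n) ℝ →ₐ[ℝ] Forms N :=
    (Algebra.ofId ℝ (Forms N)).comp (MvPolynomial.aeval fun _ => (0 : ℝ))
  let f₂ : ExteriorAlgebra ℝ (OddIdx n → ℝ) →ₐ[ℝ] Forms N := ExteriorAlgebra.lift ℝ ⟨L, hsq⟩
  let f₃ : MvPolynomial (Fin n) ℝ ⊗[ℝ] ExteriorAlgebra ℝ (OddIdx n → ℝ) →ₐ[ℝ] Forms N :=
    Algebra.TensorProduct.lift f₁ f₂ fun x y =>
      Algebra.commute_algebraMap_left (MvPolynomial.aeval (fun _ => (0 : ℝ)) x) (f₂ y)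
  let f₄ : Fn W ⊗[ℝ] (MvPolynomial (Fin n) ℝ ⊗[ℝ] ExteriorAlgebra ℝ (OddIdx n → ℝ)) →ₐ[ℝ]
      Forms N :=
    Algebra.TensorProduct.lift (fnHom.comp ρ) f₃ fun x y => (isEvenE_fn (ρ x)).comm _
  have hp : ∀ g p x, f₄.comp (SF.equiv W _ _).toAlgHom (SF.pure g p x)
      = fn (ρ g) * (f₁ p * f₂ x) := fun g p x => rfl
  refine ⟨f₄.comp (SF.equiv W _ _).toAlgHom, fun g => ?_, fun k => ?_, fun j => ?_⟩
  · rw [fn_eq, hp, map_one, map_one, mul_one, mul_one]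
  · rw [psi, ev_eq, hp]; simp [f₁]
  · rw [od_eq, hp, map_one, map_one, one_mul]
    simp only [f₂, ExteriorAlgebra.lift_ι_apply]
    simp [L, fn_one, Fintype.linearCombination_apply, Pi.single_apply]

theorem deRham_fn (g : Fn N) : deRham N (fn g) = ∑ a, od a * fn (Fn.partial (bas a) g) := by
  simp only [deRham, LinearMap.sum_apply, lmul_apply, dBase_fn]

theorem deRham_od (a : Fin 2) : deRham N (od a) = 0 := by
  simp [deRham, lmul_apply]

theorem deRham_deRham_fn (g : Fn N) : deRham N (deRham N (fn g)) = 0 := by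
  have h : deRham N (deRham N (fn g))
      = -∑ a, ∑ b, (od a * od b : Forms N) * fn (Fn.partial (bas b) (Fn.partial (bas a) g)) := by
    rw [deRham_fn, map_sum, ← Finset.sum_neg_distrib]
    refine Finset.sum_congr rfl fun a _ => ?_
    rw [isOddDer_deRham.leibniz, deRham_od, parity_od, deRham_fn, zero_mul, zero_add, neg_mul,
      Finset.mul_sum]
    simp only [mul_assoc]
  rw [h, neg_eq_zero]
  refine eq_zero_of_eq_neg ?_
  nth_rewrite 1 [Finset.sum_comm]
  simp only [← Finset.sum_neg_distrib]
  refine Finset.sum_congr rfl fun a _ => Finset.sum_congr rfl fun b _ => ?_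
  rw [(isOddE_od b).anticomm (isOddE_od a), Fn.partial_comm, neg_mul]

theorem topCoeff_od_mul_od (a b : Fin 2) : topCoeff (od a * od b : Forms N)
    = ((Pi.single a 1 : Fin 2 → ℝ) 0 * (Pi.single b 1 : Fin 2 → ℝ) 1
      - (Pi.single b 1 : Fin 2 → ℝ) 0 * (Pi.single a 1 : Fin 2 → ℝ) 1) • (1 : Fn N) := by
  rw [od_eq, od_eq, SF.pure_mul, one_mul, one_mul]
  simp only [topCoeff, SF.pure, LinearMap.comp_apply, AlgEquiv.toLinearMap_apply,
    AlgEquiv.apply_symm_apply, TensorProduct.map_tmul, LinearEquiv.coe_coe,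
    TensorProduct.rid_tmul, LinearMap.id_apply]
  congr 1
  have h1 : ∀ (d : Module.Dual ℝ (Fin 2 → ℝ)) m, CliffordAlgebra.contractLeft
      (Q := (0 : QuadraticForm ℝ (Fin 2 → ℝ))) d (ExteriorAlgebra.ι ℝ m)
        = algebraMap ℝ _ (d m) := fun d m => CliffordAlgebra.contractLeft_ι _ _ _
  have h2 : ∀ (d : Module.Dual ℝ (Fin 2 → ℝ)) m m', CliffordAlgebra.contractLeft
      (Q := (0 : QuadraticForm ℝ (Fin 2 → ℝ))) d (ExteriorAlgebra.ι ℝ m * ExteriorAlgebra.ι ℝ m')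
        = d m • ExteriorAlgebra.ι ℝ m' - d m' • ExteriorAlgebra.ι ℝ m := fun d m m' => by
    refine (CliffordAlgebra.contractLeft_ι_mul _ _ _).trans ?_
    change _ - _ * CliffordAlgebra.contractLeft
      (Q := (0 : QuadraticForm ℝ (Fin 2 → ℝ))) d (ExteriorAlgebra.ι ℝ m') = _
    rw [h1, ← Algebra.commutes, ← Algebra.smul_def]
  rw [h2, map_sub, map_smul, map_smul, h1, h1]
  simp [ExteriorAlgebra.algebraMapInv]

/-- `da ∧ db` is the Jacobian determinant of `(a, b)`. -/
theorem topCoeff_deRham_mul_deRham (g a b : Fn N) :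
    topCoeff (fn g * deRham N (fn a) * deRham N (fn b))
      = g * (Fn.partial (bas 0) a * Fn.partial (bas 1) b
        - Fn.partial (bas 1) a * Fn.partial (bas 0) b) := by
  have h : fn g * deRham N (fn a) * deRham N (fn b) = ∑ p, ∑ q,
      fn (g * Fn.partial (bas p) a * Fn.partial (bas q) b) * (od p * od q) := by
    rw [deRham_fn, deRham_fn, mul_assoc, Finset.sum_mul_sum, Finset.mul_sum]
    refine Finset.sum_congr rfl fun p _ => ?_
    rw [Finset.mul_sum]
    refine Finset.sum_congr rfl fun q _ => ?_
    rw [fn_mul, fn_mul, ← (isEvenE_fn (Fn.partial (bas p) a)).comm,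
      ← (isEvenE_fn (Fn.partial (bas q) b)).comm, mul_assoc, mul_assoc, mul_assoc]
    congr 2
    rw [← mul_assoc, ← (isEvenE_fn (Fn.partial (bas q) b)).comm, mul_assoc]
  rw [h, Fin.sum_univ_two, Fin.sum_univ_two, Fin.sum_univ_two]
  simp only [map_add, topCoeff_fn_mul, topCoeff_od_mul_od]
  simp
  ring

end Lift

/-! ### The lift of a field with `A = 0`. -/

section LiftOfMap

variable {n : ℕ} {W : TopologicalSpace.Opens (Eu 2 × Eu n)} {N : TopologicalSpace.Opens (Eu 2)}

/-- A component of a map to Euclidean space. -/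
def compFn (N : TopologicalSpace.Opens (Eu 2)) {Y : Eu 2 → Eu n} (hY : ContDiff ℝ ∞ Y)
    (i : Fin n) : Fn N :=
  Fn.mk (fun u => Y u i) ((EuclideanSpace.proj i : Eu n →L[ℝ] ℝ).contDiff.comp hY).contDiffOn

theorem partial_compFn_apply {Y : Eu 2 → Eu n} (hY : ContDiff ℝ ∞ Y) (i : Fin n) (v : Eu 2)
    (u : N) : (Fn.partial v (compFn N hY i) : N → ℝ) u = fderiv ℝ Y u v i := by
  refine (Fn.partial_mk_apply v (fun u => Y u i) _ u).trans ?_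
  have h : HasFDerivAt (fun u => Y u i)
      ((EuclideanSpace.proj i : Eu n →L[ℝ] ℝ).comp (fderiv ℝ Y u)) (u : Eu 2) :=
    (EuclideanSpace.proj i : Eu n →L[ℝ] ℝ).hasFDerivAt.comp (u : Eu 2)
      (hY.differentiable (by simp) u).hasFDerivAt
  rw [h.fderiv]; rfl

/-- The pull back along the graph of a map. -/
def graphPullback {Y : Eu 2 → Eu n} (hY : ContDiff ℝ ∞ Y)
    (hm : Set.MapsTo (fun u => (u, Y u)) N (W : Set (Eu 2 × Eu n))) : Fn W →ₐ[ℝ] Fn N :=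
  pullback (fun u => (u, Y u)) (contDiff_id.prodMk hY).contDiffOn hm

theorem graphPullback_apply {Y : Eu 2 → Eu n} (hY : ContDiff ℝ ∞ Y)
    (hm : Set.MapsTo (fun u => (u, Y u)) N (W : Set (Eu 2 × Eu n))) (g : Fn W) (u : N) :
    (graphPullback hY hm g : N → ℝ) u = ext0 W g ((u : Eu 2), Y u) := rfl

theorem partial_graphPullback {Y : Eu 2 → Eu n} (hY : ContDiff ℝ ∞ Y)
    (hm : Set.MapsTo (fun u => (u, Y u)) N (W : Set (Eu 2 × Eu n))) (g : Fn W) (v : Eu 2) :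
    Fn.partial v (graphPullback hY hm g) = graphPullback hY hm (Fn.partial (v, 0) g)
      + ∑ l, Fn.partial v (compFn N hY l) * graphPullback hY hm (Fn.dx l g) := by
  ext u
  have hp : ∀ v', ext0 W (Fn.partial v' g) ((u : Eu 2), Y u)
      = fderiv ℝ (ext0 W g) ((u : Eu 2), Y u) v' := fun v' =>
    ext0_apply W (Fn.partial v' g) ⟨((u : Eu 2), Y u), hm u.2⟩
  have h1 : (Fn.partial v (graphPullback hY hm g) : N → ℝ) u
      = fderiv ℝ (fun u => ext0 W g (u, Y u)) u v := Fn.partial_mk_apply _ _ _ u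
  have hd : HasFDerivAt (fun u => ext0 W g (u, Y u))
      ((fderiv ℝ (ext0 W g) ((u : Eu 2), Y u)).comp
        ((ContinuousLinearMap.id ℝ (Eu 2)).prod (fderiv ℝ Y u))) (u : Eu 2) :=
    HasFDerivAt.comp (u : Eu 2) (g := ext0 W g) (f := fun u => (u, Y u))
      (differentiableAt_ext0 g ⟨((u : Eu 2), Y u), hm u.2⟩).hasFDerivAt
      ((hasFDerivAt_id _).prodMk (hY.differentiable (by simp) u).hasFDerivAt)
  have hv : (v, fderiv ℝ Y u v)
      = ((v, 0) : Eu 2 × Eu n) + ∑ l, (fderiv ℝ Y u v l) • ((0, bas l) : Eu 2 × Eu n) := by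
    have h3 : fderiv ℝ Y u v = ∑ l, (fderiv ℝ Y u v l) • (bas l : Eu n) := by
      ext k
      simp [Finset.sum_apply, Pi.single_apply]
    ext1
    · simp [Prod.fst_sum]
    · simpa [Prod.snd_sum] using h3
  rw [h1, hd.fderiv]
  simp only [Subalgebra.coe_add, Pi.add_apply, coe_sum_fn, Subalgebra.coe_mul, Pi.mul_apply,
    graphPullback_apply, partial_compFn_apply, Fn.dx, hp]
  change fderiv ℝ (ext0 W g) ((u : Eu 2), Y u) (v, fderiv ℝ Y u v) = _
  rw [hv, map_add, map_sum]
  simp only [map_smul, smul_eq_mul]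

variable {M : Type*} [TopologicalSpace M] [ChartedSpace (Eu n) M]
variable {S : Type*} [TopologicalSpace S] [ChartedSpace (Eu 2) S]

/-- When `A = 0`, the morphism condition on `x^i` and `p_i` forces `dx^i ↦ dX^i` and `dp_i ↦ 0`,
since `q^i` and `Q_i` go to zero. Conversely these values define a homomorphism, and `d f = f Q̂` is
checked on generators: on functions it is the chain rule, on `dx^i` it is `d² = 0`. -/
theorem exists_isLift (T : TwistedPoisson n M) {F : Field n M S} (hA : ∀ s, F.A s = 0)
    {c : OpenPartialHomeomorph S (Eu 2)} {e : OpenPartialHomeomorph M (Eu n)}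
    (he : e ∈ atlas (Eu n) M) {Y : Eu 2 → Eu n} (hY : ContDiff ℝ ∞ Y)
    (hm : ∀ u ∈ N, Y u ∈ e.target) (hX : ∀ u ∈ N, e (F.X (c.symm u)) = Y u) :
    ∃ f, IsLift T F N c he f ∧ ∀ i, f (theta i) = deRham N (fn (compFn N hY i)) := by
  have hm' : Set.MapsTo (fun u => (u, Y u)) N (opProd N (dom e) : Set (Eu 2 × Eu n)) :=
    fun u hu => ⟨hu, hm u hu⟩
  obtain ⟨f, hfn, hpsi, hod⟩ := exists_algHom (graphPullback hY hm')
    (v := Sum.elim od (Sum.elim (fun _ => 0) fun i => deRham N (fn (compFn N hY i)))) (by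
      rintro (a | i | i)
      · exact isOddE_od a
      · exact IsOddE.zero
      · exact isOddDer_deRham.map_even (isEvenE_fn _))
  have heta : ∀ a, f (eta a) = od a := fun a => hod _
  have hpp : ∀ i, f (pp i) = 0 := fun i => hod _
  have hth : ∀ i, f (theta i) = deRham N (fn (compFn N hY i)) := fun i => hod _
  refine ⟨f, ⟨fun g => ⟨_, hfn g, fun u => ?_⟩, heta, fun i => ⟨0, ?_, fun a u => ?_⟩, ?_⟩, hth⟩
  · rw [graphPullback_apply, hX u u.2]
  · rw [hpp]; simp [fn_zero]
  · rw [Field.comp, hA]; rfl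
  set C := T.comps N he with hC
  have hqx : ∀ i, f (C.qx i) = 0 := fun i => by simp [Comps.qx, hpp]
  have hqp : ∀ i, f (C.qp i) = 0 := fun i => by simp [Comps.qp, hpp]
  have hdqx : ∀ i, f (dTarget (C.qx i)) = 0 := fun i => by
    simp [Comps.qx, isOddDer_dTarget.leibniz, hpp, hpsi]
  have hdqp : ∀ i, f (dTarget (C.qp i)) = 0 := fun i => by
    simp [Comps.qp, isOddDer_dTarget.leibniz, hpp, hpsi]
  -- Compatibility with parity is proved along with the morphism property, because the Leibniz rule
  -- for `d (f a · f b)` contains `parity (f a)`.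
  have key : ∀ z, parity (f z) = f (parity z) ∧ deRham N (f z) = f (C.Qhat z) := by
    intro z
    induction z using SF.induction with
    | add a b ha hb => simp only [map_add, ha.1, hb.1, ha.2, hb.2, and_self]
    | mul a b ha hb =>
      refine ⟨by simp only [map_mul, ha.1, hb.1], ?_⟩
      rw [map_mul f, isOddDer_deRham.leibniz, C.isOddDer_Qhat.leibniz, map_add, map_mul f,
        map_mul f, ha.1, ha.2, hb.2]
    | fn g =>
      refine ⟨by rw [hfn, parity_fn, parity_fn, hfn], ?_⟩
      rw [hfn, Comps.Qhat_fn, dSheet_fn, deRham_fn]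
      simp only [partial_graphPullback, fn_add, fn_sum, fn_mul, map_add, map_sum, map_mul f, heta,
        hfn, Comps.F, hth, hqx, add_zero, deRham_fn, mul_add, Finset.sum_add_distrib,
        Finset.sum_mul, Finset.mul_sum]
      congr 1
      rw [Finset.sum_comm]
      simp only [mul_assoc]
    | ev k =>
      have h0 : f (ev k) = 0 := hpsi k
      refine ⟨by rw [parity_ev, h0, map_zero], ?_⟩
      change deRham N (f (ev k)) = f (C.Qhat (psi k))
      rw [h0, map_zero, Comps.Qhat_apply, Comps.lie, lieLift_psi]
      simp [hdqp]
    | od j =>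
      refine ⟨?_, ?_⟩
      · rw [parity_od, map_neg, hod]
        rcases j with a | i | i
        · exact parity_od a
        · simp
        · exact (isOddDer_deRham.map_even (isEvenE_fn _)).parity
      · rcases j with a | i | i
        · change deRham N (f (eta a)) = f (C.Qhat (eta a))
          rw [heta, deRham_od, Comps.Qhat_apply, Comps.lie, lieLift_eta]
          simp
        · change deRham N (f (pp i)) = f (C.Qhat (pp i))
          rw [hpp, Comps.Qhat_pp, Comps.G, map_add, hqp, hpsi]
          simp
        · change deRham N (f (theta i)) = f (C.Qhat (theta i))
          rw [hth, deRham_deRham_fn, Comps.Qhat_apply, Comps.lie, lieLift_theta]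
          simp [hdqx]
  exact fun z => (key z).2

end LiftOfMap

/-! ### Extension by zero from a chart of the surface. -/

section Extension

variable {S : Type*} [TopologicalSpace S] [ChartedSpace (Eu 2) S] [IsManifold (𝓡 2) ∞ S]
  [T2Space S]

/-- The image of the compact support is closed because the surface is Hausdorff, so the extension by
zero is smooth at points outside the chart too. It provides both the test functions `λ` and the maps
`X`; the last clause, on the values of `Φ`, keeps `X` inside a target chart. -/
theorem exists_extension {V : Type*} [NormedAddCommGroup V] [NormedSpace ℝ V]
    {c : OpenPartialHomeomorph S (Eu 2)} (hc : c ∈ atlas (Eu 2) S) {φ : Eu 2 → V}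
    (hφ : ContDiff ℝ ∞ φ) (hK : HasCompactSupport φ) (hs : tsupport φ ⊆ c.target) :
    ∃ Φ : S → V, ContMDiff (𝓡 2) 𝓘(ℝ, V) ∞ Φ ∧ (∀ u ∈ c.target, Φ (c.symm u) = φ u) ∧
      tsupport Φ ⊆ c.symm '' tsupport φ ∧ ∀ p, Φ p = 0 ∨ ∃ u, Φ p = φ u := by
  classical
  have hclosed : IsClosed (c.symm '' tsupport φ) :=
    (hK.isCompact.image_of_continuousOn (c.continuousOn_symm.mono hs)).isClosed
  have hzero : ∀ p ∉ c.symm '' tsupport φ, c.source.indicator (φ ∘ c) p = 0 := by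
    intro p hp
    by_cases hps : p ∈ c.source
    · rw [Set.indicator_of_mem hps]
      by_contra h
      exact hp ⟨c p, subset_tsupport _ h, c.left_inv hps⟩
    · exact Set.indicator_of_notMem hps _
  refine ⟨c.source.indicator (φ ∘ c), fun p => ?_, fun u hu => ?_, ?_, fun p => ?_⟩
  · by_cases hps : p ∈ c.source
    · have h1 : ContMDiffAt (𝓡 2) 𝓘(ℝ, V) ∞ (φ ∘ c) p :=
        hφ.contMDiff.contMDiffAt.comp p
          (contMDiffAt_of_mem_maximalAtlas (IsManifold.subset_maximalAtlas hc) hps)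
      refine h1.congr_of_eventuallyEq ?_
      filter_upwards [c.open_source.mem_nhds hps] with q hq
      exact Set.indicator_of_mem hq _
    · have hp : p ∉ c.symm '' tsupport φ := by
        rintro ⟨u, hu, rfl⟩
        exact hps (c.map_target (hs hu))
      refine (contMDiffAt_const (c := (0 : V))).congr_of_eventuallyEq ?_
      filter_upwards [hclosed.isOpen_compl.mem_nhds hp] with q hq
      exact hzero q hq
  · rw [Set.indicator_of_mem (c.map_target hu), Function.comp_apply, c.right_inv hu]
  · refine closure_minimal (fun p hp => ?_) hclosed
    by_contra h
    exact hp (hzero p h)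
  · by_cases hps : p ∈ c.source
    · exact Or.inr ⟨c p, Set.indicator_of_mem hps _⟩
    · exact Or.inl (Set.indicator_of_notMem hps _)

end Extension

/-! ### Necessity: test fields and the fundamental lemma of the calculus of variations. -/

section Necessity

open MeasureTheory

variable {n : ℕ} {M : Type*} [TopologicalSpace M] [ChartedSpace (Eu n) M]
variable {S : Type*} [TopologicalSpace S] [ChartedSpace (Eu 2) S] [IsManifold (𝓡 2) ∞ S]

/-- There is a map to a chart of the target with a prescribed value and differential at a point. -/
theorem exists_field [T2Space S] [IsManifold (𝓡 n) ∞ M] {c : OpenPartialHomeomorph S (Eu 2)}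
    (hc : c ∈ atlas (Eu 2) S) {u₀ : Eu 2} (hu₀ : u₀ ∈ c.target)
    {e : OpenPartialHomeomorph M (Eu n)} (he : e ∈ atlas (Eu n) M) {y : Eu n}
    (hy : y ∈ e.target) (l : Eu 2 →L[ℝ] Eu n) :
    ∃ (F : Field n M S) (Y : Eu 2 → Eu n), (∀ s, F.A s = 0) ∧ ContDiff ℝ ∞ Y ∧
      (∀ u, Y u ∈ e.target) ∧ (∀ u ∈ c.target, F.X (c.symm u) = e.symm (Y u)) ∧ Y u₀ = y ∧
      fderiv ℝ Y u₀ = l := by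
  obtain ⟨r, hr, hball⟩ := Metric.isOpen_iff.mp e.open_target y hy
  -- A ball around `u₀` on which the affine map `y + l (u - u₀)` stays in the ball of radius `r`
  -- about `y` inside the target chart. Multiplying `l (u - u₀)` by a bump with values in `[0, 1]`
  -- preserves this bound, and does not change the value or the differential at `u₀`.
  have hA : {u | u ∈ c.target ∧ ‖l (u - u₀)‖ < r} ∈ nhds u₀ := by
    refine Filter.inter_mem (c.open_target.mem_nhds hu₀) ?_
    have hcont : Continuous fun u => ‖l (u - u₀)‖ := by fun_prop
    exact (isOpen_lt hcont continuous_const).mem_nhds (by simpa using hr)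
  obtain ⟨R, hR, hRA⟩ := Metric.nhds_basis_closedBall.mem_iff.mp hA
  let χ : ContDiffBump u₀ := ⟨R / 2, R, by linarith, by linarith⟩
  set φ : Eu 2 → Eu n := fun u => χ u • l (u - u₀) with hφdef
  have hφ : ContDiff ℝ ∞ φ :=
    χ.contDiff.smul (l.contDiff.comp (contDiff_id.sub contDiff_const))
  have hsupp : tsupport φ ⊆ Metric.closedBall u₀ R :=
    (tsupport_smul_subset_left χ _).trans χ.tsupport_eq.subset
  have hcomp : HasCompactSupport φ :=
    (isCompact_closedBall u₀ R).of_isClosed_subset (isClosed_tsupport _) hsupp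
  have hnorm : ∀ u, ‖φ u‖ < r := by
    intro u
    by_cases hu : φ u = 0
    · rwa [hu, norm_zero]
    · have h1 := (hRA (hsupp (subset_tsupport _ hu))).2
      refine lt_of_le_of_lt ?_ h1
      rw [hφdef, norm_smul, Real.norm_of_nonneg χ.nonneg]
      exact mul_le_of_le_one_left (norm_nonneg _) χ.le_one
  have hmem : ∀ v : Eu n, ‖v‖ < r → y + v ∈ e.target := fun v hv => hball (by simpa using hv)
  obtain ⟨Φ, hΦ, hΦc, -, hΦv⟩ := exists_extension hc hφ hcomp
    (hsupp.trans fun u hu => (hRA hu).1)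
  have hΦmem : ∀ p, y + Φ p ∈ e.target := by
    intro p
    rcases hΦv p with h | ⟨u, h⟩
    · rw [h]; exact hmem _ (by simpa using hr)
    · rw [h]; exact hmem _ (hnorm u)
  have hXs : ContMDiff (𝓡 2) (𝓡 n) ∞ fun p => e.symm (y + Φ p) :=
    (contMDiffOn_symm_of_mem_maximalAtlas (IsManifold.subset_maximalAtlas he)).comp_contMDiff
      (contMDiff_const.add hΦ) hΦmem
  refine ⟨⟨fun p => e.symm (y + Φ p), hXs, fun _ => 0, fun _ _ _ _ _ _ => contDiffOn_const⟩,
    fun u => y + φ u, fun _ => rfl, contDiff_const.add hφ, fun u => hmem _ (hnorm u),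
    fun u hu => ?_, ?_, ?_⟩
  · change e.symm (y + Φ (c.symm u)) = _
    rw [hΦc u hu]
  · simp [hφdef]
  · have h1 : (fun u => y + φ u) =ᶠ[nhds u₀] fun u => y + l (u - u₀) := by
      filter_upwards [χ.eventuallyEq_one] with u hu
      simp [hφdef, hu]
    rw [h1.fderiv_eq]
    have h2 : HasFDerivAt (fun u => y + l (u - u₀)) l u₀ :=
      (l.hasFDerivAt.comp u₀ ((hasFDerivAt_id u₀).sub_const u₀)).const_add y
    exact h2.fderiv

/-- The fundamental lemma: every test function on the chart domain extends by zero to an admissible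
`λ`, so the top coefficient vanishes almost everywhere, and everywhere by continuity. -/
theorem IsGaugeTransformation.topCoeff_eq_zero [T2Space S] [CompactSpace S]
    {T : TwistedPoisson n M} {ε : SectionMap n M S} (h : IsGaugeTransformation T ε)
    {c : OpenPartialHomeomorph S (Eu 2)} (hc : c ∈ atlas (Eu 2) S)
    {e : OpenPartialHomeomorph M (Eu n)} (he : e ∈ atlas (Eu n) M) {F : Field n M S}
    (hX : ∀ u ∈ dom c, F.X (c.symm u) ∈ e.source)
    {f : Tot (opProd (dom c) (dom e)) →ₐ[ℝ] Forms (dom c)} (hf : IsLift T F (dom c) c he f) :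
    topCoeff (f (epsHat (ε.comps hc le_rfl he) (T.comps (dom c) he).Htilde)) = 0 := by
  set t := topCoeff (f (epsHat (ε.comps hc le_rfl he) (T.comps (dom c) he).Htilde)) with ht
  have hcont : ContinuousOn (ext0 (dom c) t) c.target := t.2.continuousOn
  have hae := IsOpen.ae_eq_zero_of_integral_contDiff_smul_eq_zero (μ := volume) c.open_target
    (hcont.locallyIntegrableOn c.open_target.measurableSet) (fun g hg hgK hgs => by
      obtain ⟨Φ, hΦ, hΦc, hΦs, -⟩ := exists_extension hc hg hgK hgs
      have hl : tsupport Φ ⊆ c.symm '' (dom c : Set (Eu 2)) :=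
        hΦs.trans (Set.image_mono (f := c.symm) hgs)
      have h1 := h ⟨Φ, hΦ⟩ F c hc e he (dom c) le_rfl hX hl f hf
      rw [integral_variation T ε ⟨Φ, hΦ⟩ hc le_rfl he hl hX hf, ← ht] at h1
      rw [← h1]
      congr 1
      ext u
      by_cases hu : u ∈ dom c
      · have h2 := ext0_apply (dom c) t ⟨u, hu⟩
        have h3 := ext0_apply (dom c) (localFn ⟨Φ, hΦ⟩ hc le_rfl * t : Fn (dom c)) ⟨u, hu⟩
        simp only at h2 h3
        rw [h2, h3, ← hΦc u hu]
        rfl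
      · rw [ext0_eq_zero _ hu, ext0_eq_zero _ hu, smul_zero])
  have heq : Set.EqOn (ext0 (dom c) t) 0 c.target :=
    Measure.eqOn_open_of_ae_eq ((ae_restrict_iff' c.open_target.measurableSet).mpr hae)
      c.open_target hcont continuousOn_const
  ext u
  exact (ext0_apply (dom c) t u).symm.trans (heq u.2)

theorem IsGaugeTransformation.satisfiesEquation [T2Space S] [CompactSpace S]
    [IsManifold (𝓡 n) ∞ M] {T : TwistedPoisson n M} {ε : SectionMap n M S}
    (h : IsGaugeTransformation T ε) : SatisfiesEquation T ε := by
  intro s e he y hy i j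
  set c := chartAt (Eu 2) s with hcdef
  have hc : c ∈ atlas (Eu 2) S := chart_mem_atlas _ s
  have hu₀ : c s ∈ c.target := mem_chart_target _ s
  have hs : c.symm (c s) = s := c.left_inv (mem_chart_source _ s)
  -- The differential of `X` at the point sends `∂_0` to `∂_i` and `∂_1` to `∂_j`, so that the pull
  -- back of a `2`-form on `M` has top coefficient equal to its `(i, j)` component there.
  obtain ⟨F, Y, hFA, hY, hYm, hFX, hYu, hYd⟩ := exists_field hc hu₀ he hy
    ((EuclideanSpace.proj 0 : Eu 2 →L[ℝ] ℝ).smulRight (bas i : Eu n)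
      + (EuclideanSpace.proj 1 : Eu 2 →L[ℝ] ℝ).smulRight (bas j : Eu n))
  have hX : ∀ u ∈ dom c, F.X (c.symm u) ∈ e.source := fun u hu => by
    rw [hFX u hu]; exact e.map_target (hYm u)
  have hXe : ∀ u ∈ dom c, e (F.X (c.symm u)) = Y u := fun u hu => by
    rw [hFX u hu, e.right_inv (hYm u)]
  obtain ⟨f, hf, hth⟩ := exists_isLift (N := dom c) T hFA he hY (fun u _ => hYm u) hXe
  have h0 := h.topCoeff_eq_zero hc he hX hf
  have hT := T.isTwisted_comps (dom c) he
  set w : opProd (dom c) (dom e) := ⟨(c s, y), hu₀, hy⟩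
  set τ := (T.comps (dom c) he).twist (ε.comps hc le_rfl he) with hτ
  have hD : ∀ k l, (τ k l : opProd (dom c) (dom e) → ℝ) w = twistedDiff T ε s e k l y := by
    intro k l
    have := twist_comps_apply T he ε hc le_rfl k l w
    rw [← hτ] at this
    rw [this]
    change twistedDiff T ε (c.symm (c s)) e k l y = _
    rw [hs]
  choose g hg hgu using fun k l => hf.base (τ k l)
  have hgw : ∀ k l, (g k l : dom c → ℝ) ⟨c s, hu₀⟩ = twistedDiff T ε s e k l y := by
    intro k l
    rw [hgu, ← hD]
    change ext0 _ _ (c s, e (F.X (c.symm (c s)))) = _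
    rw [hXe _ hu₀, hYu]
    exact ext0_apply _ _ w
  have htop : topCoeff (f (epsHat (ε.comps hc le_rfl he) (T.comps (dom c) he).Htilde))
      = (-1 / 2 : ℝ) • ∑ k, ∑ l, g k l *
        (Fn.partial (bas 0) (compFn (dom c) hY k) * Fn.partial (bas 1) (compFn (dom c) hY l)
          - Fn.partial (bas 1) (compFn (dom c) hY k)
            * Fn.partial (bas 0) (compFn (dom c) hY l)) := by
    rw [hT.epsHat_Htilde, map_smul, map_smul, bil]
    simp only [map_sum, map_mul f, hth, ← hτ, hg, topCoeff_deRham_mul_deRham]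
  have hY0 : ∀ k, fderiv ℝ Y (c s) (bas 0) k = (bas i : Eu n) k := fun k => by rw [hYd]; simp
  have hY1 : ∀ k, fderiv ℝ Y (c s) (bas 1) k = (bas j : Eu n) k := fun k => by rw [hYd]; simp
  have hval := congrFun (congrArg Subtype.val (htop.symm.trans h0)) ⟨c s, hu₀⟩
  -- The antisymmetrized Kronecker symbols leave `-½ (τ_{ij} - τ_{ji})`, which is `-τ_{ij}` by
  -- antisymmetry.
  have hval' : (-1 / 2 : ℝ) * ∑ k, ∑ l, twistedDiff T ε s e k l y *
      ((bas i : Eu n) k * (bas j : Eu n) l - (bas j : Eu n) k * (bas i : Eu n) l) = 0 := by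
    refine Eq.trans ?_ hval
    simp only [Subalgebra.coe_smul, Pi.smul_apply, smul_eq_mul, coe_sum_fn, Subalgebra.coe_mul,
      Pi.mul_apply, Subalgebra.coe_sub, Pi.sub_apply, partial_compFn_apply, hY0, hY1, hgw]
  have hswap : twistedDiff T ε s e j i y = -twistedDiff T ε s e i j y := by
    rw [← hD, ← hD, hτ, hT.twist_swap]; rfl
  simp [mul_sub, Finset.sum_sub_distrib, hswap] at hval'
  linarith

end Necessity

end TwistedPSM

end

theorem mainTheorem1 {n : ℕ} {S : Type*} [TopologicalSpace S] [ChartedSpace (EuclideanSpace ℝ (Fin 2)) S]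
    [IsManifold (𝓡 2) ∞ S] [T2Space S] [CompactSpace S]
    {M : Type*} [TopologicalSpace M] [ChartedSpace (EuclideanSpace ℝ (Fin n)) M]
    [IsManifold (𝓡 n) ∞ M] [T2Space M] [SecondCountableTopology M]
    (T : TwistedPSM.TwistedPoisson n M) (ε : TwistedPSM.SectionMap n M S) :
    (TwistedPSM.IsGaugeTransformation T ε ↔ TwistedPSM.SatisfiesEquation T ε) ∧
    (TwistedPSM.IsBasicFor T ε ↔ TwistedPSM.SatisfiesEquation T ε) :=
  ⟨⟨TwistedPSM.IsGaugeTransformation.satisfiesEquation,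
    TwistedPSM.SatisfiesEquation.isGaugeTransformation⟩, TwistedPSM.isBasicFor_iff T ε⟩
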